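/- Let $\mathbb K\in\{\mathbb R,\mathbb C\}$, let $M$ be a connected, Hausdorff, paracompact smooth manifold of dimension $m$, let $\mathfrak k$ be a finite-dimensional $\mathbb K$-Lie algebra, and let $\mathbb L\to M$ be a bundle of Lie algebras with fiber $\mathfrak k$, i.e. a smooth $\mathbb K$-vector bundle with fiber $\mathfrak k$ given by a bundle atlas whose transition maps take values in $\operatorname{Aut}(\mathfrak k)$; each fiber $\mathbb L_x$ carries the Lie bracket for which the bundle charts $\mathbb L_x\to\mathfrak k$ are isomorphisms of Lie algebras, and the space $\Gamma(\mathbb L)$ of smooth sections carries the pointwise bracket. For a Lie algebra $\mathfrak g$ let $\operatorname{Der}(\mathfrak g)$ be the space of its derivations and $\operatorname{Cent}(\mathfrak g)=\{f\in\operatorname{End}(\mathfrak g): f[u,v]=[u,f(v)]\text{ for all }u,v\in\mathfrak g\}$ its centroid; $\operatorname{Der}(\mathbb L)$ and $\operatorname{Cent}(\mathbb L)$ are the vector bundles with fibers $\operatorname{Der}(\mathbb L_x)$ and $\operatorname{Cent}(\mathbb L_x)$, whose charts are conjugation with the bundle charts of $\mathbb L$. For $x\in M$, an $x$-derivation is a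 $\mathbb K$-linear map $\delta:\Gamma(\mathbb L)\to\mathbb L_x$ with $\delta[X,Y]=[\delta(X),Y_x]+[X_x,\delta(Y)]$ for all $X,Y\in\Gamma(\mathbb L)$; let $\mathcal D_x(\mathbb L)$ be the vector space of all $x$-derivations and $\mathcal D(\mathbb L)=\bigcup_{x\in M}\mathcal D_x(\mathbb L)$. Suppose that $\mathfrak k$ is perfect ($[\mathfrak k,\mathfrak k]=\mathfrak k$) or centerfree ($\mathfrak z(\mathfrak k)=0$). Then: 1. Every $x$-derivation $\delta$ is a differential operator of order at most $1$: for every bundle chart $\varphi$ of $\mathbb L$ around $x$ and every chart $\xi$ of $M$ around $x$ there are linear maps $D,S^1,\dots,S^m:\mathfrak k\to\mathbb L_x$ such that $\delta(X)=D(X^\varphi(x))+\sum_{i=1}^m S^i(\partial_{\xi_i}X^\varphi(x))$ for all $X\in\Gamma(\mathbb L)$, where $X^\varphi$ is the local form of $X$. 2. There is a structure of a smooth vector bundle on $\mathcal D(\mathbb L)\to M$, with fibers $\mathcal D_x(\mathbb L)$ and typical fiber $\operatorname{Der}(\mathfrak k)\times\operatorname{Cent}(\mathfrak k)^m$, such that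 $D\mapsto(x\mapsto \operatorname{ev}_x\circ D)$, where $\operatorname{ev}_x(X)=X_x$, is a linear isomorphism from $\operatorname{Der}(\Gamma(\mathbb L))$ onto the space $\Gamma(\mathcal D(\mathbb L))$ of its smooth sections, and such that there is a short exact sequence of smooth vector bundles $$0\longrightarrow \operatorname{Der}(\mathbb L)\overset{i}{\longrightarrow}\mathcal D(\mathbb L)\overset{\sigma}{\longrightarrow}TM\otimes_{\mathbb R}\operatorname{Cent}(\mathbb L)\longrightarrow 0,$$ where $i(D)(X)=D(X_x)$ for $D\in\operatorname{Der}(\mathbb L_x)$, and $\sigma$ is the symbol map: under the identification $T_xM\otimes_{\mathbb R}\operatorname{Cent}(\mathbb L_x)=\operatorname{Hom}_{\mathbb R}(T_x^*M,\operatorname{Cent}(\mathbb L_x))$, $v\otimes f\mapsto(\alpha\mapsto\alpha(v)f)$, one has $\sigma(\delta)(T_xa)(A_x)=\delta(aA)-a(x)\,\delta(A)$ for all $\delta\in\mathcal D_x(\mathbb L)$, $a\in C^\infty(M,\mathbb R)$ and $A\in\Gamma(\mathbb L)$. -/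

import Mathlib

open scoped Manifold ContDiff TensorProduct

noncomputable section

/-! ### Smooth functions with values in finite-dimensional vector spaces -/

section Smooth

variable (m : ℕ) (𝕂 : Type*) [RCLike 𝕂]
  {M : Type*} [TopologicalSpace M] [ChartedSpace (EuclideanSpace ℝ (Fin m)) M]
  {V W P : Type*} [AddCommGroup V] [Module 𝕂 V] [AddCommGroup W] [Module 𝕂 W]
  [AddCommGroup P] [Module 𝕂 P]

/-- `f` is a `C^∞`-map on `s ⊆ M` with values in the finite-dimensional `𝕂`-vector space `V`:
all its coordinates (equivalently, all `ℓ ∘ f` for linear functionals `ℓ`) are `C^∞` in the real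
sense. -/
def SmoothMapOn (f : M → V) (s : Set M) : Prop :=
  ∀ ℓ : Module.Dual 𝕂 V, ContMDiffOn (𝓡 m) 𝓘(ℝ, 𝕂) ∞ (fun x => ℓ (f x)) s

variable {m 𝕂}

theorem SmoothMapOn.congr {f g : M → V} {s : Set M} (hf : SmoothMapOn m 𝕂 f s)
    (h : ∀ x ∈ s, g x = f x) : SmoothMapOn m 𝕂 g s :=
  fun ℓ => (hf ℓ).congr fun x hx => by rw [h x hx]

theorem SmoothMapOn.mono {f : M → V} {s t : Set M} (hf : SmoothMapOn m 𝕂 f s)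
    (h : t ⊆ s) : SmoothMapOn m 𝕂 f t :=
  fun ℓ => (hf ℓ).mono h

theorem SmoothMapOn.zero {s : Set M} : SmoothMapOn m 𝕂 (fun _ : M => (0 : V)) s :=
  fun ℓ => by simpa using contMDiffOn_const

theorem SmoothMapOn.const (v : V) {s : Set M} : SmoothMapOn m 𝕂 (fun _ : M => v) s :=
  fun _ => contMDiffOn_const

theorem SmoothMapOn.add {f g : M → V} {s : Set M} (hf : SmoothMapOn m 𝕂 f s)
    (hg : SmoothMapOn m 𝕂 g s) : SmoothMapOn m 𝕂 (fun x => f x + g x) s :=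
  fun ℓ => ((hf ℓ).add (hg ℓ)).congr fun x _ => by simp

theorem SmoothMapOn.sum {ι : Type*} (t : Finset ι) {f : ι → M → V} {s : Set M}
    (hf : ∀ i ∈ t, SmoothMapOn m 𝕂 (f i) s) : SmoothMapOn m 𝕂 (fun x => ∑ i ∈ t, f i x) s := by
  classical
  induction t using Finset.induction_on with
  | empty => simpa using SmoothMapOn.zero
  | insert a t ha ih =>
    refine ((hf a (by simp)).add (ih fun i hi => hf i (by simp [hi]))).congr fun x _ => ?_
    rw [Finset.sum_insert ha]

theorem contMDiffOn_mul_rclike {f g : M → 𝕂} {s : Set M}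
    (hf : ContMDiffOn (𝓡 m) 𝓘(ℝ, 𝕂) ∞ f s) (hg : ContMDiffOn (𝓡 m) 𝓘(ℝ, 𝕂) ∞ g s) :
    ContMDiffOn (𝓡 m) 𝓘(ℝ, 𝕂) ∞ (fun x => f x * g x) s :=
  (contDiff_mul (𝕜 := ℝ) (𝔸 := 𝕂)).contMDiff.comp_contMDiffOn (hf.prodMk_space hg)

theorem SmoothMapOn.smul {a : M → 𝕂} {f : M → V} {s : Set M}
    (ha : ContMDiffOn (𝓡 m) 𝓘(ℝ, 𝕂) ∞ a s) (hf : SmoothMapOn m 𝕂 f s) :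
    SmoothMapOn m 𝕂 (fun x => a x • f x) s :=
  fun ℓ => by simpa using contMDiffOn_mul_rclike ha (hf ℓ)

theorem SmoothMapOn.map (T : V →ₗ[𝕂] W) {f : M → V} {s : Set M} (hf : SmoothMapOn m 𝕂 f s) :
    SmoothMapOn m 𝕂 (fun x => T (f x)) s :=
  fun ℓ => hf (ℓ ∘ₗ T)

theorem SmoothMapOn.of_injective (T : V →ₗ[𝕂] W) (hT : Function.Injective T) {f : M → V}
    {s : Set M} (hf : SmoothMapOn m 𝕂 (fun x => T (f x)) s) : SmoothMapOn m 𝕂 f s := by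
  obtain ⟨S, hS⟩ := LinearMap.exists_leftInverse_of_injective T (LinearMap.ker_eq_bot.2 hT)
  refine (hf.map S).congr fun x _ => ?_
  exact (LinearMap.congr_fun hS (f x)).symm

/-- A bilinear operation applied to smooth maps gives a smooth map. -/
theorem SmoothMapOn.bilin [FiniteDimensional 𝕂 V] (β : V →ₗ[𝕂] W →ₗ[𝕂] P)
    {f : M → V} {g : M → W} {s : Set M}
    (hf : SmoothMapOn m 𝕂 f s) (hg : SmoothMapOn m 𝕂 g s) :
    SmoothMapOn m 𝕂 (fun x => β (f x) (g x)) s := by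
  let b := Module.finBasis 𝕂 V
  have : SmoothMapOn m 𝕂 (fun x => ∑ k, b.coord k (f x) • β (b k) (g x)) s :=
    SmoothMapOn.sum _ fun k _ => SmoothMapOn.smul (hf (b.coord k)) (hg.map (β (b k)))
  refine this.congr fun x _ => ?_
  conv_lhs => rw [← b.sum_repr (f x)]
  simp only [map_sum, map_smul, LinearMap.sum_apply, LinearMap.smul_apply,
    Module.Basis.coord_apply]

theorem SmoothMapOn.extend {g : M → V} {s : Set M} {F : s → V} (hg : SmoothMapOn m 𝕂 g s)
    (h : ∀ x : s, g x = F x) : SmoothMapOn m 𝕂 (Function.extend Subtype.val F 0) s :=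
  hg.congr fun x hx => by
    rw [h ⟨x, hx⟩]
    exact Subtype.val_injective.extend_apply F 0 ⟨x, hx⟩

/-- A map into a space of homomorphisms is smooth if it is pointwise smooth. -/
theorem SmoothMapOn.of_apply [FiniteDimensional 𝕂 V] {G : M → V →ₗ[𝕂] W} {s : Set M}
    (h : ∀ v, SmoothMapOn m 𝕂 (fun x => G x v) s) : SmoothMapOn m 𝕂 G s := by
  let b := Module.finBasis 𝕂 V
  have : SmoothMapOn m 𝕂 (fun x => ∑ k, LinearMap.smulRightₗ (b.coord k) (G x (b k))) s :=
    SmoothMapOn.sum _ fun k _ => (h (b k)).map (LinearMap.smulRightₗ (b.coord k))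
  refine this.congr fun x _ => b.ext fun j => ?_
  simp [Finsupp.single_apply]

end Smooth

/-! ### Smooth vector bundles -/

/-- A smooth `𝕂`-vector bundle (`𝕂 = ℝ` or `ℂ`) with fiber `V` over the real `m`-dimensional
manifold `M`, given by its fibers `E x` and a bundle atlas: open sets `U i` covering `M`,
linear isomorphisms `chart i x : E x → V` for `x ∈ U i`, and transition maps
`x ↦ chart j x ∘ (chart i x)⁻¹` that are `C^∞` on `U i ∩ U j`.
The total space is the disjoint union of the fibers; its manifold structure is the unique one for
which all `(x, v) ↦ (x, chart i x v)` are diffeomorphisms onto `U i × V`. -/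
structure SmoothVectorBundle (m : ℕ) (𝕂 : Type*) [RCLike 𝕂]
    (M : Type*) [TopologicalSpace M] [ChartedSpace (EuclideanSpace ℝ (Fin m)) M]
    (V : Type*) [AddCommGroup V] [Module 𝕂 V]
    (E : M → Type*) [∀ x, AddCommGroup (E x)] [∀ x, Module 𝕂 (E x)] where
  ι : Type*
  U : ι → Set M
  isOpen_U : ∀ i, IsOpen (U i)
  cover : ∀ x, ∃ i, x ∈ U i
  chart : ∀ (i : ι) (x : M), x ∈ U i → (E x ≃ₗ[𝕂] V)
  smooth_transition : ∀ (i j : ι) (v : V), SmoothMapOn m 𝕂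
    (Function.extend Subtype.val
      (fun x : ↥(U i ∩ U j) => chart j x x.2.2 ((chart i x x.2.1).symm v)) 0) (U i ∩ U j)

namespace SmoothVectorBundle

section Basic

variable {m : ℕ} {𝕂 : Type*} [RCLike 𝕂]
  {M : Type*} [TopologicalSpace M] [ChartedSpace (EuclideanSpace ℝ (Fin m)) M]
  {V : Type*} [AddCommGroup V] [Module 𝕂 V]
  {E : M → Type*} [∀ x, AddCommGroup (E x)] [∀ x, Module 𝕂 (E x)]
  (A : SmoothVectorBundle m 𝕂 M V E)

/-- The local form of a (not necessarily smooth) section in the bundle chart `i`; it is extended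
by zero outside `U i`. -/
def localForm (i : A.ι) (X : ∀ x, E x) : M → V :=
  Function.extend Subtype.val (fun x : ↥(A.U i) => A.chart i x x.2 (X x)) 0

theorem localForm_of_mem (i : A.ι) (X : ∀ x, E x) {x : M} (hx : x ∈ A.U i) :
    A.localForm i X x = A.chart i x hx (X x) :=
  Subtype.val_injective.extend_apply (fun x : ↥(A.U i) => A.chart i x x.2 (X x)) 0 ⟨x, hx⟩

/-- The space `Γ(E)` of smooth sections. -/
def sections : Submodule 𝕂 (∀ x, E x) where
  carrier := {X | ∀ i, SmoothMapOn m 𝕂 (A.localForm i X) (A.U i)}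
  zero_mem' := fun i => SmoothMapOn.zero.congr fun x hx => by
    rw [A.localForm_of_mem i _ hx]; simp
  add_mem' := fun {X Y} hX hY i => ((hX i).add (hY i)).congr fun x hx => by
    rw [A.localForm_of_mem i _ hx, A.localForm_of_mem i _ hx, A.localForm_of_mem i _ hx]; simp
  smul_mem' := fun c X hX i => (SmoothMapOn.smul (a := fun _ => c) contMDiffOn_const (hX i)).congr
    fun x hx => by rw [A.localForm_of_mem i _ hx, A.localForm_of_mem i _ hx]; simp

/-- The product `a A` of a real-valued smooth function and a smooth section. -/
def smulSection (a : C^∞⟮𝓡 m, M; 𝓘(ℝ, ℝ), ℝ⟯) (X : A.sections) : A.sections :=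
  ⟨fun x => ((a x : ℝ) : 𝕂) • X.1 x, fun i => by
    have ha : ContMDiffOn (𝓡 m) 𝓘(ℝ, 𝕂) ∞ (fun x => ((a x : ℝ) : 𝕂)) (A.U i) :=
      (RCLike.ofRealCLM (K := 𝕂)).contDiff.contMDiff.comp_contMDiffOn a.contMDiff.contMDiffOn
    refine (SmoothMapOn.smul ha (X.2 i)).congr fun x hx => ?_
    rw [A.localForm_of_mem i _ hx, A.localForm_of_mem i _ hx]; simp⟩

end Basic

section Morphism

variable {m : ℕ} {𝕂 : Type*} [RCLike 𝕂]
  {M : Type*} [TopologicalSpace M] [ChartedSpace (EuclideanSpace ℝ (Fin m)) M]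
  {V₁ : Type*} [AddCommGroup V₁] [Module 𝕂 V₁]
  {E₁ : M → Type*} [∀ x, AddCommGroup (E₁ x)] [∀ x, Module 𝕂 (E₁ x)]
  {V₂ : Type*} [AddCommGroup V₂] [Module 𝕂 V₂]
  {E₂ : M → Type*} [∀ x, AddCommGroup (E₂ x)] [∀ x, Module 𝕂 (E₂ x)]

/-- A family of linear maps `κ x : E₁ x → E₂ x` is a (smooth) vector bundle morphism if it is
smooth in bundle charts, i.e. `x ↦ chart₂ j x ∘ κ x ∘ (chart₁ i x)⁻¹` is `C^∞` on
`U₁ i ∩ U₂ j`. -/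
def IsBundleMorphism (A : SmoothVectorBundle m 𝕂 M V₁ E₁) (B : SmoothVectorBundle m 𝕂 M V₂ E₂)
    (κ : ∀ x, E₁ x →ₗ[𝕂] E₂ x) : Prop :=
  ∀ (i : A.ι) (j : B.ι) (v : V₁), SmoothMapOn m 𝕂
    (Function.extend Subtype.val
      (fun x : ↥(A.U i ∩ B.U j) => B.chart j x x.2.2 (κ x ((A.chart i x x.2.1).symm v))) 0)
    (A.U i ∩ B.U j)

end Morphism

end SmoothVectorBundle

/-! ### Differential operators at a point -/

section DiffOp

variable {m : ℕ} {𝕂 : Type*} [RCLike 𝕂]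
  {M : Type*} [TopologicalSpace M] [ChartedSpace (EuclideanSpace ℝ (Fin m)) M]
  {V : Type*} [AddCommGroup V] [Module 𝕂 V] [FiniteDimensional 𝕂 V]

variable (𝕂) in
/-- The partial derivative `∂_{ξ_i} f` of a `V`-valued map in the chart `ξ`,
`(∂_{ξ_i} f)(x) = d/dt|_{t=0} f(ξ⁻¹(ξ(x) + t e_i))`, the derivative being taken componentwise with
respect to a basis of the finite-dimensional space `V`. -/
def chartPartialDeriv (ξ : OpenPartialHomeomorph M (EuclideanSpace ℝ (Fin m))) (i : Fin m)
    (f : M → V) (x : M) : V :=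
  ∑ k, deriv (fun t : ℝ => (Module.finBasis 𝕂 V).coord k
    (f (ξ.symm (ξ x + t • EuclideanSpace.single i (1 : ℝ))))) 0 • Module.finBasis 𝕂 V k

variable (𝕂) in
/-- The iterated partial derivative `∂_ξ^α f = ∂_{ξ_1}^{α_1} ⋯ ∂_{ξ_m}^{α_m} f`. -/
def chartMultiDeriv (ξ : OpenPartialHomeomorph M (EuclideanSpace ℝ (Fin m))) (α : Fin m → ℕ)
    (f : M → V) : M → V :=
  (List.finRange m).foldr (fun i g => (chartPartialDeriv 𝕂 ξ i)^[α i] g) f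

/-- A linear map `δ` from the smooth sections to a vector space `W` is a differential operator of
order at most `n` at the point `x`: with respect to every bundle chart `i` around `x` and every
chart `ξ` of `M` around `x` it has the form `δ(X) = ∑_{|α| ≤ n} c_α (∂_ξ^α X^i (x))` with linear
maps `c_α : V → W`, where `X^i` is the local form of `X`. -/
def IsDiffOpOfOrderLEAt {E : M → Type*} [∀ x, AddCommGroup (E x)] [∀ x, Module 𝕂 (E x)]
    (A : SmoothVectorBundle m 𝕂 M V E) {W : Type*} [AddCommGroup W] [Module 𝕂 W]
    (n : ℕ) (x : M) (δ : A.sections →ₗ[𝕂] W) : Prop :=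
  ∀ i : A.ι, x ∈ A.U i → ∀ ξ ∈ IsManifold.maximalAtlas (𝓡 m) ∞ M, x ∈ ξ.source →
    ∃ c : (Fin m → ℕ) → (V →ₗ[𝕂] W), ∀ X : A.sections,
      δ X = ∑ α ∈ (Fintype.piFinset fun _ : Fin m => Finset.range (n + 1)) with ∑ i, α i ≤ n,
        c α (chartMultiDeriv 𝕂 ξ α (A.localForm i X.1) x)

end DiffOp

/-! ### Centroid and conjugation of derivations and centroid elements -/

section LieAlg

variable (𝕂 : Type*) [RCLike 𝕂] (𝔤 : Type*) [LieRing 𝔤] [LieAlgebra 𝕂 𝔤]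

/-- The centroid `Cent(𝔤)`: linear endomorphisms commuting with all `ad x`. -/
def lieCentroid : Submodule 𝕂 (𝔤 →ₗ[𝕂] 𝔤) where
  carrier := {f | ∀ x y : 𝔤, f ⁅x, y⁆ = ⁅x, f y⁆}
  zero_mem' := fun x y => by simp
  add_mem' := fun {f g} hf hg x y => by simp [hf x y, hg x y]
  smul_mem' := fun c f hf x y => by simp [hf x y]

/-- The real vector space structure underlying the `𝕂`-vector space `Cent(𝔤)`. -/
instance lieCentroid.instModuleReal : Module ℝ (lieCentroid 𝕂 𝔤) :=
  Module.compHom (lieCentroid 𝕂 𝔤) (algebraMap ℝ 𝕂)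

theorem lieCentroid.real_smul_def (r : ℝ) (f : lieCentroid 𝕂 𝔤) : r • f = (r : 𝕂) • f := rfl

instance lieCentroid.instSMulCommClass : SMulCommClass ℝ 𝕂 (lieCentroid 𝕂 𝔤) where
  smul_comm r c f := by
    rw [lieCentroid.real_smul_def, lieCentroid.real_smul_def, smul_comm]

instance lieCentroid.instIsScalarTower : IsScalarTower ℝ 𝕂 (lieCentroid 𝕂 𝔤) where
  smul_assoc r c f := by
    rw [lieCentroid.real_smul_def, RCLike.real_smul_eq_coe_mul, mul_smul]

variable {𝕂 𝔤} {𝔥 : Type*} [LieRing 𝔥] [LieAlgebra 𝕂 𝔥]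

/-- Conjugation `D ↦ e ∘ D ∘ e⁻¹` of derivations by an isomorphism of Lie algebras. -/
def derConj (e : 𝔤 ≃ₗ⁅𝕂⁆ 𝔥) : LieDerivation 𝕂 𝔤 𝔤 ≃ₗ[𝕂] LieDerivation 𝕂 𝔥 𝔥 where
  toFun D :=
    { toLinearMap := e.toLinearEquiv.toLinearMap ∘ₗ D.toLinearMap ∘ₗ
        e.symm.toLinearEquiv.toLinearMap
      leibniz' := fun a b => by
        have h1 : e.symm ⁅a, b⁆ = ⁅e.symm a, e.symm b⁆ := e.symm.map_lie' (x := a) (y := b)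
        have h2 : ∀ u v, e ⁅u, v⁆ = ⁅e u, e v⁆ := fun u v => e.map_lie' (x := u) (y := v)
        show e (D (e.symm ⁅a, b⁆)) = ⁅a, e (D (e.symm b))⁆ - ⁅b, e (D (e.symm a))⁆
        rw [h1, D.apply_lie_eq_sub]
        have h3 : e (⁅e.symm a, D (e.symm b)⁆ - ⁅e.symm b, D (e.symm a)⁆) =
          e ⁅e.symm a, D (e.symm b)⁆ - e ⁅e.symm b, D (e.symm a)⁆ :=
            e.toLinearEquiv.map_sub _ _
        rw [h3, h2, h2, e.apply_symm_apply, e.apply_symm_apply] }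
  invFun D :=
    { toLinearMap := e.symm.toLinearEquiv.toLinearMap ∘ₗ D.toLinearMap ∘ₗ
        e.toLinearEquiv.toLinearMap
      leibniz' := fun a b => by
        have h1 : e ⁅a, b⁆ = ⁅e a, e b⁆ := e.map_lie' (x := a) (y := b)
        have h2 : ∀ u v, e.symm ⁅u, v⁆ = ⁅e.symm u, e.symm v⁆ :=
          fun u v => e.symm.map_lie' (x := u) (y := v)
        show e.symm (D (e ⁅a, b⁆)) = ⁅a, e.symm (D (e b))⁆ - ⁅b, e.symm (D (e a))⁆
        rw [h1, D.apply_lie_eq_sub]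
        have h3 : e.symm (⁅e a, D (e b)⁆ - ⁅e b, D (e a)⁆) =
          e.symm ⁅e a, D (e b)⁆ - e.symm ⁅e b, D (e a)⁆ :=
            e.symm.toLinearEquiv.map_sub _ _
        rw [h3, h2, h2, e.symm_apply_apply, e.symm_apply_apply] }
  map_add' D D' := by
    ext a
    exact e.toLinearEquiv.map_add _ _
  map_smul' c D := by
    ext a
    exact e.toLinearEquiv.map_smul _ _
  left_inv D := by
    ext a
    show e.symm (e (D (e.symm (e a)))) = D a
    rw [e.symm_apply_apply, e.symm_apply_apply]
  right_inv D := by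
    ext a
    show e (e.symm (D (e (e.symm a)))) = D a
    rw [e.apply_symm_apply, e.apply_symm_apply]

theorem derConj_apply (e : 𝔤 ≃ₗ⁅𝕂⁆ 𝔥) (D : LieDerivation 𝕂 𝔤 𝔤) (a : 𝔥) :
    derConj e D a = e (D (e.symm a)) := rfl

theorem derConj_symm_apply (e : 𝔤 ≃ₗ⁅𝕂⁆ 𝔥) (D : LieDerivation 𝕂 𝔥 𝔥) (a : 𝔤) :
    (derConj e).symm D a = e.symm (D (e a)) := rfl

/-- Conjugation `f ↦ e ∘ f ∘ e⁻¹` of centroid elements by an isomorphism of Lie algebras. -/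
def centConj (e : 𝔤 ≃ₗ⁅𝕂⁆ 𝔥) : lieCentroid 𝕂 𝔤 ≃ₗ[𝕂] lieCentroid 𝕂 𝔥 where
  toFun f := ⟨e.toLinearEquiv.toLinearMap ∘ₗ f.1 ∘ₗ e.symm.toLinearEquiv.toLinearMap,
    fun a b => by
      have h1 : e.symm ⁅a, b⁆ = ⁅e.symm a, e.symm b⁆ := e.symm.map_lie' (x := a) (y := b)
      have h2 : ∀ u v, e ⁅u, v⁆ = ⁅e u, e v⁆ := fun u v => e.map_lie' (x := u) (y := v)
      show e (f.1 (e.symm ⁅a, b⁆)) = ⁅a, e (f.1 (e.symm b))⁆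
      rw [h1, f.2 _ _, h2, e.apply_symm_apply]⟩
  invFun f := ⟨e.symm.toLinearEquiv.toLinearMap ∘ₗ f.1 ∘ₗ e.toLinearEquiv.toLinearMap,
    fun a b => by
      have h1 : e ⁅a, b⁆ = ⁅e a, e b⁆ := e.map_lie' (x := a) (y := b)
      have h2 : ∀ u v, e.symm ⁅u, v⁆ = ⁅e.symm u, e.symm v⁆ :=
        fun u v => e.symm.map_lie' (x := u) (y := v)
      show e.symm (f.1 (e ⁅a, b⁆)) = ⁅a, e.symm (f.1 (e b))⁆
      rw [h1, f.2 _ _, h2, e.symm_apply_apply]⟩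
  map_add' f g := by
    ext a
    exact e.toLinearEquiv.map_add _ _
  map_smul' c f := by
    ext a
    exact e.toLinearEquiv.map_smul _ _
  left_inv f := by
    ext a
    show e.symm (e (f.1 (e.symm (e a)))) = f.1 a
    rw [e.symm_apply_apply, e.symm_apply_apply]
  right_inv f := by
    ext a
    show e (e.symm (f.1 (e (e.symm a)))) = f.1 a
    rw [e.apply_symm_apply, e.apply_symm_apply]

theorem centConj_apply (e : 𝔤 ≃ₗ⁅𝕂⁆ 𝔥) (f : lieCentroid 𝕂 𝔤) (a : 𝔥) :
    (centConj e f).1 a = e (f.1 (e.symm a)) := rfl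

theorem centConj_symm_apply (e : 𝔤 ≃ₗ⁅𝕂⁆ 𝔥) (f : lieCentroid 𝕂 𝔥) (a : 𝔤) :
    ((centConj e).symm f).1 a = e.symm (f.1 (e a)) := rfl

end LieAlg

/-! ### Bundles of Lie algebras -/

/-- The fiber `Cent(L x) ⊗_ℝ T_x M` of `Cent(L) ⊗ TM`, a `𝕂`-vector space through its left
factor. -/
def CentTensorTangent (m : ℕ) (𝕂 : Type*) [RCLike 𝕂]
    {M : Type*} [TopologicalSpace M] [ChartedSpace (EuclideanSpace ℝ (Fin m)) M]
    (L : M → Type*) [∀ x, LieRing (L x)] [∀ x, LieAlgebra 𝕂 (L x)] (x : M) : Type _ :=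
  lieCentroid 𝕂 (L x) ⊗[ℝ] TangentSpace (𝓡 m) x

namespace CentTensorTangent

variable {m : ℕ} {𝕂 : Type*} [RCLike 𝕂]
  {M : Type*} [TopologicalSpace M] [ChartedSpace (EuclideanSpace ℝ (Fin m)) M]
  {L : M → Type*} [∀ x, LieRing (L x)] [∀ x, LieAlgebra 𝕂 (L x)]

instance instAddCommGroup (x : M) : AddCommGroup (CentTensorTangent m 𝕂 L x) :=
  inferInstanceAs (AddCommGroup (lieCentroid 𝕂 (L x) ⊗[ℝ] TangentSpace (𝓡 m) x))

instance instModule (x : M) : Module 𝕂 (CentTensorTangent m 𝕂 L x) :=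
  inferInstanceAs (Module 𝕂 (lieCentroid 𝕂 (L x) ⊗[ℝ] TangentSpace (𝓡 m) x))

/-- The identification of `Cent(L x) ⊗ T_x M` with `Hom(T_x^* M, Cent(L x))`: the element `A ⊗ v`
sends the covector `α` to `α(v) A`. Here the value at `α` of `t` is `contract α t`. -/
def contract (x : M) (α : TangentSpace (𝓡 m) x →ₗ[ℝ] ℝ) (t : CentTensorTangent m 𝕂 L x) :
    lieCentroid 𝕂 (L x) :=
  TensorProduct.lift ((LinearMap.lsmul ℝ (lieCentroid 𝕂 (L x))).flip.compl₂ α) t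

theorem contract_tmul (x : M) (α : TangentSpace (𝓡 m) x →ₗ[ℝ] ℝ) (f : lieCentroid 𝕂 (L x))
    (v : TangentSpace (𝓡 m) x) : contract (m := m) x α (f ⊗ₜ[ℝ] v) = α v • f := by
  rfl

end CentTensorTangent

/-- A bundle of Lie algebras with fiber `𝔨`: a smooth vector bundle with an `Aut(𝔨)`-valued
cocycle. The Lie brackets on the fibers `L x` are those for which all bundle charts
`L x → 𝔨` are isomorphisms of Lie algebras. -/
structure LieAlgebraBundle (m : ℕ) (𝕂 : Type*) [RCLike 𝕂]
    (M : Type*) [TopologicalSpace M] [ChartedSpace (EuclideanSpace ℝ (Fin m)) M]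
    (𝔨 : Type*) [LieRing 𝔨] [LieAlgebra 𝕂 𝔨]
    (L : M → Type*) [∀ x, LieRing (L x)] [∀ x, LieAlgebra 𝕂 (L x)]
    extends SmoothVectorBundle m 𝕂 M 𝔨 L where
  chart_lie : ∀ (i : ι) (x : M) (hx : x ∈ U i) (v w : L x),
    chart i x hx ⁅v, w⁆ = ⁅chart i x hx v, chart i x hx w⁆

namespace LieAlgebraBundle

variable {m : ℕ} {𝕂 : Type*} [RCLike 𝕂]
  {M : Type*} [TopologicalSpace M] [ChartedSpace (EuclideanSpace ℝ (Fin m)) M]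
  {𝔨 : Type*} [LieRing 𝔨] [LieAlgebra 𝕂 𝔨] [FiniteDimensional 𝕂 𝔨]
  {L : M → Type*} [∀ x, LieRing (L x)] [∀ x, LieAlgebra 𝕂 (L x)]
  (A : LieAlgebraBundle m 𝕂 M 𝔨 L)

/-- The bundle charts as isomorphisms of Lie algebras. -/
def lieChart (i : A.ι) (x : M) (hx : x ∈ A.U i) : L x ≃ₗ⁅𝕂⁆ 𝔨 :=
  { A.chart i x hx with map_lie' := fun {v w} => A.chart_lie i x hx v w }

/-- The pointwise Lie bracket of smooth sections. -/
instance instLieRingSections : LieRing A.sections where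
  bracket X Y := ⟨fun x => ⁅X.1 x, Y.1 x⁆, fun i => by
    refine (SmoothMapOn.bilin (LieModule.toEnd 𝕂 𝔨 𝔨 : 𝔨 →ₗ[𝕂] Module.End 𝕂 𝔨)
      (X.2 i) (Y.2 i)).congr
      fun x hx => ?_
    rw [A.localForm_of_mem i _ hx, A.localForm_of_mem i _ hx, A.localForm_of_mem i _ hx,
      A.chart_lie]
    rfl⟩
  add_lie X Y Z := Subtype.ext <| funext fun x => add_lie (X.1 x) (Y.1 x) (Z.1 x)
  lie_add X Y Z := Subtype.ext <| funext fun x => lie_add (X.1 x) (Y.1 x) (Z.1 x)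
  lie_self X := Subtype.ext <| funext fun x => lie_self (X.1 x)
  leibniz_lie X Y Z := Subtype.ext <| funext fun x => leibniz_lie (X.1 x) (Y.1 x) (Z.1 x)

instance instLieAlgebraSections : LieAlgebra 𝕂 A.sections where
  lie_smul c X Y := Subtype.ext <| funext fun x => lie_smul c (X.1 x) (Y.1 x)

/-- The transition maps of `A`, as endomorphisms of `𝔨`. -/
def transition (i j : A.ι) : M → (𝔨 →ₗ[𝕂] 𝔨) :=
  Function.extend Subtype.val
    (fun x : ↥(A.U i ∩ A.U j) =>
      (A.chart j x x.2.2).toLinearMap ∘ₗ (A.chart i x x.2.1).symm.toLinearMap) 0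

set_option linter.unusedSectionVars false in
theorem transition_apply (i j : A.ι) {x : M} (hi : x ∈ A.U i) (hj : x ∈ A.U j) (v : 𝔨) :
    A.transition i j x v = A.chart j x hj ((A.chart i x hi).symm v) := by
  have := Subtype.val_injective.extend_apply (fun x : ↥(A.U i ∩ A.U j) =>
      (A.chart j x x.2.2).toLinearMap ∘ₗ (A.chart i x x.2.1).symm.toLinearMap) 0 ⟨x, hi, hj⟩
  rw [transition, this]
  rfl

theorem smooth_transition_hom (i j : A.ι) :
    SmoothMapOn m 𝕂 (A.transition i j) (A.U i ∩ A.U j) := by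
  refine SmoothMapOn.of_apply fun v => (A.smooth_transition i j v).congr fun x hx => ?_
  rw [A.transition_apply i j hx.1 hx.2]
  exact (Subtype.val_injective.extend_apply (fun x : ↥(A.U i ∩ A.U j) =>
    A.chart j x x.2.2 ((A.chart i x x.2.1).symm v)) 0 ⟨x, hx⟩).symm

theorem smooth_conj (i j : A.ι) (f : 𝔨 →ₗ[𝕂] 𝔨) :
    SmoothMapOn m 𝕂 (fun x => A.transition i j x ∘ₗ f ∘ₗ A.transition j i x)
      (A.U i ∩ A.U j) := by
  have h1 := ((A.smooth_transition_hom j i).mono (Set.inter_comm _ _).subset).map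
    (LinearMap.llcomp 𝕂 𝔨 𝔨 𝔨 f)
  exact SmoothMapOn.bilin (LinearMap.llcomp 𝕂 𝔨 𝔨 𝔨) (A.smooth_transition_hom i j) h1

/-- The vector bundle `Der(L)` with fiber `Der(𝔨)`, whose fiber at `x` is `Der(L x)` and whose
bundle charts are conjugation with those of `L`. -/
def derBundle : SmoothVectorBundle m 𝕂 M (LieDerivation 𝕂 𝔨 𝔨)
    (fun x => LieDerivation 𝕂 (L x) (L x)) where
  ι := A.ι
  U := A.U
  isOpen_U := A.isOpen_U
  cover := A.cover
  chart i x hx := derConj (A.lieChart i x hx)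
  smooth_transition i j D := by
    let T : LieDerivation 𝕂 𝔨 𝔨 →ₗ[𝕂] (𝔨 →ₗ[𝕂] 𝔨) :=
      { toFun := fun D => D.toLinearMap, map_add' := fun _ _ => rfl, map_smul' := fun _ _ => rfl }
    have hT : Function.Injective T := fun D D' h => by
      ext a
      exact LinearMap.congr_fun h a
    refine SmoothMapOn.of_injective T hT ((A.smooth_conj i j D.toLinearMap).congr fun x hx => ?_)
    rw [Subtype.val_injective.extend_apply (fun x : ↥(A.U i ∩ A.U j) =>
      derConj (A.lieChart j x x.2.2) ((derConj (A.lieChart i x x.2.1)).symm D)) 0 ⟨x, hx⟩]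
    ext a
    simp only [LinearMap.comp_apply]
    rw [A.transition_apply i j hx.1 hx.2, A.transition_apply j i hx.2 hx.1]
    rfl

theorem exists_smooth_centConj (i j : A.ι) (f : lieCentroid 𝕂 𝔨) :
    ∃ c : M → lieCentroid 𝕂 𝔨, SmoothMapOn m 𝕂 c (A.U i ∩ A.U j) ∧
      ∀ x (hi : x ∈ A.U i) (hj : x ∈ A.U j),
        c x = centConj (A.lieChart j x hj) ((centConj (A.lieChart i x hi)).symm f) := by
  let c : M → lieCentroid 𝕂 𝔨 := Function.extend Subtype.val (fun x : ↥(A.U i ∩ A.U j) =>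
    centConj (A.lieChart j x x.2.2) ((centConj (A.lieChart i x x.2.1)).symm f)) 0
  have hc : ∀ x (hi : x ∈ A.U i) (hj : x ∈ A.U j),
      c x = centConj (A.lieChart j x hj) ((centConj (A.lieChart i x hi)).symm f) :=
    fun x hi hj => Subtype.val_injective.extend_apply (fun x : ↥(A.U i ∩ A.U j) =>
      centConj (A.lieChart j x x.2.2) ((centConj (A.lieChart i x x.2.1)).symm f)) 0 ⟨x, hi, hj⟩
  refine ⟨c, SmoothMapOn.of_injective (lieCentroid 𝕂 𝔨).subtype Subtype.val_injective
    ((A.smooth_conj i j f.1).congr fun x hx => ?_), hc⟩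
  rw [hc x hx.1 hx.2]
  ext a
  simp only [LinearMap.comp_apply]
  rw [A.transition_apply i j hx.1 hx.2, A.transition_apply j i hx.2 hx.1]
  rfl

/-- The chart of `Cent(L) ⊗ TM` at a point given by a bundle chart of `L` and one of `TM`. -/
def tensorChart [IsManifold (𝓡 m) ∞ M] (i : A.ι)
    (e : Bundle.Trivialization (EuclideanSpace ℝ (Fin m))
      (Bundle.TotalSpace.proj (F := EuclideanSpace ℝ (Fin m)) (E := TangentSpace (𝓡 m) (M := M))))
    [MemTrivializationAtlas e] (x : M) (hi : x ∈ A.U i) (he : x ∈ e.baseSet) :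
    CentTensorTangent m 𝕂 L x ≃ₗ[𝕂]
      (lieCentroid 𝕂 𝔨 ⊗[ℝ] EuclideanSpace ℝ (Fin m)) :=
  TensorProduct.AlgebraTensorModule.congr (centConj (A.lieChart i x hi)) (e.linearEquivAt ℝ x he)

theorem exists_smooth_tensor [IsManifold (𝓡 m) ∞ M] (i j : A.ι)
    (e e' : Bundle.Trivialization (EuclideanSpace ℝ (Fin m))
      (Bundle.TotalSpace.proj (F := EuclideanSpace ℝ (Fin m)) (E := TangentSpace (𝓡 m) (M := M))))
    [MemTrivializationAtlas e] [MemTrivializationAtlas e']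
    (t : lieCentroid 𝕂 𝔨 ⊗[ℝ] EuclideanSpace ℝ (Fin m)) :
    ∃ g : M → lieCentroid 𝕂 𝔨 ⊗[ℝ] EuclideanSpace ℝ (Fin m),
      SmoothMapOn m 𝕂 g ((A.U i ∩ e.baseSet) ∩ (A.U j ∩ e'.baseSet)) ∧
        ∀ x (hi : x ∈ A.U i) (he : x ∈ e.baseSet) (hj : x ∈ A.U j) (he' : x ∈ e'.baseSet),
          g x = A.tensorChart j e' x hj he' ((A.tensorChart i e x hi he).symm t) := by
  induction t using TensorProduct.induction_on with
  | zero => exact ⟨fun _ => 0, SmoothMapOn.zero, fun x _ _ _ _ => by rw [map_zero, map_zero]⟩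
  | add t t' ih ih' =>
    obtain ⟨g, hg, h⟩ := ih
    obtain ⟨g', hg', h'⟩ := ih'
    refine ⟨fun x => g x + g' x, hg.add hg', fun x hi he hj he' => ?_⟩
    rw [map_add, map_add, ← h x hi he hj he', ← h' x hi he hj he']
  | tmul f v =>
    obtain ⟨c, hcs, hc⟩ := A.exists_smooth_centConj i j f
    replace hcs : SmoothMapOn m 𝕂 c ((A.U i ∩ e.baseSet) ∩ (A.U j ∩ e'.baseSet)) :=
      hcs.mono fun x hx => ⟨hx.1.1, hx.2.1⟩
    let τ : M → EuclideanSpace ℝ (Fin m) := fun x =>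
      (e.coordChangeL ℝ e' x : EuclideanSpace ℝ (Fin m) →L[ℝ] EuclideanSpace ℝ (Fin m)) v
    have hτ : ContMDiffOn (𝓡 m) 𝓘(ℝ, EuclideanSpace ℝ (Fin m)) ∞ τ
        ((A.U i ∩ e.baseSet) ∩ (A.U j ∩ e'.baseSet)) := by
      have h := contMDiffOn_coordChangeL (n := ∞) (IB := 𝓡 m) e e'
      exact ((h.clm_apply contMDiffOn_const).mono fun x hx => ⟨hx.1.2, hx.2.2⟩)
    have hτk : ∀ k, ContMDiffOn (𝓡 m) 𝓘(ℝ, 𝕂) ∞ (fun x => ((τ x k : ℝ) : 𝕂))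
        ((A.U i ∩ e.baseSet) ∩ (A.U j ∩ e'.baseSet)) := fun k =>
      ((RCLike.ofRealCLM (K := 𝕂)).comp
        (EuclideanSpace.proj k : EuclideanSpace ℝ (Fin m) →L[ℝ] ℝ)).contDiff.contMDiff
          |>.comp_contMDiffOn hτ
    let b := (EuclideanSpace.basisFun (Fin m) ℝ).toBasis
    let T : Fin m → lieCentroid 𝕂 𝔨 →ₗ[𝕂] lieCentroid 𝕂 𝔨 ⊗[ℝ] EuclideanSpace ℝ (Fin m) :=
      fun k =>
        { toFun := fun f => f ⊗ₜ[ℝ] b k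
          map_add' := fun f f' => TensorProduct.add_tmul f f' (b k)
          map_smul' := fun r f => (TensorProduct.smul_tmul' r f (b k)).symm }
    have hTc : ∀ k, SmoothMapOn m 𝕂 (fun x => c x ⊗ₜ[ℝ] b k)
        ((A.U i ∩ e.baseSet) ∩ (A.U j ∩ e'.baseSet)) := fun k ℓ => hcs (ℓ ∘ₗ T k)
    refine ⟨fun x => ∑ k, ((τ x k : ℝ) : 𝕂) • (c x ⊗ₜ[ℝ] b k),
      SmoothMapOn.sum _ fun k _ => SmoothMapOn.smul (hτk k) (hTc k), ?_⟩
    intro x hi he hj he'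
    show _ = centConj (A.lieChart j x hj) ((centConj (A.lieChart i x hi)).symm f) ⊗ₜ[ℝ]
      e'.linearEquivAt ℝ x he' ((e.linearEquivAt ℝ x he).symm v)
    rw [← hc x hi hj]
    have hv : e'.linearEquivAt ℝ x he' ((e.linearEquivAt ℝ x he).symm v) = τ x := by
      have := Bundle.Trivialization.coordChangeL_apply (R := ℝ) e e' ⟨he, he'⟩ v
      exact this.symm
    rw [hv]
    conv_rhs => rw [← b.sum_repr (τ x)]
    rw [TensorProduct.tmul_sum]
    refine Finset.sum_congr rfl fun k _ => ?_
    have hk : b.repr (τ x) k = τ x k := by simp [b]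
    rw [hk, TensorProduct.tmul_smul, TensorProduct.smul_tmul', TensorProduct.smul_tmul',
      lieCentroid.real_smul_def]

/-- The standard bundle chart of the tangent bundle determined by the preferred chart at `y`. -/
abbrev tangentTriv (m : ℕ) (M : Type*) [TopologicalSpace M] [ChartedSpace (EuclideanSpace ℝ (Fin m)) M]
    [IsManifold (𝓡 m) ∞ M] (y : M) :
    Bundle.Trivialization (EuclideanSpace ℝ (Fin m))
      (Bundle.TotalSpace.proj (F := EuclideanSpace ℝ (Fin m)) (E := TangentSpace (𝓡 m) (M := M))) :=
  trivializationAt (EuclideanSpace ℝ (Fin m)) (TangentSpace (𝓡 m) (M := M)) y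

theorem smooth_tensor_transition [IsManifold (𝓡 m) ∞ M] (p q : A.ι × M)
    (t : lieCentroid 𝕂 𝔨 ⊗[ℝ] EuclideanSpace ℝ (Fin m)) :
    SmoothMapOn m 𝕂 (Function.extend Subtype.val
      (fun x : ↥((A.U p.1 ∩ (tangentTriv m M p.2).baseSet) ∩
          (A.U q.1 ∩ (tangentTriv m M q.2).baseSet)) =>
        A.tensorChart q.1 (tangentTriv m M q.2) x x.2.2.1 x.2.2.2
          ((A.tensorChart p.1 (tangentTriv m M p.2) x x.2.1.1 x.2.1.2).symm t)) 0)
      ((A.U p.1 ∩ (tangentTriv m M p.2).baseSet) ∩ (A.U q.1 ∩ (tangentTriv m M q.2).baseSet)) := by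
  obtain ⟨g, hg, h⟩ := A.exists_smooth_tensor p.1 q.1 (tangentTriv m M p.2) (tangentTriv m M q.2) t
  exact hg.extend fun x => h x x.2.1.1 x.2.1.2 x.2.2.1 x.2.2.2

/-- The vector bundle `Cent(L) ⊗ TM` with fiber `Cent(𝔨) ⊗ ℝ^m`. Its bundle charts are the tensor products of the conjugation with a
bundle chart of `L` and of a standard bundle chart of the tangent bundle. -/
def centTensorTangentBundle [IsManifold (𝓡 m) ∞ M] :
    SmoothVectorBundle m 𝕂 M (lieCentroid 𝕂 𝔨 ⊗[ℝ] EuclideanSpace ℝ (Fin m))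
    (CentTensorTangent m 𝕂 L) where
  ι := A.ι × M
  U p := A.U p.1 ∩ (tangentTriv m M p.2).baseSet
  isOpen_U p := (A.isOpen_U p.1).inter (Bundle.Trivialization.open_baseSet _)
  cover x := by
    obtain ⟨i, hi⟩ := A.cover x
    exact ⟨(i, x), hi, FiberBundle.mem_baseSet_trivializationAt' x⟩
  chart p x hx := A.tensorChart p.1 (tangentTriv m M p.2) x hx.1 hx.2
  smooth_transition := A.smooth_tensor_transition

/-- The space `𝒟_x(L)` of `x`-derivations: linear maps `δ : Γ(L) → L x` with
`δ[X, Y] = [δ X, Y_x] + [X_x, δ Y]`. -/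
def xDerivations (x : M) : Submodule 𝕂 (A.sections →ₗ[𝕂] L x) where
  carrier := {δ | ∀ X Y : A.sections, δ ⁅X, Y⁆ = ⁅δ X, Y.1 x⁆ + ⁅X.1 x, δ Y⁆}
  zero_mem' := fun X Y => by simp
  add_mem' := fun {δ δ'} h h' X Y => by
    simp only [LinearMap.add_apply, h X Y, h' X Y, add_lie, lie_add]; abel
  smul_mem' := fun c δ h X Y => by simp [h X Y]

/-- The natural injection `i : Der(L x) → 𝒟_x(L)`, `D ↦ (X ↦ D(X_x))`. -/
def natInj (x : M) : LieDerivation 𝕂 (L x) (L x) →ₗ[𝕂] A.xDerivations x where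
  toFun D := ⟨{ toFun := fun X => D (X.1 x)
                map_add' := fun X Y => D.toLinearMap.map_add _ _
                map_smul' := fun c X => D.toLinearMap.map_smul _ _ },
    fun X Y => by
      show D ⁅X.1 x, Y.1 x⁆ = ⁅D (X.1 x), Y.1 x⁆ + ⁅X.1 x, D (Y.1 x)⁆
      rw [D.apply_lie_eq_add, add_comm]⟩
  map_add' D D' := rfl
  map_smul' c D := rfl

end LieAlgebraBundle

/-- The differential `T_x a`, as a linear functional on `T_x M`. -/
def differentialAt {m : ℕ} {M : Type*} [TopologicalSpace M]
    [ChartedSpace (EuclideanSpace ℝ (Fin m)) M] (a : C^∞⟮𝓡 m, M; 𝓘(ℝ, ℝ), ℝ⟯) (x : M) :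
    TangentSpace (𝓡 m) x →ₗ[ℝ] ℝ :=
  (mfderiv (𝓡 m) 𝓘(ℝ, ℝ) a x).toLinearMap

/-- `σ` is the symbol map: under `Cent(L x) ⊗ T_x M = Hom(T_x^* M, Cent(L x))` one has
`σ(δ)(T_x a)(A_x) = δ(a A) - a(x) δ(A)` for all `x`-derivations `δ`, smooth real functions `a` and
smooth sections `A`. -/
def LieAlgebraBundle.IsSymbolMap {m : ℕ} {𝕂 : Type*} [RCLike 𝕂]
    {M : Type*} [TopologicalSpace M] [ChartedSpace (EuclideanSpace ℝ (Fin m)) M]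
    {𝔨 : Type*} [LieRing 𝔨] [LieAlgebra 𝕂 𝔨] [FiniteDimensional 𝕂 𝔨]
    {L : M → Type*} [∀ x, LieRing (L x)] [∀ x, LieAlgebra 𝕂 (L x)]
    (𝕃 : LieAlgebraBundle m 𝕂 M 𝔨 L)
    (σ : ∀ x, 𝕃.xDerivations x →ₗ[𝕂] CentTensorTangent m 𝕂 L x) : Prop :=
  ∀ (x : M) (δ : 𝕃.xDerivations x) (a : C^∞⟮𝓡 m, M; 𝓘(ℝ, ℝ), ℝ⟯) (A : 𝕃.sections),
    (CentTensorTangent.contract x (differentialAt a x) (σ x δ)).1 (A.1 x) =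
      δ.1 (𝕃.smulSection a A) - ((a x : ℝ) : 𝕂) • δ.1 A

end

universe uM

/-!
Let `δ` be an `x`-derivation and `a` a smooth real function. The *defect*
`δ(aX) - a(x) δ(X)` measures how far `δ` is from being tensorial. The Leibniz rule for
`a[X, Y] = [aX, Y] = [X, aY]` shows that the defect of `[X, Y]` is `[X_x, defect of Y]` and also
`[defect of X, Y_x]`. Everything rests on the fact that the defect of `X` vanishes as soon as
`X_x = 0` (`LieAlgebraBundle.DefectFactors`):

* if `𝔨` is centerfree, then for `X_x = 0` the defect of `X` commutes with all `Y_x`, so it is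
  zero;
* if `𝔨` is perfect, then a section `X` with `X_x = 0` is a *finite* sum of brackets `[Y_j, W_j]`
  with `(Y_j)_x = 0` (`LieAlgebraBundle.exists_bracket_decomposition`). Here the `W_j` are
  finitely many sections generating every fiber. They exist because `M` is `σ`-compact: generic
  linear combinations of a locally finite generating family still generate, by a dimension count
  and Baire's theorem (`SmoothVectorBundle.exists_generating_sections`). For fixed `W_j` the map
  `Y ↦ ∑ [Y_j, W_j]` is fiberwise onto, and local smooth right inverses are patched by a partition
  of unity.

By Hadamard's lemma, a function which vanishes to first order at `x` is a sum of products `pq` of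
functions vanishing at `x`, and `δ(pqX) = p(x) δ(qX) = 0` because `qX` vanishes at `x`. Hence `δ`
factors through the `1`-jet of sections at `x`. In a bundle chart and a chart of `M` this reads
`δ(X) = D(X(x)) + ∑ S^k(∂_k X(x))`, and the Leibniz rule on jets says exactly that `D` is a
derivation of `𝔨` and the `S^k` lie in its centroid (`LieAlgebraBundle.localEquiv`). So `(D, S)`
are linear coordinates on `𝒟_x(L)`.

A family of coordinates `(D, S)` is smooth if and only if it maps smooth sections to smooth
sections, as testing on sections that are affine in coordinates shows. This criterion makes the
coordinate changes smooth, identifies the smooth sections of `𝒟(L)` with the derivations of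
`Γ(L)`, and makes the injection of `Der(L)` a bundle morphism. In coordinates the sequence is
`D ↦ (D, 0)`, `(D, S) ↦ ∑ S^k ⊗ ∂_k`. The second map is independent of the coordinates, since its
contraction with the differential of `a` is the defect for `a`, and differentials of functions
separate the elements of `Cent(L_x) ⊗ T_x M`.
-/

noncomputable section

/-! ### Bump functions and smooth sections with prescribed local form -/

section LocalSmoothness

variable {m : ℕ} {𝕂 : Type*} [RCLike 𝕂]
  {M : Type*} [TopologicalSpace M] [ChartedSpace (EuclideanSpace ℝ (Fin m)) M]
  {V : Type*} [AddCommGroup V] [Module 𝕂 V]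

theorem SmoothMapOn.of_locally {f : M → V} {s : Set M}
    (h : ∀ x ∈ s, ∃ u, IsOpen u ∧ x ∈ u ∧ SmoothMapOn m 𝕂 f (s ∩ u)) : SmoothMapOn m 𝕂 f s :=
  fun ℓ => contMDiffOn_of_locally_contMDiffOn fun x hx => by
    obtain ⟨u, hu, hxu, hf⟩ := h x hx
    exact ⟨u, hu, hxu, hf ℓ⟩

theorem SmoothMapOn.smul_real {a : M → ℝ} {f : M → V} {s : Set M}
    (ha : ContMDiffOn (𝓡 m) 𝓘(ℝ, ℝ) ∞ a s) (hf : SmoothMapOn m 𝕂 f s) :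
    SmoothMapOn m 𝕂 (fun x => (a x : 𝕂) • f x) s :=
  SmoothMapOn.smul ((RCLike.ofRealCLM (K := 𝕂)).contDiff.contMDiff.comp_contMDiffOn ha) hf

/-- Bump functions around `x` with support in a prescribed neighbourhood. -/
theorem exists_smooth_bump [T2Space M] [IsManifold (𝓡 m) ∞ M] (x : M) {O : Set M}
    (hO : O ∈ nhds x) :
    ∃ χ : C^∞⟮𝓡 m, M; 𝓘(ℝ, ℝ), ℝ⟯, tsupport χ ⊆ O ∧ ∀ᶠ y in nhds x, χ y = 1 := by
  obtain ⟨f, -, hf⟩ := (SmoothBumpFunction.nhds_basis_tsupport (I := 𝓡 m) (c := x)).mem_iff.1 hO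
  exact ⟨⟨f, f.contMDiff⟩, hf, f.eventuallyEq_one⟩

end LocalSmoothness

namespace SmoothVectorBundle

variable {m : ℕ} {𝕂 : Type*} [RCLike 𝕂]
  {M : Type*} [TopologicalSpace M] [ChartedSpace (EuclideanSpace ℝ (Fin m)) M]
  {V : Type*} [AddCommGroup V] [Module 𝕂 V]
  {E : M → Type*} [∀ x, AddCommGroup (E x)] [∀ x, Module 𝕂 (E x)]
  (A : SmoothVectorBundle m 𝕂 M V E)

/-- Transition maps applied to smooth maps are smooth. The definition of a bundle provides this for
constant maps only; expand in a basis. -/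
theorem smooth_transition_apply [FiniteDimensional 𝕂 V] (i j : A.ι) {f : M → V} {s : Set M}
    (hs : s ⊆ A.U i ∩ A.U j) (hf : SmoothMapOn m 𝕂 f s) {g : M → V}
    (hg : ∀ x (hx : x ∈ s), g x = A.chart j x (hs hx).2 ((A.chart i x (hs hx).1).symm (f x))) :
    SmoothMapOn m 𝕂 g s := by
  let b := Module.finBasis 𝕂 V
  have h : SmoothMapOn m 𝕂 (fun x => ∑ k, b.coord k (f x) • Function.extend Subtype.val
      (fun x : ↥(A.U i ∩ A.U j) => A.chart j x x.2.2 ((A.chart i x x.2.1).symm (b k))) 0 x) s :=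
    SmoothMapOn.sum _ fun k _ => SmoothMapOn.smul (hf (b.coord k))
      ((A.smooth_transition i j (b k)).mono hs)
  refine h.congr fun x hx => ?_
  rw [hg x hx]
  conv_lhs => rw [← b.sum_repr (f x)]
  rw [map_sum, map_sum]
  refine Finset.sum_congr rfl fun k _ => ?_
  rw [Subtype.val_injective.extend_apply (fun x : ↥(A.U i ∩ A.U j) =>
    A.chart j x x.2.2 ((A.chart i x x.2.1).symm (b k))) 0 ⟨x, hs hx⟩]
  simp

/-- To check that a section is smooth it suffices to look, around each point, at one local form. -/
theorem mem_sections_of_locally [FiniteDimensional 𝕂 V] {X : ∀ x, E x}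
    (h : ∀ x, ∃ i, ∃ u, IsOpen u ∧ x ∈ u ∧ u ⊆ A.U i ∧ SmoothMapOn m 𝕂 (A.localForm i X) u) :
    X ∈ A.sections := by
  intro j
  refine SmoothMapOn.of_locally fun x hx => ?_
  obtain ⟨i, u, hu, hxu, hui, hX⟩ := h x
  refine ⟨u, hu, hxu, ?_⟩
  refine A.smooth_transition_apply i j (fun y hy => ⟨hui hy.2, hy.1⟩)
    (hX.mono Set.inter_subset_right) fun y hy => ?_
  rw [A.localForm_of_mem j _ hy.1, A.localForm_of_mem i _ (hui hy.2), LinearEquiv.symm_apply_apply]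

/-- The section which in the bundle chart `i` has the local form `χ f`, extended by zero outside
`U i`. -/
def cutoff (i : A.ι) (χ : M → ℝ) (f : M → V) : ∀ x, E x := by
  classical
  exact fun x => if hx : x ∈ A.U i then (A.chart i x hx).symm ((χ x : 𝕂) • f x) else 0

theorem cutoff_apply (i : A.ι) (χ : M → ℝ) (f : M → V) {x : M} (hx : x ∈ A.U i) :
    A.cutoff i χ f x = (A.chart i x hx).symm ((χ x : 𝕂) • f x) := by
  rw [cutoff, dif_pos hx]

theorem cutoff_eq_zero (i : A.ι) (χ : M → ℝ) (f : M → V) {x : M} (hx : χ x = 0) :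
    A.cutoff i χ f x = 0 := by
  by_cases h : x ∈ A.U i
  · simp [A.cutoff_apply i χ f h, hx]
  · rw [cutoff, dif_neg h]

theorem localForm_cutoff (i : A.ι) (χ : M → ℝ) (f : M → V) {x : M} (hx : x ∈ A.U i) :
    A.localForm i (A.cutoff i χ f) x = (χ x : 𝕂) • f x := by
  rw [A.localForm_of_mem i _ hx, A.cutoff_apply i χ f hx, LinearEquiv.apply_symm_apply]

theorem cutoff_mem_sections [FiniteDimensional 𝕂 V] (i : A.ι)
    (χ : C^∞⟮𝓡 m, M; 𝓘(ℝ, ℝ), ℝ⟯) {f : M → V} {O : Set M} (hO : IsOpen O)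
    (hOi : O ⊆ A.U i) (hχ : tsupport χ ⊆ O) (hf : SmoothMapOn m 𝕂 f O) :
    A.cutoff i χ f ∈ A.sections := by
  refine A.mem_sections_of_locally fun x => ?_
  by_cases hx : x ∈ O
  · refine ⟨i, O, hO, hx, hOi, (hf.smul_real χ.contMDiff.contMDiffOn).congr fun y hy => ?_⟩
    exact A.localForm_cutoff i χ f (hOi hy)
  · obtain ⟨j, hj⟩ := A.cover x
    refine ⟨j, A.U j ∩ (tsupport χ)ᶜ, (A.isOpen_U j).inter (isClosed_tsupport _).isOpen_compl,
      ⟨hj, fun h => hx (hχ h)⟩, Set.inter_subset_left, SmoothMapOn.zero.congr fun y hy => ?_⟩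
    rw [A.localForm_of_mem j _ hy.1, A.cutoff_eq_zero i χ f (image_eq_zero_of_notMem_tsupport hy.2),
      map_zero]

/-- The smooth section with local form `χ f` in the bundle chart `i`. -/
def cutoffSection [FiniteDimensional 𝕂 V] (i : A.ι)
    (χ : C^∞⟮𝓡 m, M; 𝓘(ℝ, ℝ), ℝ⟯) {f : M → V} {O : Set M} (hO : IsOpen O)
    (hOi : O ⊆ A.U i) (hχ : tsupport χ ⊆ O) (hf : SmoothMapOn m 𝕂 f O) : A.sections :=
  ⟨A.cutoff i χ f, A.cutoff_mem_sections i χ hO hOi hχ hf⟩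

theorem cutoffSection_apply [FiniteDimensional 𝕂 V] (i : A.ι)
    (χ : C^∞⟮𝓡 m, M; 𝓘(ℝ, ℝ), ℝ⟯) {f : M → V} {O : Set M} (hO : IsOpen O)
    (hOi : O ⊆ A.U i) (hχ : tsupport χ ⊆ O) (hf : SmoothMapOn m 𝕂 f O) {x : M} (hx : x ∈ A.U i) :
    (A.cutoffSection i χ hO hOi hχ hf).1 x = (A.chart i x hx).symm ((χ x : 𝕂) • f x) :=
  A.cutoff_apply i χ f hx

/-- Every vector is the value of a smooth section. -/
theorem exists_section_eq [FiniteDimensional 𝕂 V] [T2Space M] [IsManifold (𝓡 m) ∞ M] (x : M)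
    (v : E x) : ∃ X : A.sections, X.1 x = v := by
  obtain ⟨i, hi⟩ := A.cover x
  obtain ⟨χ, hχ, h1⟩ := exists_smooth_bump (m := m) x ((A.isOpen_U i).mem_nhds hi)
  refine ⟨A.cutoffSection i χ (A.isOpen_U i) subset_rfl hχ
    (SmoothMapOn.const (A.chart i x hi v)), ?_⟩
  rw [A.cutoffSection_apply i χ _ _ _ _ hi, h1.self_of_nhds]
  simp

theorem smulSection_apply (a : C^∞⟮𝓡 m, M; 𝓘(ℝ, ℝ), ℝ⟯) (X : A.sections) (x : M) :
    (A.smulSection a X).1 x = ((a x : ℝ) : 𝕂) • X.1 x := rfl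

end SmoothVectorBundle

/-! ### Partial derivatives in a chart -/

section PartialDeriv

variable {m : ℕ} {𝕂 : Type*} [RCLike 𝕂]
  {M : Type*} [TopologicalSpace M] [ChartedSpace (EuclideanSpace ℝ (Fin m)) M]
  {V : Type*} [AddCommGroup V] [Module 𝕂 V]
  {W : Type*} [AddCommGroup W] [Module 𝕂 W]

/-- The curve `t ↦ ξ⁻¹(ξ(x) + t e_k)`, whose velocity at `0` is the coordinate vector
`∂_{ξ_k}` at `x`. -/
def coordCurve (ξ : OpenPartialHomeomorph M (EuclideanSpace ℝ (Fin m))) (k : Fin m) (x : M)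
    (t : ℝ) : M :=
  ξ.symm (ξ x + t • EuclideanSpace.single k (1 : ℝ))

/-- The partial derivative in the `k`-th coordinate of the chart `ξ`, for functions with values in
a normed space. -/
def normedPartialDeriv {F : Type*} [NormedAddCommGroup F] [NormedSpace ℝ F]
    (ξ : OpenPartialHomeomorph M (EuclideanSpace ℝ (Fin m))) (k : Fin m) (g : M → F) (x : M) : F :=
  deriv (fun t : ℝ => g (coordCurve ξ k x t)) 0

variable {ξ : OpenPartialHomeomorph M (EuclideanSpace ℝ (Fin m))} {x : M}

omit [ChartedSpace (EuclideanSpace ℝ (Fin m)) M] in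
theorem coordCurve_zero (hx : x ∈ ξ.source) (k : Fin m) : coordCurve ξ k x 0 = x := by
  simp [coordCurve, ξ.left_inv hx]

omit [ChartedSpace (EuclideanSpace ℝ (Fin m)) M] in
theorem continuousAt_coordCurve (hx : x ∈ ξ.source) (k : Fin m) :
    ContinuousAt (coordCurve ξ k x) 0 := by
  have h1 : ContinuousAt (fun t : ℝ => ξ x + t • EuclideanSpace.single k (1 : ℝ)) 0 := by
    fun_prop
  refine ContinuousAt.comp (g := ξ.symm) ?_ h1
  simpa using ξ.continuousAt_symm (ξ.map_source hx)

omit [ChartedSpace (EuclideanSpace ℝ (Fin m)) M] in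
theorem eventually_coordCurve (hx : x ∈ ξ.source) (k : Fin m) {p : M → Prop}
    (h : ∀ᶠ y in nhds x, p y) : ∀ᶠ t in nhds (0 : ℝ), p (coordCurve ξ k x t) := by
  have := continuousAt_coordCurve hx k
  rw [ContinuousAt, coordCurve_zero hx] at this
  exact this.eventually h

omit [ChartedSpace (EuclideanSpace ℝ (Fin m)) M] in
theorem coord_coordCurve (hx : x ∈ ξ.source) (k l : Fin m) :
    ∀ᶠ t in nhds (0 : ℝ), ξ (coordCurve ξ k x t) l =
      ξ x l + t * (EuclideanSpace.single k (1 : ℝ) : EuclideanSpace ℝ (Fin m)) l := by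
  have h1 : ContinuousAt (fun t : ℝ => ξ x + t • EuclideanSpace.single k (1 : ℝ)) 0 := by
    fun_prop
  have h2 := h1.eventually_mem (s := ξ.target)
    (by simpa using ξ.open_target.mem_nhds (ξ.map_source hx))
  filter_upwards [h2] with t ht
  rw [coordCurve, ξ.right_inv ht]
  simp

section Normed

variable {F : Type*} [NormedAddCommGroup F] [NormedSpace ℝ F]

omit [ChartedSpace (EuclideanSpace ℝ (Fin m)) M] in
theorem normedPartialDeriv_congr (hx : x ∈ ξ.source) (k : Fin m) {g h : M → F}
    (hgh : ∀ᶠ y in nhds x, g y = h y) :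
    normedPartialDeriv ξ k g x = normedPartialDeriv ξ k h x :=
  Filter.EventuallyEq.deriv_eq (eventually_coordCurve hx k hgh)

variable (hξ : ξ ∈ IsManifold.maximalAtlas (𝓡 m) ∞ M)
include hξ

theorem contDiffOn_comp_chart_symm {g : M → F} {O : Set M}
    (hg : ContMDiffOn (𝓡 m) 𝓘(ℝ, F) ∞ g O) :
    ContDiffOn ℝ ∞ (fun y => g (ξ.symm y)) (ξ.target ∩ ξ.symm ⁻¹' O) := by
  rw [← contMDiffOn_iff_contDiffOn]
  exact hg.comp' (contMDiffOn_symm_of_mem_maximalAtlas hξ)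

theorem hasDerivAt_coordCurve {g : M → F} {O : Set M} (hO : IsOpen O)
    (hg : ContMDiffOn (𝓡 m) 𝓘(ℝ, F) ∞ g O) (hx : x ∈ ξ.source) (hxO : x ∈ O) (k : Fin m) :
    HasDerivAt (fun t : ℝ => g (coordCurve ξ k x t))
      (fderiv ℝ (fun y => g (ξ.symm y)) (ξ x) (EuclideanSpace.single k (1 : ℝ))) 0 := by
  have h1 := contDiffOn_comp_chart_symm hξ hg
  have ho : IsOpen (ξ.target ∩ ξ.symm ⁻¹' O) := ξ.isOpen_inter_preimage_symm hO
  have hmem : ξ x ∈ ξ.target ∩ ξ.symm ⁻¹' O :=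
    ⟨ξ.map_source hx, by simpa [ξ.left_inv hx] using hxO⟩
  have h2 : DifferentiableAt ℝ (fun y => g (ξ.symm y)) (ξ x) :=
    (h1.contDiffAt (ho.mem_nhds hmem)).differentiableAt (by simp)
  have h3 : HasDerivAt (fun t : ℝ => ξ x + t • EuclideanSpace.single k (1 : ℝ))
      (EuclideanSpace.single k (1 : ℝ)) 0 := by
    simpa using ((hasDerivAt_id (0 : ℝ)).smul_const
      (EuclideanSpace.single k (1 : ℝ) : EuclideanSpace ℝ (Fin m))).const_add (ξ x)
  exact HasFDerivAt.comp_hasDerivAt_of_eq (0 : ℝ) h2.hasFDerivAt h3 (by simp)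

theorem normedPartialDeriv_eq_fderiv {g : M → F} {O : Set M} (hO : IsOpen O)
    (hg : ContMDiffOn (𝓡 m) 𝓘(ℝ, F) ∞ g O) (hx : x ∈ ξ.source) (hxO : x ∈ O) (k : Fin m) :
    normedPartialDeriv ξ k g x =
      fderiv ℝ (fun y => g (ξ.symm y)) (ξ x) (EuclideanSpace.single k (1 : ℝ)) :=
  (hasDerivAt_coordCurve hξ hO hg hx hxO k).deriv

theorem contMDiffOn_normedPartialDeriv {g : M → F} {O : Set M} (hO : IsOpen O)
    (hg : ContMDiffOn (𝓡 m) 𝓘(ℝ, F) ∞ g O) (k : Fin m) :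
    ContMDiffOn (𝓡 m) 𝓘(ℝ, F) ∞ (normedPartialDeriv ξ k g) (O ∩ ξ.source) := by
  have h1 := contDiffOn_comp_chart_symm hξ hg
  have ho : IsOpen (ξ.target ∩ ξ.symm ⁻¹' O) := ξ.isOpen_inter_preimage_symm hO
  have h2 : ContDiffOn ℝ ∞ (fun y => fderiv ℝ (fun y => g (ξ.symm y)) y
      (EuclideanSpace.single k (1 : ℝ))) (ξ.target ∩ ξ.symm ⁻¹' O) :=
    (h1.fderiv_of_isOpen ho (by simp)).clm_apply contDiffOn_const
  have h3 := h2.contMDiffOn.comp ((contMDiffOn_of_mem_maximalAtlas hξ).mono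
    (Set.inter_subset_right (s := O))) (fun y hy => ?_)
  · exact h3.congr fun y hy => normedPartialDeriv_eq_fderiv hξ hO hg hy.2 hy.1 k
  · exact ⟨ξ.map_source hy.2, by simpa [ξ.left_inv hy.2] using hy.1⟩

end Normed

theorem ext_dual [FiniteDimensional 𝕂 V] {u v : V} (h : ∀ ℓ : Module.Dual 𝕂 V, ℓ u = ℓ v) :
    u = v := by
  rw [← sub_eq_zero, ← Module.forall_dual_apply_eq_zero_iff 𝕂]
  intro ℓ
  rw [map_sub, h, sub_self]

theorem dual_apply_eq_sum {κ : Type*} [Fintype κ] (b : Module.Basis κ 𝕂 V) (ℓ : Module.Dual 𝕂 V)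
    (v : V) : ℓ v = ∑ j, b.coord j v * ℓ (b j) :=
  calc ℓ v = ℓ (∑ j, b.repr v j • b j) := by rw [b.sum_repr]
    _ = _ := by simp only [map_sum, map_smul, smul_eq_mul, Module.Basis.coord_apply]

variable [FiniteDimensional 𝕂 V] [FiniteDimensional 𝕂 W]

omit [ChartedSpace (EuclideanSpace ℝ (Fin m)) M] in
theorem chartPartialDeriv_congr (hx : x ∈ ξ.source) (k : Fin m) {g h : M → V}
    (hgh : ∀ᶠ y in nhds x, g y = h y) :
    chartPartialDeriv 𝕂 ξ k g x = chartPartialDeriv 𝕂 ξ k h x := by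
  refine Finset.sum_congr rfl fun j _ => ?_
  congr 1
  exact normedPartialDeriv_congr (g := fun y => (Module.finBasis 𝕂 V).coord j (g y))
    (h := fun y => (Module.finBasis 𝕂 V).coord j (h y)) hx k
    (hgh.mono fun y hy => by rw [hy])

variable (hξ : ξ ∈ IsManifold.maximalAtlas (𝓡 m) ∞ M)
include hξ

theorem dual_chartPartialDeriv {f : M → V} {O : Set M} (hO : IsOpen O)
    (hf : SmoothMapOn m 𝕂 f O) (hx : x ∈ ξ.source) (hxO : x ∈ O) (k : Fin m)
    (ℓ : Module.Dual 𝕂 V) :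
    ℓ (chartPartialDeriv 𝕂 ξ k f x) = normedPartialDeriv ξ k (fun y => ℓ (f y)) x := by
  let b := Module.finBasis 𝕂 V
  have h : (fun t : ℝ => ℓ (f (coordCurve ξ k x t))) =
      fun t : ℝ => ∑ j, b.coord j (f (coordCurve ξ k x t)) * ℓ (b j) := by
    funext t
    exact dual_apply_eq_sum b ℓ _
  have hd := fun j => hasDerivAt_coordCurve hξ hO (hf (b.coord j)) hx hxO k
  rw [normedPartialDeriv, h, (HasDerivAt.fun_sum fun j (_ : j ∈ Finset.univ) =>
    (hd j).mul_const (ℓ (b j))).deriv, chartPartialDeriv, map_sum]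
  refine Finset.sum_congr rfl fun j _ => ?_
  rw [map_smul, smul_eq_mul]
  congr 1
  exact (hd j).deriv

theorem SmoothMapOn.chartPartialDeriv {f : M → V} {O : Set M} (hO : IsOpen O)
    (hf : SmoothMapOn m 𝕂 f O) (k : Fin m) :
    SmoothMapOn m 𝕂 (chartPartialDeriv 𝕂 ξ k f) (O ∩ ξ.source) := fun ℓ =>
  (contMDiffOn_normedPartialDeriv hξ hO (hf ℓ) k).congr fun _ hy =>
    dual_chartPartialDeriv hξ hO hf hy.2 hy.1 k ℓ

theorem chartPartialDeriv_map (T : V →ₗ[𝕂] W) {f : M → V} {O : Set M} (hO : IsOpen O)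
    (hf : SmoothMapOn m 𝕂 f O) (hx : x ∈ ξ.source) (hxO : x ∈ O) (k : Fin m) :
    chartPartialDeriv 𝕂 ξ k (fun y => T (f y)) x = T (chartPartialDeriv 𝕂 ξ k f x) := by
  refine ext_dual (𝕂 := 𝕂) fun ℓ => ?_
  rw [dual_chartPartialDeriv hξ hO (hf.map T) hx hxO]
  exact (dual_chartPartialDeriv hξ hO hf hx hxO k (ℓ ∘ₗ T)).symm

theorem chartPartialDeriv_add {f g : M → V} {O : Set M} (hO : IsOpen O)
    (hf : SmoothMapOn m 𝕂 f O) (hg : SmoothMapOn m 𝕂 g O)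
    (hx : x ∈ ξ.source) (hxO : x ∈ O) (k : Fin m) :
    chartPartialDeriv 𝕂 ξ k (fun y => f y + g y) x =
      chartPartialDeriv 𝕂 ξ k f x + chartPartialDeriv 𝕂 ξ k g x := by
  refine ext_dual (𝕂 := 𝕂) fun ℓ => ?_
  rw [dual_chartPartialDeriv hξ hO (hf.add hg) hx hxO, map_add,
    dual_chartPartialDeriv hξ hO hf hx hxO, dual_chartPartialDeriv hξ hO hg hx hxO]
  simp only [map_add]
  exact ((hasDerivAt_coordCurve hξ hO (hf ℓ) hx hxO k).add
    (hasDerivAt_coordCurve hξ hO (hg ℓ) hx hxO k)).deriv.trans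
    (congrArg₂ (· + ·) (hasDerivAt_coordCurve hξ hO (hf ℓ) hx hxO k).deriv.symm
      (hasDerivAt_coordCurve hξ hO (hg ℓ) hx hxO k).deriv.symm)

theorem chartPartialDeriv_bilin {P : Type*} [AddCommGroup P] [Module 𝕂 P] [FiniteDimensional 𝕂 P]
    (β : V →ₗ[𝕂] W →ₗ[𝕂] P) {f : M → V} {g : M → W} {O : Set M} (hO : IsOpen O)
    (hf : SmoothMapOn m 𝕂 f O) (hg : SmoothMapOn m 𝕂 g O)
    (hx : x ∈ ξ.source) (hxO : x ∈ O) (k : Fin m) :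
    chartPartialDeriv 𝕂 ξ k (fun y => β (f y) (g y)) x =
      β (chartPartialDeriv 𝕂 ξ k f x) (g x) + β (f x) (chartPartialDeriv 𝕂 ξ k g x) := by
  refine ext_dual (𝕂 := 𝕂) fun ℓ => ?_
  rw [dual_chartPartialDeriv hξ hO (SmoothMapOn.bilin β hf hg) hx hxO]
  let b := Module.finBasis 𝕂 V
  have hb : ∀ (v : V) (w : W), ℓ (β v w) = ∑ j, b.coord j v * ℓ (β (b j) w) := by
    exact fun v w => dual_apply_eq_sum b (ℓ ∘ₗ β.flip w) v
  have h : (fun t : ℝ => ℓ (β (f (coordCurve ξ k x t)) (g (coordCurve ξ k x t)))) =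
      fun t : ℝ => ∑ j, b.coord j (f (coordCurve ξ k x t)) *
        ℓ (β (b j) (g (coordCurve ξ k x t))) := by
    funext t
    exact hb _ _
  have h1 := fun j => hasDerivAt_coordCurve hξ hO (hf (b.coord j)) hx hxO k
  have h2 := fun j => hasDerivAt_coordCurve hξ hO (hg (ℓ ∘ₗ β (b j))) hx hxO k
  simp only [LinearMap.comp_apply] at h2
  rw [normedPartialDeriv, h, (HasDerivAt.fun_sum fun j (_ : j ∈ Finset.univ) =>
    (h1 j).fun_mul (h2 j)).deriv, map_add, hb, hb, ← Finset.sum_add_distrib]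
  refine Finset.sum_congr rfl fun j _ => ?_
  rw [dual_chartPartialDeriv hξ hO hf hx hxO, coordCurve_zero hx, normedPartialDeriv, (h1 j).deriv]
  have := dual_chartPartialDeriv hξ hO hg hx hxO k (ℓ ∘ₗ β (b j))
  simp only [LinearMap.comp_apply] at this
  rw [this, normedPartialDeriv, (h2 j).deriv]

theorem chartPartialDeriv_smul {a : M → ℝ} {f : M → V} {O : Set M} (hO : IsOpen O)
    (ha : ContMDiffOn (𝓡 m) 𝓘(ℝ, ℝ) ∞ a O) (hf : SmoothMapOn m 𝕂 f O)
    (hx : x ∈ ξ.source) (hxO : x ∈ O) (k : Fin m) :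
    chartPartialDeriv 𝕂 ξ k (fun y => (a y : 𝕂) • f y) x =
      ((normedPartialDeriv ξ k a x : ℝ) : 𝕂) • f x + (a x : 𝕂) • chartPartialDeriv 𝕂 ξ k f x := by
  refine ext_dual (𝕂 := 𝕂) fun ℓ => ?_
  rw [dual_chartPartialDeriv hξ hO (SmoothMapOn.smul_real ha hf) hx hxO, map_add, map_smul,
    map_smul, dual_chartPartialDeriv hξ hO hf hx hxO]
  have h1 : HasDerivAt (fun t : ℝ => (a (coordCurve ξ k x t) : 𝕂)) _ 0 :=
    (RCLike.ofRealCLM (K := 𝕂)).hasFDerivAt.comp_hasDerivAt (0 : ℝ)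
      (hasDerivAt_coordCurve hξ hO ha hx hxO k)
  have h2 := hasDerivAt_coordCurve hξ hO (hf ℓ) hx hxO k
  simp only [map_smul, smul_eq_mul]
  rw [normedPartialDeriv, (h1.fun_mul h2).deriv, normedPartialDeriv, normedPartialDeriv, h2.deriv,
    (hasDerivAt_coordCurve hξ hO ha hx hxO k).deriv, coordCurve_zero hx]
  simp

end PartialDeriv

/-! ### Hadamard's lemma -/

section Hadamard

open MeasureTheory

/-- Differentiation under the integral sign, to all orders: the integral is written as a convolution
of the indicator function of `[0, 1]` with the (cut off, reflected) integrand. -/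
theorem contDiff_integral_unitInterval {E F : Type*} [NormedAddCommGroup E] [NormedSpace ℝ E]
    [NormedAddCommGroup F] [NormedSpace ℝ F] {f : E × ℝ → F} (hf : ContDiff ℝ ∞ f) :
    ContDiff ℝ ∞ (fun y => ∫ t in Set.Icc (0 : ℝ) 1, f (y, t)) := by
  let β : ContDiffBump (0 : ℝ) := ⟨1, 2, one_pos, one_lt_two⟩
  let g : E → ℝ → F := fun p s => β s • f (p, -s)
  let φ : ℝ → ℝ := (Set.Icc (0 : ℝ) 1).indicator fun _ => 1
  have h1 : ContDiff ℝ ∞ (fun q : E × ℝ => g q.1 q.2) :=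
    (β.contDiff.comp contDiff_snd).smul (hf.comp (contDiff_fst.prodMk contDiff_snd.neg))
  have h2 := contDiffOn_convolution_right_with_param_comp (𝕜 := ℝ) (μ := volume) (n := ⊤)
    (ContinuousLinearMap.lsmul ℝ ℝ) (s := (Set.univ : Set E)) (v := fun _ => (0 : ℝ))
    contDiffOn_const (f := φ) (g := g) (k := Metric.closedBall 0 2) isOpen_univ
    (isCompact_closedBall 0 2) (fun p x _ hx => ?_) ?_ (by
      simpa [Function.HasUncurry.uncurry] using h1.contDiffOn)
  · rw [contDiffOn_univ] at h2
    convert h2 using 2 with y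
    rw [convolution_def, ← integral_indicator measurableSet_Icc]
    refine integral_congr_ae (Filter.Eventually.of_forall fun t => ?_)
    by_cases ht : t ∈ Set.Icc (0 : ℝ) 1
    · have : β (0 - t) = 1 := β.one_of_mem_closedBall (by
        rw [mem_closedBall_zero_iff, Real.norm_eq_abs, abs_le]
        exact ⟨by linarith [ht.2], by linarith [ht.1]⟩)
      simp [φ, g, ht, -zero_sub, this]
    · simp [φ, ht]
  · have : β x = 0 := β.zero_of_le_dist (not_le.1 hx).le
    simp [g, this]
  · exact ((integrable_indicator_iff measurableSet_Icc).2
      (integrableOn_const (by simp))).locallyIntegrable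

/-- **Hadamard's lemma** on `ℝ^m`. -/
theorem exists_hadamard {m : ℕ} {f : EuclideanSpace ℝ (Fin m) → ℝ} (hf : ContDiff ℝ ∞ f)
    (p : EuclideanSpace ℝ (Fin m)) :
    ∃ g : Fin m → EuclideanSpace ℝ (Fin m) → ℝ, (∀ k, ContDiff ℝ ∞ (g k)) ∧
      (∀ k, g k p = fderiv ℝ f p (EuclideanSpace.single k 1)) ∧
      ∀ y, f y = f p + ∑ k, (y k - p k) * g k y := by
  have hd : ContDiff ℝ ∞ (fderiv ℝ f) := hf.fderiv_right (by simp)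
  let F : Fin m → EuclideanSpace ℝ (Fin m) × ℝ → ℝ := fun k q =>
    fderiv ℝ f (p + q.2 • (q.1 - p)) (EuclideanSpace.single k 1)
  have hF : ∀ k, ContDiff ℝ ∞ (F k) := fun k =>
    (hd.comp (contDiff_const.add (contDiff_snd.smul (contDiff_fst.sub contDiff_const)))).clm_apply
      contDiff_const
  refine ⟨fun k y => ∫ t in Set.Icc (0 : ℝ) 1, F k (y, t),
    fun k => contDiff_integral_unitInterval (hF k), fun k => by simp [F], fun y => ?_⟩
  have hc : ∀ t : ℝ, HasDerivAt (fun t : ℝ => p + t • (y - p)) (y - p) t := fun t => by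
    simpa using ((hasDerivAt_id t).smul_const (y - p)).const_add p
  have h1 : ∀ t : ℝ, HasDerivAt (fun t : ℝ => f (p + t • (y - p)))
      (fderiv ℝ f (p + t • (y - p)) (y - p)) t := fun t =>
    ((hf.differentiable (by simp)).differentiableAt.hasFDerivAt).comp_hasDerivAt t (hc t)
  have hcont : Continuous (fun t : ℝ => fderiv ℝ f (p + t • (y - p)) (y - p)) :=
    (hd.continuous.comp (by fun_prop)).clm_apply continuous_const
  have h2 := intervalIntegral.integral_eq_sub_of_hasDerivAt (a := 0) (b := 1)
    (fun t _ => h1 t) (hcont.intervalIntegrable 0 1)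
  have h3 : ∀ t : ℝ, fderiv ℝ f (p + t • (y - p)) (y - p) =
      ∑ k, (y k - p k) * F k (y, t) := fun t => by
    have : ∀ T : EuclideanSpace ℝ (Fin m) →L[ℝ] ℝ, T (y - p) =
        ∑ k, (y k - p k) * T (EuclideanSpace.single k 1) := fun T => by
      conv_lhs => rw [← (EuclideanSpace.basisFun (Fin m) ℝ).sum_repr (y - p)]
      simp
    exact this _
  have h4 : ∀ k, IntervalIntegrable (fun t => (y k - p k) * F k (y, t)) volume 0 1 := fun k =>
    ((continuous_const.mul ((hF k).continuous.comp
      (continuous_const.prodMk continuous_id))).intervalIntegrable 0 1)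
  simp only [h3] at h2
  rw [intervalIntegral.integral_finsetSum fun k _ => h4 k] at h2
  simp only [intervalIntegral.integral_of_le zero_le_one, ← integral_Icc_eq_integral_Ioc,
    integral_const_mul, one_smul, zero_smul, add_zero, add_sub_cancel] at h2
  dsimp only
  linarith

end Hadamard

section FlatFunctions

/-- A smooth function with support in `O`, times a function that is smooth on `O`, is globally
smooth. -/
theorem contMDiff_mul_of_tsupport_subset {m : ℕ} {M : Type*} [TopologicalSpace M]
    [ChartedSpace (EuclideanSpace ℝ (Fin m)) M] (χ : C^∞⟮𝓡 m, M; 𝓘(ℝ, ℝ), ℝ⟯)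
    {g : M → ℝ} {O : Set M} (hO : IsOpen O) (hχ : tsupport χ ⊆ O)
    (hg : ContMDiffOn (𝓡 m) 𝓘(ℝ, ℝ) ∞ g O) :
    ContMDiff (𝓡 m) 𝓘(ℝ, ℝ) ∞ (fun y => χ y * g y) := by
  refine contMDiff_of_tsupport fun x hx => ?_
  have : x ∈ O := hχ (closure_mono (Function.support_mul_subset_left _ _) hx)
  exact χ.contMDiff.contMDiffAt.mul (hg.contMDiffAt (hO.mem_nhds this))

variable {m : ℕ} {M : Type*} [TopologicalSpace M] [ChartedSpace (EuclideanSpace ℝ (Fin m)) M]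
  [IsManifold (𝓡 m) ∞ M] [T2Space M]
  {ξ : OpenPartialHomeomorph M (EuclideanSpace ℝ (Fin m))}
  (hξ : ξ ∈ IsManifold.maximalAtlas (𝓡 m) ∞ M)
include hξ

/-- A smooth function whose value and first derivatives vanish at `x` is a sum of products of two
smooth functions vanishing at `x`. -/
theorem exists_sum_mul_of_flat {x : M} (hx : x ∈ ξ.source) (a : C^∞⟮𝓡 m, M; 𝓘(ℝ, ℝ), ℝ⟯)
    (h0 : a x = 0) (h1 : ∀ k, normedPartialDeriv ξ k a x = 0) :
    ∃ p q : Option (Fin m) → C^∞⟮𝓡 m, M; 𝓘(ℝ, ℝ), ℝ⟯, (∀ k, p k x = 0) ∧ (∀ k, q k x = 0) ∧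
      a = ∑ k, p k * q k := by
  have hsm := contDiffOn_comp_chart_symm hξ (O := Set.univ) a.contMDiff.contMDiffOn
  simp only [Set.preimage_univ, Set.inter_univ] at hsm
  -- Extend the local representative of `a` to a smooth function on `ℝ^m`.
  obtain ⟨r, hr, hball⟩ := Metric.isOpen_iff.1 ξ.open_target _ (ξ.map_source hx)
  let β : ContDiffBump (ξ x) := ⟨r / 4, r / 2, by linarith, by linarith⟩
  let f : EuclideanSpace ℝ (Fin m) → ℝ := fun y => β y * a (ξ.symm y)
  have hf : ContDiff ℝ ∞ f := by
    rw [contDiff_iff_contDiffAt]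
    intro y
    by_cases hy : y ∈ Metric.closedBall (ξ x) (r / 2)
    · exact β.contDiff.contDiffAt.mul (hsm.contDiffAt (ξ.open_target.mem_nhds
        (hball (Metric.closedBall_subset_ball (by linarith) hy))))
    · refine (contDiffAt_const (c := (0 : ℝ))).congr_of_eventuallyEq ?_
      filter_upwards [Metric.isClosed_closedBall.isOpen_compl.mem_nhds hy] with z hz
      have : β z = 0 := β.zero_of_le_dist
          (not_le.1 (show ¬ dist z (ξ x) ≤ r / 2 from hz)).le
      simp [f, this]
  have hfa : ∀ y ∈ Metric.ball (ξ x) (r / 4), f y = a (ξ.symm y) := fun y hy => by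
    have : β y = 1 := β.one_of_mem_closedBall (Metric.ball_subset_closedBall hy)
    simp [f, this]
  obtain ⟨g, hg, hgp, hsum⟩ := exists_hadamard hf (ξ x)
  have hg0 : ∀ k, g k (ξ x) = 0 := fun k => by
    rw [hgp, ← h1 k, normedPartialDeriv_eq_fderiv hξ isOpen_univ a.contMDiff.contMDiffOn hx trivial,
      Filter.EventuallyEq.fderiv_eq]
    filter_upwards [Metric.ball_mem_nhds (ξ x) (by linarith : 0 < r / 4)] with y hy using hfa y hy
  have hf0 : f (ξ x) = 0 := by
    rw [hfa _ (Metric.mem_ball_self (by linarith)), ξ.left_inv hx, h0]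
  let O : Set M := ξ.source ∩ ξ ⁻¹' Metric.ball (ξ x) (r / 4)
  have hO : IsOpen O := ξ.isOpen_inter_preimage Metric.isOpen_ball
  obtain ⟨χ, hχ, hχ1⟩ := exists_smooth_bump (m := m) x
    (hO.mem_nhds ⟨hx, Metric.mem_ball_self (by linarith : 0 < r / 4)⟩)
  have hξO : ContMDiffOn (𝓡 m) 𝓘(ℝ, EuclideanSpace ℝ (Fin m)) ∞ ξ O :=
    (contMDiffOn_of_mem_maximalAtlas hξ).mono Set.inter_subset_left
  have hP : ∀ k, ContMDiffOn (𝓡 m) 𝓘(ℝ, ℝ) ∞ (fun y => ξ y k - ξ x k) O := fun k =>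
    (((EuclideanSpace.proj k : EuclideanSpace ℝ (Fin m) →L[ℝ] ℝ).contDiff.sub
      contDiff_const).contMDiff (n := ∞)).comp_contMDiffOn hξO
  have hQ : ∀ k, ContMDiffOn (𝓡 m) 𝓘(ℝ, ℝ) ∞ (fun y => g k (ξ y)) O := fun k =>
    (hg k).contMDiff.comp_contMDiffOn hξO
  let P : Fin m → C^∞⟮𝓡 m, M; 𝓘(ℝ, ℝ), ℝ⟯ := fun k =>
    ⟨_, contMDiff_mul_of_tsupport_subset χ hO hχ (hP k)⟩
  let Q : Fin m → C^∞⟮𝓡 m, M; 𝓘(ℝ, ℝ), ℝ⟯ := fun k =>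
    ⟨_, contMDiff_mul_of_tsupport_subset χ hO hχ (hQ k)⟩
  -- `a = (1 - χ²) a + χ² a`, and Hadamard's lemma applies to the second term.
  refine ⟨fun k => k.elim (1 - χ * χ) P, fun k => k.elim a Q, ?_, ?_, ?_⟩
  · rintro (_ | k)
    · simp [hχ1.self_of_nhds]
    · show χ x * (ξ x k - ξ x k) = 0
      rw [sub_self, mul_zero]
  · rintro (_ | k)
    · exact h0
    · show χ x * g k (ξ x) = 0
      rw [hg0, mul_zero]
  · ext y
    have hev : ∀ s : Finset (Fin m), (∑ k ∈ s, P k * Q k) y = ∑ k ∈ s, P k y * Q k y := fun s => by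
      classical
      induction s using Finset.induction_on with
      | empty => simp
      | insert b s hb ih => simp [Finset.sum_insert hb, ih]
    rw [Fintype.sum_option]
    simp only [Option.elim_none, Option.elim_some]
    show a y = (1 - χ y * χ y) * a y + (∑ k, P k * Q k) y
    rw [hev]
    by_cases hy : y ∈ O
    · have h2 := hsum (ξ y)
      rw [hf0, hfa _ hy.2, ξ.left_inv hy.1, zero_add] at h2
      have h3 : ∑ k, P k y * Q k y = χ y * χ y * a y := by
        rw [h2, Finset.mul_sum]
        refine Finset.sum_congr rfl fun k _ => ?_
        show (χ y * (ξ y k - ξ x k)) * (χ y * g k (ξ y)) = _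
        ring
      rw [h3]; ring
    · have : χ y = 0 := image_eq_zero_of_notMem_tsupport fun h => hy (hχ h)
      have h3 : ∀ k, P k y = 0 := fun k => by
        show χ y * _ = 0
        rw [this, zero_mul]
      simp [this, h3]

end FlatFunctions

/-! ### `1`-jets of sections -/

namespace SmoothVectorBundle

variable {m : ℕ} {𝕂 : Type*} [RCLike 𝕂]
  {M : Type*} [TopologicalSpace M] [ChartedSpace (EuclideanSpace ℝ (Fin m)) M]
  {V : Type*} [AddCommGroup V] [Module 𝕂 V]
  {E : M → Type*} [∀ x, AddCommGroup (E x)] [∀ x, Module 𝕂 (E x)]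
  (A : SmoothVectorBundle m 𝕂 M V E)

/-- Multiplication with a smooth real function, as a linear map on smooth sections. -/
def smulSectionₗ (a : C^∞⟮𝓡 m, M; 𝓘(ℝ, ℝ), ℝ⟯) : A.sections →ₗ[𝕂] A.sections where
  toFun := A.smulSection a
  map_add' X Y := Subtype.ext <| funext fun x => smul_add _ (X.1 x) (Y.1 x)
  map_smul' c X := Subtype.ext <| funext fun x => smul_comm _ c (X.1 x)

theorem smulSectionₗ_apply (a : C^∞⟮𝓡 m, M; 𝓘(ℝ, ℝ), ℝ⟯) (X : A.sections) :
    A.smulSectionₗ a X = A.smulSection a X := rfl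

theorem smulSection_add_left (a b : C^∞⟮𝓡 m, M; 𝓘(ℝ, ℝ), ℝ⟯) (X : A.sections) :
    A.smulSection (a + b) X = A.smulSection a X + A.smulSection b X :=
  Subtype.ext <| funext fun x => by
    show ((a x + b x : ℝ) : 𝕂) • X.1 x = ((a x : ℝ) : 𝕂) • X.1 x + ((b x : ℝ) : 𝕂) • X.1 x
    rw [RCLike.ofReal_add, add_smul]

theorem smulSection_zero_left (X : A.sections) : A.smulSection 0 X = 0 :=
  Subtype.ext <| funext fun x => by
    show ((0 : ℝ) : 𝕂) • X.1 x = 0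
    rw [RCLike.ofReal_zero, zero_smul]

theorem smulSection_mul (a b : C^∞⟮𝓡 m, M; 𝓘(ℝ, ℝ), ℝ⟯) (X : A.sections) :
    A.smulSection (a * b) X = A.smulSection a (A.smulSection b X) :=
  Subtype.ext <| funext fun x => by
    show ((a x * b x : ℝ) : 𝕂) • X.1 x = ((a x : ℝ) : 𝕂) • ((b x : ℝ) : 𝕂) • X.1 x
    rw [RCLike.ofReal_mul, mul_smul]

theorem smulSection_sum_left {κ : Type*} (t : Finset κ) (a : κ → C^∞⟮𝓡 m, M; 𝓘(ℝ, ℝ), ℝ⟯)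
    (X : A.sections) : A.smulSection (∑ k ∈ t, a k) X = ∑ k ∈ t, A.smulSection (a k) X := by
  classical
  induction t using Finset.induction_on with
  | empty => simp [smulSection_zero_left]
  | insert b t hb ih => rw [Finset.sum_insert hb, Finset.sum_insert hb, smulSection_add_left, ih]

theorem eventually_mem_U {i : A.ι} {x : M} (hx : x ∈ A.U i) : ∀ᶠ y in nhds x, y ∈ A.U i :=
  (A.isOpen_U i).mem_nhds hx

theorem localForm_add (i : A.ι) (X Y : A.sections) {y : M} (hy : y ∈ A.U i) :
    A.localForm i (X + Y).1 y = A.localForm i X.1 y + A.localForm i Y.1 y := by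
  simp only [A.localForm_of_mem i _ hy]
  exact map_add _ _ _

theorem localForm_smul (i : A.ι) (c : 𝕂) (X : A.sections) {y : M} (hy : y ∈ A.U i) :
    A.localForm i (c • X).1 y = c • A.localForm i X.1 y := by
  simp only [A.localForm_of_mem i _ hy]
  exact map_smul _ _ _

theorem localForm_smulSection (i : A.ι) (a : C^∞⟮𝓡 m, M; 𝓘(ℝ, ℝ), ℝ⟯) (X : A.sections) {y : M}
    (hy : y ∈ A.U i) :
    A.localForm i (A.smulSection a X).1 y = (a y : 𝕂) • A.localForm i X.1 y := by
  simp only [A.localForm_of_mem i _ hy]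
  exact map_smul _ _ _

section Jets

variable [FiniteDimensional 𝕂 V]
  (i : A.ι) {ξ : OpenPartialHomeomorph M (EuclideanSpace ℝ (Fin m))}
  (hξ : ξ ∈ IsManifold.maximalAtlas (𝓡 m) ∞ M)

/-- The `1`-jet at `x` of a smooth section, in a bundle chart and a chart of the base: the value
and the first partial derivatives of the local form. -/
def jet {x : M} (hx : x ∈ A.U i ∩ ξ.source) : A.sections →ₗ[𝕂] V × (Fin m → V) where
  toFun X := (A.localForm i X.1 x, fun k => chartPartialDeriv 𝕂 ξ k (A.localForm i X.1) x)
  map_add' X Y := by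
    refine Prod.ext (A.localForm_add i X Y hx.1) (funext fun k => ?_)
    dsimp only
    rw [chartPartialDeriv_congr (𝕂 := 𝕂) hx.2 k (g := A.localForm i (X + Y).1)
      (h := fun y => A.localForm i X.1 y + A.localForm i Y.1 y)
      ((A.eventually_mem_U hx.1).mono fun y hy =>
        A.localForm_add i X Y hy),
      chartPartialDeriv_add hξ (A.isOpen_U i) (X.2 i) (Y.2 i) hx.2 hx.1]
    rfl
  map_smul' c X := by
    refine Prod.ext (A.localForm_smul i c X hx.1) (funext fun k => ?_)
    dsimp only
    rw [chartPartialDeriv_congr (𝕂 := 𝕂) hx.2 k (g := A.localForm i (c • X).1)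
      (h := fun y => (c • LinearMap.id : V →ₗ[𝕂] V) (A.localForm i X.1 y))
      ((A.eventually_mem_U hx.1).mono fun y hy =>
        A.localForm_smul i c X hy),
      chartPartialDeriv_map hξ (c • LinearMap.id) (A.isOpen_U i) (X.2 i) hx.2 hx.1]
    rfl

theorem jet_fst {x : M} (hx : x ∈ A.U i ∩ ξ.source) (X : A.sections) :
    (A.jet i hξ hx X).1 = A.localForm i X.1 x := rfl

theorem jet_snd {x : M} (hx : x ∈ A.U i ∩ ξ.source) (X : A.sections) (k : Fin m) :
    (A.jet i hξ hx X).2 k = chartPartialDeriv 𝕂 ξ k (A.localForm i X.1) x := rfl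

theorem jet_smulSection {x : M} (hx : x ∈ A.U i ∩ ξ.source) (a : C^∞⟮𝓡 m, M; 𝓘(ℝ, ℝ), ℝ⟯)
    (X : A.sections) :
    A.jet i hξ hx (A.smulSection a X) = ((a x : ℝ) : 𝕂) • A.jet i hξ hx X +
      (0, fun k => ((normedPartialDeriv ξ k a x : ℝ) : 𝕂) • A.localForm i X.1 x) := by
  refine Prod.ext ?_ (funext fun k => ?_)
  · rw [jet_fst, A.localForm_smulSection i a X hx.1, Prod.fst_add, add_zero]
    rfl
  · rw [jet_snd, chartPartialDeriv_congr (𝕂 := 𝕂) hx.2 k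
      (g := A.localForm i (A.smulSection a X).1)
      (h := fun y => (a y : 𝕂) • A.localForm i X.1 y)
      ((A.eventually_mem_U hx.1).mono fun y hy =>
        A.localForm_smulSection i a X hy),
      chartPartialDeriv_smul hξ (A.isOpen_U i) a.contMDiff.contMDiffOn (X.2 i) hx.2 hx.1]
    exact add_comm _ _

variable (ξ) in
/-- The affine map `y ↦ v + ∑ (ξ_k(y) - c_k) w_k` in the coordinates `ξ`, for `p = (v, w)`. -/
def affineMap (c : EuclideanSpace ℝ (Fin m)) (p : V × (Fin m → V)) : M → V :=
  fun y => p.1 + ∑ k, ((ξ y k - c k : ℝ) : 𝕂) • p.2 k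

include hξ in
theorem contMDiffOn_coord_sub (c : EuclideanSpace ℝ (Fin m)) (k : Fin m) :
    ContMDiffOn (𝓡 m) 𝓘(ℝ, ℝ) ∞ (fun y => ξ y k - c k) ξ.source :=
  (((EuclideanSpace.proj k : EuclideanSpace ℝ (Fin m) →L[ℝ] ℝ).contDiff.sub
    contDiff_const).contMDiff (n := ∞)).comp_contMDiffOn (contMDiffOn_of_mem_maximalAtlas hξ)

omit [FiniteDimensional 𝕂 V] in
include hξ in
theorem smooth_affineMap (c : EuclideanSpace ℝ (Fin m)) (p : V × (Fin m → V)) :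
    SmoothMapOn m 𝕂 (affineMap (𝕂 := 𝕂) ξ c p) ξ.source :=
  (SmoothMapOn.const p.1).add <| SmoothMapOn.sum _ fun k _ =>
    SmoothMapOn.smul_real (contMDiffOn_coord_sub hξ c k) (SmoothMapOn.const (p.2 k))

omit [ChartedSpace (EuclideanSpace ℝ (Fin m)) M] in
theorem normedPartialDeriv_coord {x : M} (hx : x ∈ ξ.source) (c : EuclideanSpace ℝ (Fin m))
    (k l : Fin m) : normedPartialDeriv ξ k (fun y => ξ y l - c l) x = if k = l then 1 else 0 := by
  have h : (fun t : ℝ => ξ (coordCurve ξ k x t) l - c l) =ᶠ[nhds 0] fun t =>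
      ξ x l + t * (EuclideanSpace.single k (1 : ℝ) : EuclideanSpace ℝ (Fin m)) l - c l := by
    filter_upwards [coord_coordCurve hx k l] with t ht
    rw [ht]
  rw [normedPartialDeriv, h.deriv_eq]
  have h2 := (((hasDerivAt_id (0 : ℝ)).mul_const
    ((EuclideanSpace.single k (1 : ℝ) : EuclideanSpace ℝ (Fin m)) l)).const_add
      (ξ x l)).sub_const (c l)
  refine h2.deriv.trans ?_
  simp [eq_comm]

include hξ in
theorem chartPartialDeriv_affineMap {x : M} (hx : x ∈ ξ.source) (c : EuclideanSpace ℝ (Fin m))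
    (p : V × (Fin m → V)) (k : Fin m) :
    chartPartialDeriv 𝕂 ξ k (affineMap (𝕂 := 𝕂) ξ c p) x = p.2 k := by
  have hs : ∀ l, SmoothMapOn m 𝕂 (fun y => ((ξ y l - c l : ℝ) : 𝕂) • p.2 l) ξ.source := fun l =>
    SmoothMapOn.smul_real (contMDiffOn_coord_sub hξ c l) (SmoothMapOn.const (p.2 l))
  have hconst : ∀ v : V, chartPartialDeriv 𝕂 ξ k (fun _ : M => v) x = 0 := fun v => by
    simp [chartPartialDeriv]
  have hsum : ∀ t : Finset (Fin m), chartPartialDeriv 𝕂 ξ k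
      (fun y => ∑ l ∈ t, ((ξ y l - c l : ℝ) : 𝕂) • p.2 l) x =
        ∑ l ∈ t, ((if k = l then 1 else 0 : ℝ) : 𝕂) • p.2 l := fun t => by
    classical
    induction t using Finset.induction_on with
    | empty => simpa using hconst 0
    | insert b t hb ih =>
      simp only [Finset.sum_insert hb]
      rw [chartPartialDeriv_add hξ ξ.open_source (hs b) (SmoothMapOn.sum _ fun l _ => hs l) hx hx,
        ih, chartPartialDeriv_smul hξ ξ.open_source (contMDiffOn_coord_sub hξ c b)
          (SmoothMapOn.const (p.2 b)) hx hx, hconst, smul_zero, add_zero,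
        normedPartialDeriv_coord hx]
  unfold affineMap
  rw [chartPartialDeriv_add hξ ξ.open_source (SmoothMapOn.const p.1)
    (SmoothMapOn.sum _ fun l _ => hs l) hx hx, hsum, hconst]
  simp

/-- The smooth section which, where the cutoff function `χ` is `1`, is given in the coordinates
`ξ` and the bundle chart `i` by `y ↦ v + ∑ (ξ_k(y) - c_k) w_k`. -/
def jetSection {χ : C^∞⟮𝓡 m, M; 𝓘(ℝ, ℝ), ℝ⟯} (hχ : tsupport χ ⊆ A.U i ∩ ξ.source)
    (c : EuclideanSpace ℝ (Fin m)) : (V × (Fin m → V)) →ₗ[𝕂] A.sections where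
  toFun p := A.cutoffSection i χ ((A.isOpen_U i).inter ξ.open_source) Set.inter_subset_left hχ
    ((smooth_affineMap (𝕂 := 𝕂) hξ c p).mono Set.inter_subset_right)
  map_add' p q := Subtype.ext <| funext fun y => by
    by_cases hy : y ∈ A.U i
    · refine (A.cutoff_apply i χ _ hy).trans (Eq.trans ?_ (congrArg₂ (· + ·)
        (A.cutoff_apply i χ _ hy) (A.cutoff_apply i χ _ hy)).symm)
      rw [← map_add]
      congr 1
      simp only [affineMap, Prod.fst_add, Prod.snd_add, Pi.add_apply, smul_add,
        Finset.sum_add_distrib]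
      abel
    · have h0 : χ y = 0 := image_eq_zero_of_notMem_tsupport fun h => hy (hχ h).1
      refine (A.cutoff_eq_zero i χ _ h0).trans (Eq.trans ?_ (congrArg₂ (· + ·)
        (A.cutoff_eq_zero i χ _ h0) (A.cutoff_eq_zero i χ _ h0)).symm)
      simp
  map_smul' r p := Subtype.ext <| funext fun y => by
    by_cases hy : y ∈ A.U i
    · refine (A.cutoff_apply i χ _ hy).trans (Eq.trans ?_ (congrArg (r • ·)
        (A.cutoff_apply i χ _ hy)).symm)
      simp only [← map_smul]
      rw [smul_comm r]
      simp only [affineMap, Prod.smul_fst, Prod.smul_snd, Pi.smul_apply, smul_add,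
        Finset.smul_sum, smul_comm r]
    · have h0 : χ y = 0 := image_eq_zero_of_notMem_tsupport fun h => hy (hχ h).1
      refine (A.cutoff_eq_zero i χ _ h0).trans (Eq.trans ?_ (congrArg (r • ·)
        (A.cutoff_eq_zero i χ _ h0)).symm)
      simp

theorem localForm_jetSection {χ : C^∞⟮𝓡 m, M; 𝓘(ℝ, ℝ), ℝ⟯} (hχ : tsupport χ ⊆ A.U i ∩ ξ.source)
    (c : EuclideanSpace ℝ (Fin m)) (p : V × (Fin m → V)) {y : M} (hy : y ∈ A.U i) :
    A.localForm i (A.jetSection i hξ hχ c p).1 y =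
      (χ y : 𝕂) • affineMap (𝕂 := 𝕂) ξ c p y :=
  A.localForm_cutoff i χ _ hy

theorem jet_jetSection {χ : C^∞⟮𝓡 m, M; 𝓘(ℝ, ℝ), ℝ⟯} (hχ : tsupport χ ⊆ A.U i ∩ ξ.source)
    (c : EuclideanSpace ℝ (Fin m)) (p : V × (Fin m → V)) {x : M} (hx : x ∈ A.U i ∩ ξ.source)
    (h1 : ∀ᶠ y in nhds x, χ y = 1) :
    A.jet i hξ hx (A.jetSection i hξ hχ c p) = (affineMap (𝕂 := 𝕂) ξ c p x, p.2) := by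
  have h : ∀ᶠ y in nhds x, A.localForm i (A.jetSection i hξ hχ c p).1 y =
      affineMap (𝕂 := 𝕂) ξ c p y := by
    filter_upwards [h1, (A.isOpen_U i).mem_nhds hx.1] with y hy hyU
    rw [A.localForm_jetSection i hξ hχ c p hyU, hy]
    simp
  refine Prod.ext h.self_of_nhds (funext fun k => ?_)
  rw [jet_snd, chartPartialDeriv_congr hx.2 k h, chartPartialDeriv_affineMap hξ hx.2]

omit [ChartedSpace (EuclideanSpace ℝ (Fin m)) M] [FiniteDimensional 𝕂 V] in
theorem affineMap_self (x : M) (p : V × (Fin m → V)) :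
    affineMap (𝕂 := 𝕂) ξ (ξ x) p x = p.1 := by
  simp [affineMap]

/-- A linear map on sections which kills all products `a X` where `a` vanishes to first order at
`x`, kills all sections which vanish to first order at `x`. -/
theorem eq_zero_of_jet_eq_zero [T2Space M] [IsManifold (𝓡 m) ∞ M]
    {W : Type*} [AddCommGroup W] [Module 𝕂 W] {x : M}
    (hx : x ∈ A.U i ∩ ξ.source) (δ : A.sections →ₗ[𝕂] W)
    (hδ : ∀ (a : C^∞⟮𝓡 m, M; 𝓘(ℝ, ℝ), ℝ⟯) (X : A.sections), a x = 0 →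
      (∀ k, normedPartialDeriv ξ k a x = 0) → δ (A.smulSection a X) = 0)
    {X : A.sections} (hX : A.jet i hξ hx X = 0) : δ X = 0 := by
  obtain ⟨χ, hχ, hχ1⟩ := exists_smooth_bump (m := m) x ((A.isOpen_U i).mem_nhds hx.1)
  let b := Module.finBasis 𝕂 V
  let Z : Fin (Module.finrank 𝕂 V) → A.sections := fun j =>
    A.cutoffSection i χ (A.isOpen_U i) subset_rfl hχ (SmoothMapOn.const (b j))
  have hcoord := fun j => X.2 i (b.coord j)
  have hre := fun j => RCLike.reCLM.contDiff.contMDiff.comp_contMDiffOn (hcoord j)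
  have him := fun j => RCLike.imCLM.contDiff.contMDiff.comp_contMDiffOn (hcoord j)
  let u : Fin (Module.finrank 𝕂 V) → C^∞⟮𝓡 m, M; 𝓘(ℝ, ℝ), ℝ⟯ := fun j =>
    ⟨_, contMDiff_mul_of_tsupport_subset χ (A.isOpen_U i) hχ (hre j)⟩
  let v : Fin (Module.finrank 𝕂 V) → C^∞⟮𝓡 m, M; 𝓘(ℝ, ℝ), ℝ⟯ := fun j =>
    ⟨_, contMDiff_mul_of_tsupport_subset χ (A.isOpen_U i) hχ (him j)⟩
  have hu : ∀ j y, u j y = χ y * RCLike.re (b.coord j (A.localForm i X.1 y)) := fun _ _ => rfl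
  have hv : ∀ j y, v j y = χ y * RCLike.im (b.coord j (A.localForm i X.1 y)) := fun _ _ => rfl
  have hX0 : A.localForm i X.1 x = 0 := congrArg Prod.fst hX
  have hX1 : ∀ j k, fderiv ℝ (fun y => b.coord j (A.localForm i X.1 (ξ.symm y))) (ξ x)
      (EuclideanSpace.single k (1 : ℝ)) = 0 := fun j k => by
    rw [← normedPartialDeriv_eq_fderiv hξ (A.isOpen_U i) (hcoord j) hx.2 hx.1,
      ← dual_chartPartialDeriv hξ (A.isOpen_U i) (X.2 i) hx.2 hx.1,
      ← A.jet_snd i hξ hx, hX]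
    simp
  have hu0 : ∀ j, u j x = 0 := fun j => by rw [hu, hX0]; simp
  have hv0 : ∀ j, v j x = 0 := fun j => by rw [hv, hX0]; simp
  have hu1 : ∀ j k, normedPartialDeriv ξ k (u j) x = 0 := fun j k => by
    rw [normedPartialDeriv_congr hx.2 k (h := fun y =>
      RCLike.re (b.coord j (A.localForm i X.1 y)))
      (hχ1.mono fun y hy => by rw [hu, hy, one_mul])]
    have := (RCLike.reCLM (K := 𝕂)).hasFDerivAt.comp_hasDerivAt (0 : ℝ)
      (hasDerivAt_coordCurve hξ (A.isOpen_U i) (hcoord j) hx.2 hx.1 k)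
    refine this.deriv.trans ?_
    rw [hX1, map_zero]
  have hv1 : ∀ j k, normedPartialDeriv ξ k (v j) x = 0 := fun j k => by
    rw [normedPartialDeriv_congr hx.2 k (h := fun y =>
      RCLike.im (b.coord j (A.localForm i X.1 y)))
      (hχ1.mono fun y hy => by rw [hv, hy, one_mul])]
    have := (RCLike.imCLM (K := 𝕂)).hasFDerivAt.comp_hasDerivAt (0 : ℝ)
      (hasDerivAt_coordCurve hξ (A.isOpen_U i) (hcoord j) hx.2 hx.1 k)
    refine this.deriv.trans ?_
    rw [hX1, map_zero]
  have hone : ∀ᶠ y in nhds x, (1 - χ * χ) y = (0 : ℝ) := hχ1.mono fun y hy => by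
    show 1 - χ y * χ y = 0
    rw [hy]; norm_num
  -- `X = (1 - χ²) X + χ² X`, where `1 - χ²` vanishes near `x` and `χ² X` is expanded in the local
  -- frame `χ b_j`, with coefficients `u_j + i v_j` that vanish to first order at `x`.
  have hdec : X = A.smulSection (1 - χ * χ) X +
      ∑ j, (A.smulSection (u j) (Z j) + A.smulSection (v j) ((RCLike.I : 𝕂) • Z j)) := by
    have hev : ∀ y, (∑ j, (A.smulSection (u j) (Z j) +
        A.smulSection (v j) ((RCLike.I : 𝕂) • Z j))).1 y =
        ∑ j, (((u j y : ℝ) : 𝕂) • (Z j).1 y + ((v j y : ℝ) : 𝕂) • (RCLike.I : 𝕂) • (Z j).1 y) :=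
      fun y => by
        rw [AddSubmonoidClass.coe_finsetSum, Finset.sum_apply]
        rfl
    refine Subtype.ext <| funext fun y => ?_
    show X.1 y = ((1 - χ y * χ y : ℝ) : 𝕂) • X.1 y + _
    rw [hev]
    by_cases hy : y ∈ A.U i
    · have hZ : ∀ j, (Z j).1 y = (A.chart i y hy).symm ((χ y : 𝕂) • b j) := fun j =>
        A.cutoffSection_apply i χ _ _ _ _ hy
      have hsum : ∑ j, (((u j y : ℝ) : 𝕂) • (Z j).1 y +
          ((v j y : ℝ) : 𝕂) • (RCLike.I : 𝕂) • (Z j).1 y) = ((χ y * χ y : ℝ) : 𝕂) • X.1 y := by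
        have h2 : X.1 y = (A.chart i y hy).symm (∑ j, b.coord j (A.localForm i X.1 y) • b j) := by
          rw [show ∑ j, b.coord j (A.localForm i X.1 y) • b j = A.localForm i X.1 y from
            b.sum_repr _, A.localForm_of_mem i _ hy, LinearEquiv.symm_apply_apply]
        conv_rhs => rw [h2, map_sum, Finset.smul_sum]
        refine Finset.sum_congr rfl fun j _ => ?_
        rw [hZ, hu, hv]
        simp only [map_smul, smul_smul, ← add_smul]
        congr 1
        conv_rhs => rw [← RCLike.re_add_im (b.coord j (A.localForm i X.1 y))]
        push_cast
        ring
      rw [hsum, ← add_smul, ← RCLike.ofReal_add]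
      simp
    · have h0 : χ y = 0 := image_eq_zero_of_notMem_tsupport fun h => hy (hχ h)
      simp [hu, hv, h0]
  rw [hdec, map_add, map_sum, hδ _ _ hone.self_of_nhds (fun k => ?_), zero_add]
  · refine Finset.sum_eq_zero fun j _ => ?_
    rw [map_add, hδ _ _ (hu0 j) (hu1 j), hδ _ _ (hv0 j) (hv1 j), add_zero]
  · rw [normedPartialDeriv_congr hx.2 k hone]
    simp [normedPartialDeriv]

/-- A linear map on sections which kills all products `a X` where `a` vanishes to first order at
`x`, factors through the `1`-jet at `x`. -/
theorem eq_comp_jet [T2Space M] [IsManifold (𝓡 m) ∞ M]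
    {W : Type*} [AddCommGroup W] [Module 𝕂 W] {x : M}
    (hx : x ∈ A.U i ∩ ξ.source) (δ : A.sections →ₗ[𝕂] W)
    (hδ : ∀ (a : C^∞⟮𝓡 m, M; 𝓘(ℝ, ℝ), ℝ⟯) (X : A.sections), a x = 0 →
      (∀ k, normedPartialDeriv ξ k a x = 0) → δ (A.smulSection a X) = 0) :
    ∃ T : (V × (Fin m → V)) →ₗ[𝕂] W, ∀ X, δ X = T (A.jet i hξ hx X) := by
  obtain ⟨χ, hχ, hχ1⟩ := exists_smooth_bump (m := m) x
    (((A.isOpen_U i).inter ξ.open_source).mem_nhds hx)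
  refine ⟨δ ∘ₗ A.jetSection i hξ hχ (ξ x), fun X => ?_⟩
  rw [← sub_eq_zero, LinearMap.comp_apply, ← map_sub]
  refine A.eq_zero_of_jet_eq_zero i hξ hx δ hδ ?_
  rw [map_sub, A.jet_jetSection i hξ hχ _ _ hx hχ1, affineMap_self, sub_self]

theorem jet_surjective [T2Space M] [IsManifold (𝓡 m) ∞ M] {x : M} (hx : x ∈ A.U i ∩ ξ.source) :
    Function.Surjective (A.jet i hξ hx) := fun p => by
  obtain ⟨χ, hχ, hχ1⟩ := exists_smooth_bump (m := m) x
    (((A.isOpen_U i).inter ξ.open_source).mem_nhds hx)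
  exact ⟨A.jetSection i hξ hχ (ξ x) p, by
    rw [A.jet_jetSection i hξ hχ _ _ hx hχ1, affineMap_self]⟩

end Jets

end SmoothVectorBundle

/-! ### The local form of an `x`-derivation -/

theorem lieCentroid_apply_lie {𝕂 𝔤 : Type*} [RCLike 𝕂] [LieRing 𝔤] [LieAlgebra 𝕂 𝔤]
    (f : lieCentroid 𝕂 𝔤) (u v : 𝔤) : f.1 ⁅u, v⁆ = ⁅u, f.1 v⁆ := f.2 u v

theorem lieCentroid_apply_lie' {𝕂 𝔤 : Type*} [RCLike 𝕂] [LieRing 𝔤] [LieAlgebra 𝕂 𝔤]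
    (f : lieCentroid 𝕂 𝔤) (u v : 𝔤) : f.1 ⁅u, v⁆ = ⁅f.1 u, v⁆ := by
  rw [← lie_skew, map_neg, lieCentroid_apply_lie, lie_skew]

namespace LieAlgebraBundle

variable {m : ℕ} {𝕂 : Type*} [RCLike 𝕂]
  {M : Type*} [TopologicalSpace M] [ChartedSpace (EuclideanSpace ℝ (Fin m)) M]
  {𝔨 : Type*} [LieRing 𝔨] [LieAlgebra 𝕂 𝔨] [FiniteDimensional 𝕂 𝔨]
  {L : M → Type*} [∀ x, LieRing (L x)] [∀ x, LieAlgebra 𝕂 (L x)]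
  (A : LieAlgebraBundle m 𝕂 M 𝔨 L)

theorem lie_sections_apply (X Y : A.sections) (x : M) :
    (⁅X, Y⁆ : A.sections).1 x = ⁅X.1 x, Y.1 x⁆ :=
  rfl

theorem smulSection_lie (a : C^∞⟮𝓡 m, M; 𝓘(ℝ, ℝ), ℝ⟯) (X Y : A.sections) :
    A.smulSection a ⁅X, Y⁆ = ⁅A.smulSection a X, Y⁆ :=
  Subtype.ext <| funext fun x => (smul_lie _ (X.1 x) (Y.1 x)).symm

theorem smulSection_lie' (a : C^∞⟮𝓡 m, M; 𝓘(ℝ, ℝ), ℝ⟯) (X Y : A.sections) :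
    A.smulSection a ⁅X, Y⁆ = ⁅X, A.smulSection a Y⁆ :=
  Subtype.ext <| funext fun x => (lie_smul _ (X.1 x) (Y.1 x)).symm

theorem xDerivation_lie {x : M} (δ : A.xDerivations x) (X Y : A.sections) :
    δ.1 ⁅X, Y⁆ = ⁅δ.1 X, Y.1 x⁆ + ⁅X.1 x, δ.1 Y⁆ := δ.2 X Y

theorem localForm_lie (i : A.ι) (X Y : A.sections) {y : M} (hy : y ∈ A.U i) :
    A.localForm i (⁅X, Y⁆ : A.sections).1 y = ⁅A.localForm i X.1 y, A.localForm i Y.1 y⁆ := by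
  simp only [A.localForm_of_mem i _ hy]
  exact A.chart_lie i y hy _ _

/-- The defect `X ↦ δ(aX) - a(x) δ(X)` of an `x`-derivation may be moved to the second argument of
a bracket. -/
theorem defect_lie {x : M} (δ : A.xDerivations x) (a : C^∞⟮𝓡 m, M; 𝓘(ℝ, ℝ), ℝ⟯)
    (X Y : A.sections) :
    δ.1 (A.smulSection a ⁅X, Y⁆) - ((a x : ℝ) : 𝕂) • δ.1 ⁅X, Y⁆ =
      ⁅X.1 x, δ.1 (A.smulSection a Y) - ((a x : ℝ) : 𝕂) • δ.1 Y⁆ := by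
  rw [smulSection_lie', xDerivation_lie, xDerivation_lie, A.smulSection_apply]
  simp only [lie_smul, lie_sub, smul_add]
  abel

/-- The defect of an `x`-derivation may be moved to the first argument of a bracket. -/
theorem defect_lie' {x : M} (δ : A.xDerivations x) (a : C^∞⟮𝓡 m, M; 𝓘(ℝ, ℝ), ℝ⟯)
    (X Y : A.sections) :
    δ.1 (A.smulSection a ⁅X, Y⁆) - ((a x : ℝ) : 𝕂) • δ.1 ⁅X, Y⁆ =
      ⁅δ.1 (A.smulSection a X) - ((a x : ℝ) : 𝕂) • δ.1 X, Y.1 x⁆ := by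
  rw [smulSection_lie, xDerivation_lie, xDerivation_lie, A.smulSection_apply]
  simp only [smul_lie, sub_lie, smul_add]
  abel

/-- The defect `X ↦ δ(aX) - a(x) δ(X)` of every `x`-derivation `δ` vanishes on the sections `X`
with `X_x = 0`; by linearity this says that it only depends on the value `X_x`. This is the one
consequence of `𝔨` being perfect or centerfree on which the local form of `x`-derivations rests. -/
def DefectFactors : Prop :=
  ∀ (x : M) (δ : A.xDerivations x) (a : C^∞⟮𝓡 m, M; 𝓘(ℝ, ℝ), ℝ⟯) (X : A.sections), X.1 x = 0 →
    δ.1 (A.smulSection a X) = ((a x : ℝ) : 𝕂) • δ.1 X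

/-- In the centerfree case the defect of a section `X` vanishing at `x` is central, hence zero: its
bracket with `Y_x` is the defect of `[Y, X]`, which is also the bracket of the defect of `Y` with
`X_x = 0`. -/
theorem defectFactors_of_center_eq_bot [T2Space M] [IsManifold (𝓡 m) ∞ M]
    (h : LieAlgebra.center 𝕂 𝔨 = ⊥) : A.DefectFactors := by
  intro x δ a X hX
  rw [← sub_eq_zero]
  obtain ⟨i, hi⟩ := A.cover x
  refine (A.chart i x hi).injective ?_
  rw [map_zero]
  have hc : A.chart i x hi (δ.1 (A.smulSection a X) - ((a x : ℝ) : 𝕂) • δ.1 X) ∈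
      LieAlgebra.center 𝕂 𝔨 := by
    rw [LieModule.mem_maxTrivSubmodule]
    intro v
    obtain ⟨Y, hY⟩ := A.exists_section_eq x ((A.chart i x hi).symm v)
    have h1 := A.defect_lie δ a Y X
    rw [A.defect_lie' δ a Y X, hX, lie_zero, hY] at h1
    rw [← (A.chart i x hi).apply_symm_apply v, ← A.chart_lie, ← h1, map_zero]
  rwa [h, LieSubmodule.mem_bot] at hc

/-- If every section vanishing at `x` is a finite sum of brackets `[Y_j, W_j]` with `Y_j` vanishing
at `x`, then the defect factors through the value at `x`: the defect of `[Y_j, W_j]` is the bracket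
of `(Y_j)_x = 0` with the defect of `W_j`. -/
theorem defectFactors_of_decomposition
    (h : ∀ (x : M) (X : A.sections), X.1 x = 0 → ∃ (N : ℕ) (Y W : Fin N → A.sections),
      (∀ j, (Y j).1 x = 0) ∧ X = ∑ j, ⁅Y j, W j⁆) : A.DefectFactors := by
  intro x δ a X hX
  obtain ⟨N, Y, W, hY, rfl⟩ := h x X hX
  rw [← A.smulSectionₗ_apply, map_sum, map_sum, map_sum, Finset.smul_sum]
  refine Finset.sum_congr rfl fun j _ => ?_
  have := A.defect_lie δ a (Y j) (W j)
  rw [hY, zero_lie, sub_eq_zero] at this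
  exact this

section Charts

variable (i : A.ι) {ξ : OpenPartialHomeomorph M (EuclideanSpace ℝ (Fin m))}
  (hξ : ξ ∈ IsManifold.maximalAtlas (𝓡 m) ∞ M)

/-- The product rule: the bracket of sections acts on `1`-jets as the bracket of
`𝔨 ⊗ ℝ[ε_1, …, ε_m] / (ε_k ε_l)`. -/
theorem jet_lie {x : M} (hx : x ∈ A.U i ∩ ξ.source) (X Y : A.sections) :
    A.jet i hξ hx ⁅X, Y⁆ = (⁅(A.jet i hξ hx X).1, (A.jet i hξ hx Y).1⁆,
      fun k => ⁅(A.jet i hξ hx X).2 k, (A.jet i hξ hx Y).1⁆ +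
        ⁅(A.jet i hξ hx X).1, (A.jet i hξ hx Y).2 k⁆) := by
  refine Prod.ext (A.localForm_lie i X Y hx.1) (funext fun k => ?_)
  simp only [SmoothVectorBundle.jet_snd, SmoothVectorBundle.jet_fst]
  rw [chartPartialDeriv_congr (𝕂 := 𝕂) hx.2 k (g := A.localForm i (⁅X, Y⁆ : A.sections).1)
    (h := fun y => (LieModule.toEnd 𝕂 𝔨 𝔨 : 𝔨 →ₗ[𝕂] Module.End 𝕂 𝔨) (A.localForm i X.1 y)
      (A.localForm i Y.1 y))
    ((A.eventually_mem_U hx.1).mono fun y hy => A.localForm_lie i X Y hy),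
    chartPartialDeriv_bilin hξ (LieModule.toEnd 𝕂 𝔨 𝔨 : 𝔨 →ₗ[𝕂] Module.End 𝕂 𝔨) (A.isOpen_U i)
      (X.2 i) (Y.2 i) hx.2 hx.1]
  rfl

/-- The `x`-derivation `X ↦ D(X(x)) + ∑ S^k(∂_k X(x))` given in local coordinates by a derivation
`D` and centroid elements `S^k`. -/
def ofLocal {x : M} (hx : x ∈ A.U i ∩ ξ.source) :
    (LieDerivation 𝕂 𝔨 𝔨 × (Fin m → lieCentroid 𝕂 𝔨)) →ₗ[𝕂] A.xDerivations x where
  toFun p := ⟨(A.chart i x hx.1).symm.toLinearMap ∘ₗ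
      (p.1.toLinearMap ∘ₗ LinearMap.fst 𝕂 _ _ +
        ∑ k, (p.2 k).1 ∘ₗ LinearMap.proj k ∘ₗ LinearMap.snd 𝕂 _ _) ∘ₗ A.jet i hξ hx,
    fun X Y => by
      have hX : X.1 x = (A.chart i x hx.1).symm (A.jet i hξ hx X).1 := by
        rw [A.jet_fst, A.localForm_of_mem i _ hx.1, LinearEquiv.symm_apply_apply]
      have hY : Y.1 x = (A.chart i x hx.1).symm (A.jet i hξ hx Y).1 := by
        rw [A.jet_fst, A.localForm_of_mem i _ hx.1, LinearEquiv.symm_apply_apply]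
      have hl : ∀ v w, (A.chart i x hx.1).symm ⁅v, w⁆ =
          ⁅(A.chart i x hx.1).symm v, (A.chart i x hx.1).symm w⁆ := fun v w => by
        refine (A.chart i x hx.1).injective ?_
        rw [A.chart_lie]
        simp
      rw [hX, hY]
      simp only [LinearMap.comp_apply, LinearEquiv.coe_coe, ← hl, ← map_add]
      congr 1
      rw [A.jet_lie]
      simp only [LinearMap.add_apply, LinearMap.sum_apply, LinearMap.comp_apply,
        LinearMap.fst_apply, LinearMap.snd_apply, LinearMap.proj_apply, map_add, add_lie, lie_add]
      have h1 : p.1.toLinearMap ⁅(A.jet i hξ hx X).1, (A.jet i hξ hx Y).1⁆ =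
          ⁅p.1.toLinearMap (A.jet i hξ hx X).1, (A.jet i hξ hx Y).1⁆ +
          ⁅(A.jet i hξ hx X).1, p.1.toLinearMap (A.jet i hξ hx Y).1⁆ := by
        have := p.1.apply_lie_eq_add (A.jet i hξ hx X).1 (A.jet i hξ hx Y).1
        exact this.trans (add_comm _ _)
      rw [h1, sum_lie, lie_sum, Finset.sum_add_distrib]
      simp only [lieCentroid_apply_lie' _ ((A.jet i hξ hx X).2 _),
        lieCentroid_apply_lie _ _ ((A.jet i hξ hx Y).2 _)]
      abel⟩
  map_add' p q := by
    refine Subtype.ext <| LinearMap.ext fun X => ?_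
    refine (A.chart i x hx.1).injective ?_
    simp [Finset.sum_add_distrib]
    abel
  map_smul' c p := by
    refine Subtype.ext <| LinearMap.ext fun X => ?_
    refine (A.chart i x hx.1).injective ?_
    simp [Finset.smul_sum]

theorem ofLocal_apply {x : M} (hx : x ∈ A.U i ∩ ξ.source)
    (p : LieDerivation 𝕂 𝔨 𝔨 × (Fin m → lieCentroid 𝕂 𝔨)) (X : A.sections) :
    (A.ofLocal i hξ hx p).1 X = (A.chart i x hx.1).symm
      (p.1 (A.jet i hξ hx X).1 + ∑ k, (p.2 k).1 ((A.jet i hξ hx X).2 k)) := by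
  simp [ofLocal]

theorem ofLocal_injective [T2Space M] [IsManifold (𝓡 m) ∞ M] {x : M} (hx : x ∈ A.U i ∩ ξ.source) :
    Function.Injective (A.ofLocal i hξ hx) := by
  rw [← LinearMap.ker_eq_bot, LinearMap.ker_eq_bot']
  intro p hp
  have h : ∀ q : 𝔨 × (Fin m → 𝔨), p.1 q.1 + ∑ k, (p.2 k).1 (q.2 k) = 0 := fun q => by
    obtain ⟨X, rfl⟩ := A.jet_surjective i hξ hx q
    have := A.ofLocal_apply i hξ hx p X
    rw [hp] at this
    exact (A.chart i x hx.1).symm.injective (this.symm.trans (map_zero _).symm)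
  refine Prod.ext (LieDerivation.ext fun v => ?_) (funext fun k => Subtype.ext <|
    LinearMap.ext fun w => ?_)
  · simpa using h (v, 0)
  · have := h (0, Pi.single k w)
    rw [Finset.sum_eq_single k (fun l _ hl => by simp [Pi.single_eq_of_ne hl]) (by simp)] at this
    simpa using this

variable {A} in
/-- If `a` vanishes to first order at `x` then `δ(aX) = 0`: writing `a = ∑ p_k q_k` with functions
vanishing at `x`, the sections `q_k X` vanish at `x` and so have no defect with respect to `p_k`. -/
theorem DefectFactors.apply_smulSection_of_flat [T2Space M] [IsManifold (𝓡 m) ∞ M]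
    (H : A.DefectFactors) {x : M}
    (hξx : x ∈ ξ.source) (hξ : ξ ∈ IsManifold.maximalAtlas (𝓡 m) ∞ M)
    (δ : A.xDerivations x) (a : C^∞⟮𝓡 m, M; 𝓘(ℝ, ℝ), ℝ⟯)
    (X : A.sections) (h0 : a x = 0) (h1 : ∀ k, normedPartialDeriv ξ k a x = 0) :
    δ.1 (A.smulSection a X) = 0 := by
  obtain ⟨p, q, hp, hq, rfl⟩ := exists_sum_mul_of_flat hξ hξx a h0 h1
  rw [A.smulSection_sum_left, map_sum]
  refine Finset.sum_eq_zero fun k _ => ?_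
  rw [A.smulSection_mul, H x δ (p k) (A.smulSection (q k) X), hp]
  · simp
  · rw [A.smulSection_apply, hq]
    simp

variable {A} in
/-- Every `x`-derivation factors linearly through the `1`-jet at `x`. -/
theorem DefectFactors.exists_eq_jet [T2Space M] [IsManifold (𝓡 m) ∞ M] (H : A.DefectFactors) {x : M}
    (hx : x ∈ A.U i ∩ ξ.source) (δ : A.xDerivations x) :
    ∃ T : (𝔨 × (Fin m → 𝔨)) →ₗ[𝕂] L x, ∀ X, δ.1 X = T (A.jet i hξ hx X) :=
  A.eq_comp_jet i hξ hx δ.1 fun a X h0 h1 => H.apply_smulSection_of_flat hx.2 hξ δ a X h0 h1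

variable {A} in
/-- Every `x`-derivation has the local form given by a derivation and centroid elements: comparing
the Leibniz rule for sections with `1`-jets `(v, 0)` and `(w, 0)` shows that the part of order zero
is a derivation, comparing it for `(v, 0)` and `(0, w e_k)` that the coefficient of `∂_k` is in the
centroid. -/
theorem DefectFactors.ofLocal_surjective [T2Space M] [IsManifold (𝓡 m) ∞ M]
    (H : A.DefectFactors) {x : M}
    (hx : x ∈ A.U i ∩ ξ.source) : Function.Surjective (A.ofLocal i hξ hx) := by
  intro δ
  obtain ⟨T, hT⟩ := H.exists_eq_jet i hξ hx δ
  let c := A.chart i x hx.1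
  have hval : ∀ X : A.sections, c (X.1 x) = (A.jet i hξ hx X).1 := fun X => by
    rw [A.jet_fst, A.localForm_of_mem i _ hx.1]
  have hlie : ∀ X Y : A.sections, c (T (A.jet i hξ hx ⁅X, Y⁆)) =
      ⁅c (T (A.jet i hξ hx X)), (A.jet i hξ hx Y).1⁆ +
        ⁅(A.jet i hξ hx X).1, c (T (A.jet i hξ hx Y))⁆ := fun X Y => by
    rw [← hT, A.xDerivation_lie, map_add, A.chart_lie, A.chart_lie, hT, hT]
    rw [← hval, ← hval]
  let D : LieDerivation 𝕂 𝔨 𝔨 :=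
    { toLinearMap := c.toLinearMap ∘ₗ T ∘ₗ LinearMap.inl 𝕂 _ _
      leibniz' := fun v w => by
        obtain ⟨X, hX⟩ := A.jet_surjective i hξ hx (v, 0)
        obtain ⟨Y, hY⟩ := A.jet_surjective i hξ hx (w, 0)
        have h := hlie X Y
        rw [A.jet_lie, hX, hY] at h
        have h0 : (fun k : Fin m => ⁅(0 : Fin m → 𝔨) k, w⁆ + ⁅v, (0 : Fin m → 𝔨) k⁆) = 0 := by
          funext k; simp
        rw [h0] at h
        show c (T (⁅v, w⁆, 0)) = ⁅v, c (T (w, 0))⁆ - ⁅w, c (T (v, 0))⁆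
        rw [h, ← lie_skew w, sub_neg_eq_add, add_comm] }
  let S : Fin m → lieCentroid 𝕂 𝔨 := fun k =>
    ⟨c.toLinearMap ∘ₗ T ∘ₗ LinearMap.inr 𝕂 _ _ ∘ₗ LinearMap.single 𝕂 (fun _ => 𝔨) k, fun v w => by
      obtain ⟨X, hX⟩ := A.jet_surjective i hξ hx (v, 0)
      obtain ⟨Y, hY⟩ := A.jet_surjective i hξ hx (0, Pi.single k w)
      have h := hlie X Y
      rw [A.jet_lie, hX, hY] at h
      have h0 : (fun l : Fin m => ⁅(0 : Fin m → 𝔨) l, (0 : 𝔨)⁆ +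
          ⁅v, (Pi.single k w : Fin m → 𝔨) l⁆) = Pi.single k ⁅v, w⁆ := by
        funext l
        rcases eq_or_ne l k with rfl | hl
        · simp
        · simp [Pi.single_eq_of_ne hl]
      rw [h0, lie_zero, lie_zero, zero_add] at h
      exact h⟩
  refine ⟨(D, S), Subtype.ext <| LinearMap.ext fun X => ?_⟩
  refine (A.chart i x hx.1).injective ?_
  rw [A.ofLocal_apply, LinearEquiv.apply_symm_apply, hT]
  show c (T ((A.jet i hξ hx X).1, 0)) +
    ∑ k, c (T (0, Pi.single k ((A.jet i hξ hx X).2 k))) = c (T (A.jet i hξ hx X))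
  rw [← map_sum, ← map_sum, ← map_add, ← map_add]
  congr 2
  refine Prod.ext ?_ ?_
  · simp [Prod.fst_sum]
  · rw [Prod.snd_add, Prod.snd_sum, zero_add]
    exact Finset.univ_sum_single _

/-- The local coordinates of `x`-derivations, as a linear isomorphism from the typical fiber. -/
def localEquiv [T2Space M] [IsManifold (𝓡 m) ∞ M]
    (H : A.DefectFactors) {x : M} (hx : x ∈ A.U i ∩ ξ.source) :
    (LieDerivation 𝕂 𝔨 𝔨 × (Fin m → lieCentroid 𝕂 𝔨)) ≃ₗ[𝕂] A.xDerivations x :=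
  LinearEquiv.ofBijective (A.ofLocal i hξ hx)
    ⟨A.ofLocal_injective i hξ hx, H.ofLocal_surjective i hξ hx⟩

end Charts

section DiffOp

omit [ChartedSpace (EuclideanSpace ℝ (Fin m)) M] in
theorem chartMultiDeriv_zero {V : Type*} [AddCommGroup V] [Module 𝕂 V] [FiniteDimensional 𝕂 V]
    (ξ : OpenPartialHomeomorph M (EuclideanSpace ℝ (Fin m))) (f : M → V) :
    chartMultiDeriv 𝕂 ξ 0 f = f := by
  have : ∀ l : List (Fin m), l.foldr
      (fun i g => (chartPartialDeriv 𝕂 ξ i)^[(0 : Fin m → ℕ) i] g) f = f := fun l => by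
    induction l with
    | nil => rfl
    | cons b l ih => simp
  exact this _

omit [ChartedSpace (EuclideanSpace ℝ (Fin m)) M] in
theorem chartMultiDeriv_single {V : Type*} [AddCommGroup V] [Module 𝕂 V] [FiniteDimensional 𝕂 V]
    (ξ : OpenPartialHomeomorph M (EuclideanSpace ℝ (Fin m))) (k : Fin m) (f : M → V) :
    chartMultiDeriv 𝕂 ξ (Pi.single k 1) f = chartPartialDeriv 𝕂 ξ k f := by
  have : ∀ l : List (Fin m), l.Nodup → l.foldr
      (fun i g => (chartPartialDeriv 𝕂 ξ i)^[(Pi.single k 1 : Fin m → ℕ) i] g) f =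
        if k ∈ l then chartPartialDeriv 𝕂 ξ k f else f := fun l hl => by
    induction l with
    | nil => rfl
    | cons b l ih =>
      rw [List.foldr_cons, ih hl.of_cons]
      rcases eq_or_ne b k with rfl | hb
      · have : b ∉ l := (List.nodup_cons.1 hl).1
        simp [this]
      · simp [hb.symm]
  rw [chartMultiDeriv, this _ (List.nodup_finRange m), if_pos (List.mem_finRange k)]

theorem isDiffOpOfOrderLEAt_one [T2Space M] [IsManifold (𝓡 m) ∞ M]
    (H : A.DefectFactors) (x : M) (δ : A.xDerivations x) :
    IsDiffOpOfOrderLEAt A.toSmoothVectorBundle 1 x δ.1 := by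
  classical
  intro i hi ξ hξ hx
  obtain ⟨T, hT⟩ := H.exists_eq_jet i hξ ⟨hi, hx⟩ δ
  refine ⟨fun α => (if α = 0 then T ∘ₗ LinearMap.inl 𝕂 _ _ else 0) +
    ∑ k, if α = Pi.single k 1 then
      T ∘ₗ LinearMap.inr 𝕂 _ _ ∘ₗ LinearMap.single 𝕂 (fun _ => 𝔨) k else 0, fun X => ?_⟩
  simp only [LinearMap.add_apply, LinearMap.sum_apply, Finset.sum_add_distrib]
  rw [Finset.sum_comm]
  have h : ∀ (s : Finset (Fin m → ℕ)) (β : Fin m → ℕ) (f : 𝔨 →ₗ[𝕂] L x), β ∈ s →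
      (∑ α ∈ s, (if α = β then f else 0) (chartMultiDeriv 𝕂 ξ α (A.localForm i X.1) x)) =
        f (chartMultiDeriv 𝕂 ξ β (A.localForm i X.1) x) := fun s β f hβ => by
    rw [Finset.sum_eq_single_of_mem β hβ]
    · simp
    · intro α _ hα
      simp [hα]
  rw [h _ 0 _ (by simp), Finset.sum_congr rfl fun k _ => h _ (Pi.single k 1) _ ?_]
  · simp only [chartMultiDeriv_zero, chartMultiDeriv_single]
    rw [hT]
    show _ = T ((A.jet i hξ ⟨hi, hx⟩ X).1, 0) +
      ∑ k, T (0, Pi.single k ((A.jet i hξ ⟨hi, hx⟩ X).2 k))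
    rw [← map_sum, ← map_add]
    congr 1
    refine Prod.ext ?_ ?_
    · simp [Prod.fst_sum]
    · rw [Prod.snd_add, Prod.snd_sum, zero_add]
      exact (Finset.univ_sum_single _).symm
  · rw [Finset.mem_filter, Fintype.mem_piFinset]
    refine ⟨fun l => ?_, by simp⟩
    rcases eq_or_ne l k with rfl | hl
    · simp
    · simp [Pi.single_eq_of_ne hl]

end DiffOp

end LieAlgebraBundle

/-! ### The bundle of `x`-derivations and its smooth sections -/

section SmoothProducts

theorem contMDiffOn_coord {m : ℕ} {M : Type*} [TopologicalSpace M]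
    [ChartedSpace (EuclideanSpace ℝ (Fin m)) M] [IsManifold (𝓡 m) ∞ M]
    {ξ : OpenPartialHomeomorph M (EuclideanSpace ℝ (Fin m))}
    (hξ : ξ ∈ IsManifold.maximalAtlas (𝓡 m) ∞ M) (k : Fin m) :
    ContMDiffOn (𝓡 m) 𝓘(ℝ, ℝ) ∞ (fun y => ξ y k) ξ.source :=
  (SmoothVectorBundle.contMDiffOn_coord_sub hξ 0 k).congr fun y _ => by simp

variable {m : ℕ} {𝕂 : Type*} [RCLike 𝕂]
  {M : Type*} [TopologicalSpace M] [ChartedSpace (EuclideanSpace ℝ (Fin m)) M]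
  {V W : Type*} [AddCommGroup V] [Module 𝕂 V] [AddCommGroup W] [Module 𝕂 W]

theorem SmoothMapOn.prodMk {f : M → V} {g : M → W} {s : Set M} (hf : SmoothMapOn m 𝕂 f s)
    (hg : SmoothMapOn m 𝕂 g s) : SmoothMapOn m 𝕂 (fun x => (f x, g x)) s :=
  ((hf.map (LinearMap.inl 𝕂 V W)).add (hg.map (LinearMap.inr 𝕂 V W))).congr fun x _ => by simp

theorem SmoothMapOn.pi {κ : Type*} [Fintype κ] {f : M → κ → V} {s : Set M}
    (hf : ∀ k, SmoothMapOn m 𝕂 (fun x => f x k) s) : SmoothMapOn m 𝕂 f s := by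
  classical
  exact (SmoothMapOn.sum Finset.univ fun k _ =>
    (hf k).map (LinearMap.single 𝕂 (fun _ : κ => V) k)).congr fun x _ =>
      (Finset.univ_sum_single (f x)).symm

theorem SmoothMapOn.neg {f : M → V} {s : Set M} (hf : SmoothMapOn m 𝕂 f s) :
    SmoothMapOn m 𝕂 (fun x => -f x) s :=
  hf.map (-LinearMap.id)

end SmoothProducts

section DerToEnd

variable (𝕂 : Type*) [RCLike 𝕂] (𝔤 : Type*) [LieRing 𝔤] [LieAlgebra 𝕂 𝔤]

/-- The inclusion of the derivations into the endomorphisms. -/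
def derToEnd : LieDerivation 𝕂 𝔤 𝔤 →ₗ[𝕂] (𝔤 →ₗ[𝕂] 𝔤) where
  toFun D := D.toLinearMap
  map_add' _ _ := rfl
  map_smul' _ _ := rfl

theorem derToEnd_injective : Function.Injective (derToEnd 𝕂 𝔤) := fun _ _ h =>
  LieDerivation.ext fun a => LinearMap.congr_fun h a

end DerToEnd

namespace LieAlgebraBundle

variable {m : ℕ} {𝕂 : Type*} [RCLike 𝕂]
  {M : Type uM} [TopologicalSpace M] [ChartedSpace (EuclideanSpace ℝ (Fin m)) M]
  {𝔨 : Type*} [LieRing 𝔨] [LieAlgebra 𝕂 𝔨] [FiniteDimensional 𝕂 𝔨]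
  {L : M → Type*} [∀ x, LieRing (L x)] [∀ x, LieAlgebra 𝕂 (L x)]
  (A : LieAlgebraBundle m 𝕂 M 𝔨 L)

section Coordinates

variable (i : A.ι) {ξ : OpenPartialHomeomorph M (EuclideanSpace ℝ (Fin m))}
  (hξ : ξ ∈ IsManifold.maximalAtlas (𝓡 m) ∞ M)

variable (ξ) in
/-- The local form of the section obtained by applying to `X` the family of `x`-derivations with
local coordinates `p`. -/
def localValue (p : M → LieDerivation 𝕂 𝔨 𝔨 × (Fin m → lieCentroid 𝕂 𝔨)) (X : A.sections) :
    M → 𝔨 :=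
  fun x => (p x).1 (A.localForm i X.1 x) +
    ∑ k, ((p x).2 k).1 (chartPartialDeriv 𝕂 ξ k (A.localForm i X.1) x)

theorem chart_ofLocal {x : M} (hx : x ∈ A.U i ∩ ξ.source)
    (p : M → LieDerivation 𝕂 𝔨 𝔨 × (Fin m → lieCentroid 𝕂 𝔨)) (X : A.sections) :
    A.chart i x hx.1 ((A.ofLocal i hξ hx (p x)).1 X) = A.localValue i ξ p X x := by
  rw [A.ofLocal_apply, LinearEquiv.apply_symm_apply]
  rfl

include hξ in
theorem smooth_localValue {p : M → LieDerivation 𝕂 𝔨 𝔨 × (Fin m → lieCentroid 𝕂 𝔨)} {O : Set M}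
    (hOi : O ⊆ A.U i ∩ ξ.source) (hp : SmoothMapOn m 𝕂 p O) (X : A.sections) :
    SmoothMapOn m 𝕂 (A.localValue i ξ p X) O := by
  have h1 := SmoothMapOn.bilin (LinearMap.id : (𝔨 →ₗ[𝕂] 𝔨) →ₗ[𝕂] 𝔨 →ₗ[𝕂] 𝔨)
    (hp.map (derToEnd 𝕂 𝔨 ∘ₗ LinearMap.fst 𝕂 _ _))
    ((X.2 i).mono fun x hx => (hOi hx).1)
  have h2 := fun k => SmoothMapOn.bilin (LinearMap.id : (𝔨 →ₗ[𝕂] 𝔨) →ₗ[𝕂] 𝔨 →ₗ[𝕂] 𝔨)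
    (hp.map ((lieCentroid 𝕂 𝔨).subtype ∘ₗ LinearMap.proj k ∘ₗ LinearMap.snd 𝕂 _ _))
    ((SmoothMapOn.chartPartialDeriv hξ (A.isOpen_U i) (X.2 i) k).mono hOi)
  exact h1.add (SmoothMapOn.sum Finset.univ fun k _ => h2 k)

include hξ in
/-- A family of `x`-derivations has smooth local coordinates as soon as it maps smooth sections to
smooth sections: test it on sections which are affine in local coordinates. -/
theorem smooth_of_smooth_localValue [T2Space M] [IsManifold (𝓡 m) ∞ M]
    {p : M → LieDerivation 𝕂 𝔨 𝔨 × (Fin m → lieCentroid 𝕂 𝔨)} {O : Set M}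
    (hOi : O ⊆ A.U i ∩ ξ.source) (hp : ∀ X, SmoothMapOn m 𝕂 (A.localValue i ξ p X) O) :
    SmoothMapOn m 𝕂 p O := by
  -- Around every point the values on all affine maps are smooth.
  have key : ∀ x₀ ∈ O, ∃ u, IsOpen u ∧ x₀ ∈ u ∧ ∀ q : 𝔨 × (Fin m → 𝔨), SmoothMapOn m 𝕂
      (fun x => (p x).1 (SmoothVectorBundle.affineMap (𝕂 := 𝕂) ξ (0 : EuclideanSpace ℝ (Fin m)) q x)
        + ∑ k, ((p x).2 k).1 (q.2 k)) (O ∩ u) := fun x₀ hx₀ => by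
    obtain ⟨χ, hχ, hχ1⟩ := exists_smooth_bump (m := m) x₀
      (((A.isOpen_U i).inter ξ.open_source).mem_nhds (hOi hx₀))
    obtain ⟨u, hu, huo, hxu⟩ := eventually_nhds_iff.1 hχ1
    refine ⟨u, huo, hxu, fun q => ((hp (A.jetSection i hξ hχ 0 q)).mono
      Set.inter_subset_left).congr fun x hx => ?_⟩
    have hj := A.jet_jetSection i hξ hχ 0 q (hOi hx.1)
      (Filter.eventually_of_mem (huo.mem_nhds hx.2) hu)
    have h1 := congrArg Prod.fst hj
    have h2 := fun k => congrFun (congrArg Prod.snd hj) k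
    simp only [SmoothVectorBundle.jet_fst, SmoothVectorBundle.jet_snd] at h1 h2
    simp only [localValue, h1, h2]
  have hD : ∀ v, SmoothMapOn m 𝕂 (fun x => (p x).1 v) O := fun v =>
    SmoothMapOn.of_locally fun x₀ hx₀ => by
      obtain ⟨u, hu, hxu, h⟩ := key x₀ hx₀
      refine ⟨u, hu, hxu, (h (v, 0)).congr fun x _ => ?_⟩
      simp [SmoothVectorBundle.affineMap]
  have hS : ∀ k w, SmoothMapOn m 𝕂 (fun x => ((p x).2 k).1 w) O := fun k w =>
    SmoothMapOn.of_locally fun x₀ hx₀ => by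
      obtain ⟨u, hu, hxu, h⟩ := key x₀ hx₀
      have hc := (contMDiffOn_coord hξ k).mono (hOi.trans Set.inter_subset_right)
      refine ⟨u, hu, hxu, ((h (0, Pi.single k w)).add
        (((hD w).smul_real hc).neg.mono Set.inter_subset_left)).congr fun x _ => ?_⟩
      have h0 : ∑ l, ((p x).2 l).1 ((Pi.single k w : Fin m → 𝔨) l) = ((p x).2 k).1 w := by
        rw [Finset.sum_eq_single k (fun l _ hl => by simp [Pi.single_eq_of_ne hl]) (by simp)]
        simp
      have h1 : SmoothVectorBundle.affineMap (𝕂 := 𝕂) ξ (0 : EuclideanSpace ℝ (Fin m))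
          ((0 : 𝔨), Pi.single k w) x = (ξ x k : 𝕂) • w := by
        simp only [SmoothVectorBundle.affineMap]
        rw [Finset.sum_eq_single k (fun l _ hl => by simp [Pi.single_eq_of_ne hl]) (by simp)]
        simp
      dsimp only
      rw [h0, h1, map_smul]
      abel
  refine SmoothMapOn.congr (f := fun x => ((p x).1, (p x).2))
    (SmoothMapOn.prodMk ?_ (SmoothMapOn.pi fun k => ?_)) fun _ _ => rfl
  · exact SmoothMapOn.of_injective (derToEnd 𝕂 𝔨) (derToEnd_injective 𝕂 𝔨)
      (SmoothMapOn.of_apply hD)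
  · exact SmoothMapOn.of_injective (lieCentroid 𝕂 𝔨).subtype Subtype.val_injective
      (SmoothMapOn.of_apply (hS k))

end Coordinates

section DerivationBundle

variable [IsManifold (𝓡 m) ∞ M] [T2Space M]

/-- The index of some bundle chart around `y`. -/
def chartIndexAt (y : M) : A.ι := (A.cover y).choose

omit [FiniteDimensional 𝕂 𝔨] [IsManifold (𝓡 m) ∞ M] [T2Space M] in
theorem mem_chartIndexAt (y : M) : y ∈ A.U (A.chartIndexAt y) := (A.cover y).choose_spec

omit [T2Space M] in
theorem chartAt_mem_maximalAtlas (y : M) :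
    chartAt (EuclideanSpace ℝ (Fin m)) y ∈ IsManifold.maximalAtlas (𝓡 m) ∞ M :=
  IsManifold.chart_mem_maximalAtlas y

/-- The domain of the local coordinates around `y`. -/
def coordDomain (y : M) : Set M :=
  A.U (A.chartIndexAt y) ∩ (chartAt (EuclideanSpace ℝ (Fin m)) y).source

omit [FiniteDimensional 𝕂 𝔨] [IsManifold (𝓡 m) ∞ M] [T2Space M] in
theorem isOpen_coordDomain (y : M) : IsOpen (A.coordDomain y) :=
  (A.isOpen_U _).inter (chartAt _ y).open_source

omit [FiniteDimensional 𝕂 𝔨] [IsManifold (𝓡 m) ∞ M] [T2Space M] in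
theorem mem_coordDomain (y : M) : y ∈ A.coordDomain y :=
  ⟨A.mem_chartIndexAt y, mem_chart_source _ y⟩

/-- The local coordinates around `y` of `x`-derivations. -/
def coordEquiv (H : A.DefectFactors) (y : M) {x : M} (hx : x ∈ A.coordDomain y) :
    (LieDerivation 𝕂 𝔨 𝔨 × (Fin m → lieCentroid 𝕂 𝔨)) ≃ₗ[𝕂] A.xDerivations x :=
  A.localEquiv (A.chartIndexAt y) (chartAt_mem_maximalAtlas y) H hx

theorem chart_coordEquiv (H : A.DefectFactors) (y : M) {x : M} (hx : x ∈ A.coordDomain y)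
    (p : M → LieDerivation 𝕂 𝔨 𝔨 × (Fin m → lieCentroid 𝕂 𝔨)) (X : A.sections) :
    A.chart (A.chartIndexAt y) x hx.1 ((A.coordEquiv H y hx (p x)).1 X) =
      A.localValue (A.chartIndexAt y) (chartAt _ y) p X x :=
  A.chart_ofLocal _ (chartAt_mem_maximalAtlas y) hx p X

/-- The local coordinates of a family of `x`-derivations are smooth if the family maps every smooth
section to a section with smooth local form. -/
theorem smooth_coordEquiv_symm (H : A.DefectFactors) (y : M) {O : Set M}
    (hOy : O ⊆ A.coordDomain y) {p : M → LieDerivation 𝕂 𝔨 𝔨 × (Fin m → lieCentroid 𝕂 𝔨)}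
    (δ : ∀ x ∈ O, A.xDerivations x)
    (hp : ∀ x (hx : x ∈ O), p x = (A.coordEquiv H y (hOy hx)).symm (δ x hx))
    (hδ : ∀ X : A.sections, ∃ f : M → 𝔨, SmoothMapOn m 𝕂 f O ∧
      ∀ x (hx : x ∈ O), f x = A.chart (A.chartIndexAt y) x (hOy hx).1 ((δ x hx).1 X)) :
    SmoothMapOn m 𝕂 p O := by
  refine A.smooth_of_smooth_localValue _ (chartAt_mem_maximalAtlas y) hOy fun X => ?_
  obtain ⟨f, hf, hfx⟩ := hδ X
  refine hf.congr fun x hx => ?_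
  rw [← A.chart_coordEquiv H y (hOy hx) p X, hfx x hx, hp x hx, LinearEquiv.apply_symm_apply]

/-- The vector bundle `𝒟(L)` of all `x`-derivations. Its charts are indexed by the points `y` of `M`
and come from a bundle chart of `L` and the preferred chart of `M` around `y`. -/
def xDerivationBundle (H : A.DefectFactors) : SmoothVectorBundle.{_, _, _, _, uM} m 𝕂 M
    (LieDerivation 𝕂 𝔨 𝔨 × (Fin m → lieCentroid 𝕂 𝔨)) (fun x => A.xDerivations x) where
  ι := M
  U := A.coordDomain
  isOpen_U := A.isOpen_coordDomain
  cover x := ⟨x, A.mem_coordDomain x⟩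
  chart y _ hx := (A.coordEquiv H y hx).symm
  smooth_transition y z p := by
    refine A.smooth_coordEquiv_symm H z
      Set.inter_subset_right (fun x hx => A.coordEquiv H y hx.1 p) (fun x hx => ?_) fun X => ?_
    · exact Subtype.val_injective.extend_apply
        (fun x : ↥(A.coordDomain y ∩ A.coordDomain z) =>
          (A.coordEquiv H z x.2.2).symm ((A.coordEquiv H y x.2.1).symm.symm p)) 0 ⟨x, hx⟩
    · have hs := A.smooth_localValue _ (chartAt_mem_maximalAtlas y)
        (O := A.coordDomain y ∩ A.coordDomain z) Set.inter_subset_left (SmoothMapOn.const p) X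
      let f : M → 𝔨 := fun x => A.transition (A.chartIndexAt y) (A.chartIndexAt z) x
        (A.localValue (A.chartIndexAt y) (chartAt _ y) (fun _ => p) X x)
      have hf : ∀ x (hx : x ∈ A.coordDomain y ∩ A.coordDomain z), f x =
          A.chart (A.chartIndexAt z) x hx.2.1 ((A.chart (A.chartIndexAt y) x hx.1.1).symm
            (A.localValue (A.chartIndexAt y) (chartAt _ y) (fun _ => p) X x)) :=
        fun x hx => A.transition_apply _ _ hx.1.1 hx.2.1 _
      refine ⟨f, A.smooth_transition_apply _ _ (fun x hx => ⟨hx.1.1, hx.2.1⟩) hs hf,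
        fun x hx => ?_⟩
      rw [hf x hx, ← A.chart_coordEquiv H y hx.1 (fun _ => p) X, LinearEquiv.symm_apply_apply]

/-- A family of `x`-derivations is a smooth section of `𝒟(L)` if and only if it maps smooth
sections to smooth sections. -/
theorem mem_sections_xDerivationBundle_iff (H : A.DefectFactors) (δ : ∀ x, A.xDerivations x) :
    δ ∈ (A.xDerivationBundle H).sections ↔
      ∀ X : A.sections, (fun x => (δ x).1 X) ∈ A.sections := by
  have hloc : ∀ (X : A.sections) (y x : M) (hx : x ∈ A.coordDomain y),
      A.localValue (A.chartIndexAt y) (chartAt _ y) ((A.xDerivationBundle H).localForm y δ) X x =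
        A.localForm (A.chartIndexAt y) (fun x => (δ x).1 X) x := fun X y x hx => by
    rw [← A.chart_coordEquiv H y hx, A.localForm_of_mem _ _ hx.1,
      (A.xDerivationBundle H).localForm_of_mem y δ hx]
    congr 3
    exact (A.coordEquiv H y hx).apply_symm_apply (δ x)
  constructor
  · intro hδ X
    refine A.mem_sections_of_locally fun y => ⟨A.chartIndexAt y, A.coordDomain y,
      A.isOpen_coordDomain y, A.mem_coordDomain y, Set.inter_subset_left, ?_⟩
    exact (A.smooth_localValue _ (chartAt_mem_maximalAtlas y) subset_rfl (hδ y) X).congr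
      fun x hx => (hloc X y x hx).symm
  · intro hδ (y : M)
    refine A.smooth_of_smooth_localValue _ (chartAt_mem_maximalAtlas y)
      subset_rfl fun X => ?_
    exact ((hδ X (A.chartIndexAt y)).mono Set.inter_subset_left).congr fun x hx => hloc X y x hx

/-- The evaluations `ev_x ∘ D` of a derivation `D` of `Γ(L)`. -/
def evalDerivation (D : LieDerivation 𝕂 A.sections A.sections) (x : M) : A.xDerivations x :=
  ⟨{ toFun := fun X => (D X).1 x
     map_add' := fun X Y => congrFun (congrArg Subtype.val (D.toLinearMap.map_add X Y)) x
     map_smul' := fun c X => congrFun (congrArg Subtype.val (D.toLinearMap.map_smul c X)) x },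
    fun X Y => by
      have := congrFun (congrArg Subtype.val (D.apply_lie_eq_add X Y)) x
      exact this.trans (add_comm _ _)⟩

/-- The isomorphism `D ↦ (x ↦ ev_x ∘ D)` from the derivations of `Γ(L)` onto the smooth sections of
`𝒟(L)`. -/
def derivationEquivSections (H : A.DefectFactors) :
    LieDerivation 𝕂 A.sections A.sections ≃ₗ[𝕂] (A.xDerivationBundle H).sections where
  toFun D := ⟨A.evalDerivation D,
    (A.mem_sections_xDerivationBundle_iff H _).2 fun X => (D X).2⟩
  map_add' _ _ := rfl
  map_smul' _ _ := rfl
  invFun δ :=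
    { toFun := fun X => ⟨fun x => (δ.1 x).1 X, (A.mem_sections_xDerivationBundle_iff H _).1 δ.2 X⟩
      map_add' := fun X Y => Subtype.ext <| funext fun x => (δ.1 x).1.map_add X Y
      map_smul' := fun c X => Subtype.ext <| funext fun x => (δ.1 x).1.map_smul c X
      leibniz' := fun X Y => Subtype.ext <| funext fun x => by
        have := (δ.1 x).2 X Y
        refine this.trans ?_
        show _ = ⁅X.1 x, (δ.1 x).1 Y⁆ - ⁅Y.1 x, (δ.1 x).1 X⁆
        rw [← lie_skew (Y.1 x), sub_neg_eq_add, add_comm] }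
  left_inv _ := rfl
  right_inv _ := rfl

/-- In local coordinates the natural injection is `D ↦ (D, 0)`. -/
theorem coordEquiv_derConj (H : A.DefectFactors) (y : M) {x : M} (hx : x ∈ A.coordDomain y)
    (D : LieDerivation 𝕂 (L x) (L x)) :
    A.coordEquiv H y hx (derConj (A.lieChart _ x hx.1) D, 0) = A.natInj x D := by
  refine Subtype.ext <| LinearMap.ext fun X => ?_
  refine (A.ofLocal_apply _ _ hx _ X).trans ?_
  simp only [Pi.zero_apply, ZeroMemClass.coe_zero, LinearMap.zero_apply, Finset.sum_const_zero,
    add_zero, derConj_apply]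
  have h0 : (A.jet (A.chartIndexAt y) (chartAt_mem_maximalAtlas y) hx X).1 =
      A.lieChart _ x hx.1 (X.1 x) := A.localForm_of_mem _ _ hx.1
  rw [h0, LieEquiv.symm_apply_apply]
  exact (A.chart _ x hx.1).symm_apply_apply _

theorem natInj_injective (x : M) : Function.Injective (A.natInj x) := fun D D' h =>
  LieDerivation.ext fun v => by
    obtain ⟨X, rfl⟩ := A.exists_section_eq x v
    exact LinearMap.congr_fun (congrArg Subtype.val h) X

theorem isBundleMorphism_natInj (H : A.DefectFactors) :
    SmoothVectorBundle.IsBundleMorphism A.derBundle (A.xDerivationBundle H) A.natInj := by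
  intro i y D
  refine A.smooth_coordEquiv_symm H y
    Set.inter_subset_right
    (fun x hx => A.natInj x ((derConj (A.lieChart i x hx.1)).symm D)) (fun x hx => ?_) fun X => ?_
  · exact Subtype.val_injective.extend_apply (fun x : ↥(A.U i ∩ A.coordDomain y) =>
      (A.coordEquiv H y x.2.2).symm
        (A.natInj x ((derConj (A.lieChart i x x.2.1)).symm D))) 0 ⟨x, hx⟩
  · let f : M → 𝔨 := fun x => A.transition i (A.chartIndexAt y) x (D (A.localForm i X.1 x))
    have hf : ∀ x (hx : x ∈ A.U i ∩ A.coordDomain y), f x =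
        A.chart (A.chartIndexAt y) x hx.2.1 ((A.chart i x hx.1).symm (D (A.localForm i X.1 x))) :=
      fun x hx => A.transition_apply _ _ hx.1 hx.2.1 _
    refine ⟨f, A.smooth_transition_apply _ _ (fun x hx => ⟨hx.1, hx.2.1⟩)
      (((X.2 i).map D.toLinearMap).mono Set.inter_subset_left) hf, fun x hx => ?_⟩
    rw [hf x hx, A.localForm_of_mem i _ hx.1]
    rfl

end DerivationBundle

end LieAlgebraBundle

/-! ### The symbol map -/

/-- The partial derivatives of a function in the preferred chart at `y` are the values of its
differential on the corresponding frame of the tangent bundle. -/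
theorem differentialAt_frame {m : ℕ} {M : Type*} [TopologicalSpace M]
    [ChartedSpace (EuclideanSpace ℝ (Fin m)) M] [IsManifold (𝓡 m) ∞ M]
    (a : C^∞⟮𝓡 m, M; 𝓘(ℝ, ℝ), ℝ⟯) {x y : M}
    (hx : x ∈ (chartAt (EuclideanSpace ℝ (Fin m)) y).source)
    (he : x ∈ (LieAlgebraBundle.tangentTriv m M y).baseSet) (k : Fin m) :
    differentialAt a x (((LieAlgebraBundle.tangentTriv m M y).linearEquivAt ℝ x he).symm
      (EuclideanSpace.single k 1)) =
      normedPartialDeriv (chartAt (EuclideanSpace ℝ (Fin m)) y) k a x := by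
  have hmax : chartAt (EuclideanSpace ℝ (Fin m)) y ∈ IsManifold.maximalAtlas (𝓡 m) ∞ M :=
    IsManifold.chart_mem_maximalAtlas y
  rw [normedPartialDeriv_eq_fderiv hmax isOpen_univ a.contMDiff.contMDiffOn hx trivial]
  have : IsManifold (𝓡 m) 1 M := IsManifold.of_le (n := ∞) (by simp)
  set w : TangentSpace (𝓡 m) x :=
    ((LieAlgebraBundle.tangentTriv m M y).linearEquivAt ℝ x he).symm (EuclideanSpace.single k 1)
  set ξ := chartAt (EuclideanSpace ℝ (Fin m)) y
  have hw : mfderiv (𝓡 m) (𝓡 m) ξ x w = EuclideanSpace.single k (1 : ℝ) := by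
    have h1 := TangentBundle.continuousLinearMapAt_trivializationAt (I := 𝓡 m) (x₀ := y) hx
    have h2 : mfderiv (𝓡 m) (𝓡 m) ξ x w =
        (LieAlgebraBundle.tangentTriv m M y).continuousLinearMapAt ℝ x w := by
      rw [h1]; rfl
    rw [h2]
    have h3 := (LieAlgebraBundle.tangentTriv m M y).linearEquivAt ℝ x he
      |>.apply_symm_apply (EuclideanSpace.single k (1 : ℝ))
    rw [← h3, Bundle.Trivialization.continuousLinearMapAt_apply,
      Bundle.Trivialization.linearMapAt_def_of_mem _ he]
    rfl
  have hg : MDifferentiableAt (𝓡 m) 𝓘(ℝ, ℝ) (fun z => a (ξ.symm z)) (ξ x) := by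
    have := contDiffOn_comp_chart_symm hmax (O := Set.univ) a.contMDiff.contMDiffOn
    simp only [Set.preimage_univ, Set.inter_univ] at this
    exact ((this.contDiffAt (ξ.open_target.mem_nhds (ξ.map_source hx))).differentiableAt
      (by simp)).mdifferentiableAt
  have hξ : MDifferentiableAt (𝓡 m) (𝓡 m) ξ x :=
    ((contMDiffOn_of_mem_maximalAtlas hmax).contMDiffAt
      (ξ.open_source.mem_nhds hx)).mdifferentiableAt (by simp)
  have hcomp : mfderiv (𝓡 m) 𝓘(ℝ, ℝ) a x =
      mfderiv (𝓡 m) 𝓘(ℝ, ℝ) ((fun z => a (ξ.symm z)) ∘ ξ) x := by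
    refine Filter.EventuallyEq.mfderiv_eq ?_
    filter_upwards [ξ.open_source.mem_nhds hx] with z hz
    simp [ξ.left_inv hz]
  show mfderiv (𝓡 m) 𝓘(ℝ, ℝ) a x w = _
  rw [hcomp, mfderiv_comp x hg hξ]
  show mfderiv (𝓡 m) 𝓘(ℝ, ℝ) (fun z => a (ξ.symm z)) (ξ x) (mfderiv (𝓡 m) (𝓡 m) ξ x w) = _
  rw [hw, mfderiv_eq_fderiv]
  rfl

section TensorBasis

variable {m : ℕ} {𝕂 : Type*} [RCLike 𝕂] (𝔤 : Type*) [LieRing 𝔤] [LieAlgebra 𝕂 𝔤]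

variable (m 𝕂) in
/-- The map `(f_k) ↦ ∑ f_k ⊗ e_k` from `Cent(𝔤)^m` to `Cent(𝔤) ⊗ ℝ^m`, which is bijective. -/
def tensorSum : (Fin m → lieCentroid 𝕂 𝔤) →ₗ[𝕂]
    lieCentroid 𝕂 𝔤 ⊗[ℝ] EuclideanSpace ℝ (Fin m) where
  toFun f := ∑ k, f k ⊗ₜ[ℝ] EuclideanSpace.single k (1 : ℝ)
  map_add' f g := by simp [TensorProduct.add_tmul, Finset.sum_add_distrib]
  map_smul' c f := by simp [Finset.smul_sum, TensorProduct.smul_tmul']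

theorem tensorSum_apply (f : Fin m → lieCentroid 𝕂 𝔤) :
    tensorSum m 𝕂 𝔤 f = ∑ k, f k ⊗ₜ[ℝ] EuclideanSpace.single k (1 : ℝ) := rfl

theorem tensorSum_surjective : Function.Surjective (tensorSum m 𝕂 𝔤) := by
  intro t
  induction t using TensorProduct.induction_on with
  | zero => exact ⟨0, map_zero _⟩
  | add t t' h h' =>
    obtain ⟨f, rfl⟩ := h
    obtain ⟨f', rfl⟩ := h'
    exact ⟨f + f', map_add _ _ _⟩
  | tmul f v =>
    refine ⟨fun k => v k • f, ?_⟩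
    rw [tensorSum_apply]
    conv_rhs => rw [← (EuclideanSpace.basisFun (Fin m) ℝ).sum_repr v]
    rw [TensorProduct.tmul_sum]
    refine Finset.sum_congr rfl fun k _ => ?_
    rw [TensorProduct.tmul_smul, TensorProduct.smul_tmul']
    simp

theorem tensorSum_injective : Function.Injective (tensorSum m 𝕂 𝔤) := by
  intro f g h
  funext l
  have := congrArg (TensorProduct.lift ((LinearMap.lsmul ℝ (lieCentroid 𝕂 𝔤)).flip.compl₂
    (EuclideanSpace.proj l : EuclideanSpace ℝ (Fin m) →L[ℝ] ℝ).toLinearMap)) h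
  simpa [tensorSum_apply] using this

end TensorBasis

namespace CentTensorTangent

variable {m : ℕ} {𝕂 : Type*} [RCLike 𝕂]
  {M : Type*} [TopologicalSpace M] [ChartedSpace (EuclideanSpace ℝ (Fin m)) M]
  {L : M → Type*} [∀ x, LieRing (L x)] [∀ x, LieAlgebra 𝕂 (L x)]

theorem contract_sub (x : M) (α : TangentSpace (𝓡 m) x →ₗ[ℝ] ℝ) (t t' : CentTensorTangent m 𝕂 L x) :
    contract x α (t - t') = contract x α t - contract x α t' :=
  map_sub (TensorProduct.lift ((LinearMap.lsmul ℝ (lieCentroid 𝕂 (L x))).flip.compl₂ α)) t t'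

theorem contract_sum (x : M) (α : TangentSpace (𝓡 m) x →ₗ[ℝ] ℝ) {κ : Type*} (s : Finset κ)
    (t : κ → CentTensorTangent m 𝕂 L x) :
    contract x α (∑ k ∈ s, t k) = ∑ k ∈ s, contract x α (t k) :=
  map_sum (TensorProduct.lift ((LinearMap.lsmul ℝ (lieCentroid 𝕂 (L x))).flip.compl₂ α)) t s

end CentTensorTangent

namespace LieAlgebraBundle

variable {m : ℕ} {𝕂 : Type*} [RCLike 𝕂]
  {M : Type uM} [TopologicalSpace M] [ChartedSpace (EuclideanSpace ℝ (Fin m)) M]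
  {𝔨 : Type*} [LieRing 𝔨] [LieAlgebra 𝕂 𝔨] [FiniteDimensional 𝕂 𝔨]
  {L : M → Type*} [∀ x, LieRing (L x)] [∀ x, LieAlgebra 𝕂 (L x)]
  (A : LieAlgebraBundle m 𝕂 M 𝔨 L) [IsManifold (𝓡 m) ∞ M] [T2Space M]

omit [FiniteDimensional 𝕂 𝔨] [T2Space M] in
theorem mem_baseSet_tangentTriv {y x : M} (hx : x ∈ A.coordDomain y) :
    x ∈ (tangentTriv m M y).baseSet := hx.2

/-- The chart of `Cent(L) ⊗ TM` around `y` belonging to the local coordinates around `y`. -/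
def coordTensorChart (y : M) {x : M} (hx : x ∈ A.coordDomain y) :
    CentTensorTangent m 𝕂 L x ≃ₗ[𝕂] (lieCentroid 𝕂 𝔨 ⊗[ℝ] EuclideanSpace ℝ (Fin m)) :=
  A.tensorChart (A.chartIndexAt y) (tangentTriv m M y) x hx.1 (A.mem_baseSet_tangentTriv hx)

omit [FiniteDimensional 𝕂 𝔨] [T2Space M] in
theorem contract_coordTensorChart_symm (y : M) {x : M} (hx : x ∈ A.coordDomain y)
    (a : C^∞⟮𝓡 m, M; 𝓘(ℝ, ℝ), ℝ⟯) (f : Fin m → lieCentroid 𝕂 𝔨) :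
    CentTensorTangent.contract x (differentialAt a x)
      ((A.coordTensorChart y hx).symm (tensorSum m 𝕂 𝔨 f)) =
      ∑ k, normedPartialDeriv (chartAt (EuclideanSpace ℝ (Fin m)) y) k a x •
        (centConj (A.lieChart _ x hx.1)).symm (f k) := by
  rw [tensorSum_apply, map_sum, CentTensorTangent.contract_sum]
  refine Finset.sum_congr rfl fun k _ => ?_
  rw [← differentialAt_frame a hx.2 (A.mem_baseSet_tangentTriv hx)]
  rfl

omit [FiniteDimensional 𝕂 𝔨] in
include A in
/-- The tensors in `Cent(L x) ⊗ T_x M` are separated by contraction with differentials of smooth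
functions. -/
theorem eq_zero_of_contract_eq_zero {x : M} (t : CentTensorTangent m 𝕂 L x)
    (h : ∀ a : C^∞⟮𝓡 m, M; 𝓘(ℝ, ℝ), ℝ⟯,
      CentTensorTangent.contract x (differentialAt a x) t = 0) : t = 0 := by
  have hx := A.mem_coordDomain x
  obtain ⟨f, hf⟩ := tensorSum_surjective (m := m) (𝕂 := 𝕂) 𝔨 (A.coordTensorChart x hx t)
  rw [← (A.coordTensorChart x hx).symm_apply_apply t, ← hf] at h ⊢
  have hξ := chartAt_mem_maximalAtlas (m := m) x
  set ξ := chartAt (EuclideanSpace ℝ (Fin m)) x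
  have hf0 : f = 0 := by
    obtain ⟨χ, hχ, hχ1⟩ := exists_smooth_bump (m := m) x (ξ.open_source.mem_nhds hx.2)
    funext l
    let a : C^∞⟮𝓡 m, M; 𝓘(ℝ, ℝ), ℝ⟯ := ⟨_, contMDiff_mul_of_tsupport_subset χ ξ.open_source hχ
      (SmoothVectorBundle.contMDiffOn_coord_sub hξ 0 l)⟩
    have ha : ∀ k, normedPartialDeriv ξ k a x = if k = l then 1 else 0 := fun k => by
      rw [← SmoothVectorBundle.normedPartialDeriv_coord hx.2 0 k l]
      refine normedPartialDeriv_congr hx.2 k (hχ1.mono fun y hy => ?_)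
      show χ y * _ = _
      rw [hy, one_mul]
    have h1 := h a
    rw [A.contract_coordTensorChart_symm x hx a f] at h1
    simp only [ξ] at ha
    simp only [ha, ite_smul, one_smul, zero_smul, Finset.sum_ite_eq', Finset.mem_univ,
      if_true] at h1
    exact (centConj (A.lieChart _ x hx.1)).symm.injective (h1.trans (map_zero _).symm)
  rw [hf0, map_zero, map_zero]

/-- The symbol in the local coordinates around `y`: the `x`-derivation with coordinates `(D, S)` is
mapped to `∑ S^k ⊗ ∂_k`. -/
def coordSymbol (H : A.DefectFactors) (y : M) {x : M} (hx : x ∈ A.coordDomain y) :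
    A.xDerivations x →ₗ[𝕂] CentTensorTangent m 𝕂 L x :=
  (A.coordTensorChart y hx).symm.toLinearMap ∘ₗ tensorSum m 𝕂 𝔨 ∘ₗ LinearMap.snd 𝕂 _ _ ∘ₗ
    (A.coordEquiv H y hx).symm.toLinearMap

theorem coordSymbol_coordEquiv (H : A.DefectFactors) (y : M) {x : M} (hx : x ∈ A.coordDomain y)
    (p : LieDerivation 𝕂 𝔨 𝔨 × (Fin m → lieCentroid 𝕂 𝔨)) :
    A.coordSymbol H y hx (A.coordEquiv H y hx p) =
      (A.coordTensorChart y hx).symm (tensorSum m 𝕂 𝔨 p.2) := by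
  simp [coordSymbol]

/-- The symbol computes the failure of `C^∞`-linearity. -/
theorem contract_coordSymbol (H : A.DefectFactors) (y : M) {x : M} (hx : x ∈ A.coordDomain y)
    (δ : A.xDerivations x) (a : C^∞⟮𝓡 m, M; 𝓘(ℝ, ℝ), ℝ⟯) (X : A.sections) :
    (CentTensorTangent.contract x (differentialAt a x) (A.coordSymbol H y hx δ)).1 (X.1 x) =
      δ.1 (A.smulSection a X) - ((a x : ℝ) : 𝕂) • δ.1 X := by
  obtain ⟨p, rfl⟩ := (A.coordEquiv H y hx).surjective δ
  rw [coordSymbol_coordEquiv, A.contract_coordTensorChart_symm y hx]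
  have hξ := chartAt_mem_maximalAtlas (m := m) y
  have hx' : x ∈ A.U (A.chartIndexAt y) ∩ (chartAt (EuclideanSpace ℝ (Fin m)) y).source := hx
  let c := A.chart (A.chartIndexAt y) x hx'.1
  have h1 : ∀ Z : A.sections, (A.coordEquiv H y hx p).1 Z = c.symm
      (p.1 (A.jet (A.chartIndexAt y) hξ hx' Z).1 +
        ∑ k, (p.2 k).1 ((A.jet (A.chartIndexAt y) hξ hx' Z).2 k)) :=
    fun Z => A.ofLocal_apply _ hξ hx' p Z
  rw [h1, h1, A.jet_smulSection, ← map_smul c.symm, ← map_sub c.symm]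
  have hsum : ∀ g : Fin m → lieCentroid 𝕂 (L x), (∑ k, g k).1 (X.1 x) = ∑ k, (g k).1 (X.1 x) :=
    fun g => by rw [AddSubmonoidClass.coe_finsetSum, LinearMap.sum_apply]
  rw [hsum]
  refine c.injective ?_
  rw [c.apply_symm_apply, map_sum]
  have hterm : ∀ k, c ((normedPartialDeriv (chartAt (EuclideanSpace ℝ (Fin m)) y) k a x •
      (centConj (A.lieChart _ x hx'.1)).symm (p.2 k)).1 (X.1 x)) =
      (p.2 k).1 (((normedPartialDeriv (chartAt (EuclideanSpace ℝ (Fin m)) y) k a x : ℝ) : 𝕂) •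
        A.localForm (A.chartIndexAt y) X.1 x) := fun k => by
    rw [map_smul, A.localForm_of_mem _ _ hx.1]
    refine (map_smul c _ _).trans (congrArg _ ?_)
    exact c.apply_symm_apply _
  rw [Finset.sum_congr rfl fun k _ => hterm k]
  simp only [Prod.fst_add, Prod.snd_add, Prod.smul_fst, Prod.smul_snd, Pi.add_apply, Pi.smul_apply,
    map_add, Finset.sum_add_distrib, smul_add, Finset.smul_sum, add_zero]
  have hsmul : ∀ (r : 𝕂) (v : 𝔨), p.1 (r • v) = r • p.1 v := p.1.toLinearMap.map_smul
  simp only [LinearMap.map_smul, hsmul]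
  abel

/-- The symbol does not depend on the choice of local coordinates, since its contractions with
differentials of functions do not. -/
theorem coordSymbol_eq (H : A.DefectFactors) (y z : M) {x : M} (hy : x ∈ A.coordDomain y)
    (hz : x ∈ A.coordDomain z) : A.coordSymbol H y hy = A.coordSymbol H z hz := by
  refine LinearMap.ext fun δ => ?_
  rw [← sub_eq_zero]
  refine A.eq_zero_of_contract_eq_zero _ fun a => Subtype.ext <| LinearMap.ext fun v => ?_
  obtain ⟨X, rfl⟩ := A.exists_section_eq x v
  rw [CentTensorTangent.contract_sub]
  show (CentTensorTangent.contract x (differentialAt a x) (A.coordSymbol H y hy δ)).1 (X.1 x) -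
    (CentTensorTangent.contract x (differentialAt a x) (A.coordSymbol H z hz δ)).1 (X.1 x) = 0
  rw [contract_coordSymbol, contract_coordSymbol, sub_self]

/-- The symbol map, computed at each point `x` in the local coordinates around `x` itself. -/
def symbol (H : A.DefectFactors) (x : M) : A.xDerivations x →ₗ[𝕂] CentTensorTangent m 𝕂 L x :=
  A.coordSymbol H x (A.mem_coordDomain x)

theorem isSymbolMap_symbol (H : A.DefectFactors) : A.IsSymbolMap (A.symbol H) :=
  fun x δ a X => A.contract_coordSymbol H x (A.mem_coordDomain x) δ a X

theorem isBundleMorphism_symbol (H : A.DefectFactors) :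
    SmoothVectorBundle.IsBundleMorphism (A.xDerivationBundle H) A.centTensorTangentBundle
      (A.symbol H) := by
  rintro (y : M) ⟨j, z⟩ p
  obtain ⟨g, hg, h⟩ := A.exists_smooth_tensor (A.chartIndexAt y) j (tangentTriv m M y)
    (tangentTriv m M z) (tensorSum m 𝕂 𝔨 p.2)
  refine hg.extend fun x => ?_
  rw [h x x.2.1.1 x.2.1.2 x.2.2.1 x.2.2.2]
  show _ = A.tensorChart j (tangentTriv m M z) x _ _ (A.symbol H x (A.coordEquiv H y x.2.1 p))
  rw [symbol, A.coordSymbol_eq H x y _ x.2.1]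
  exact congrArg _ (A.coordSymbol_coordEquiv H y x.2.1 p).symm

theorem exact_natInj_symbol (H : A.DefectFactors) (x : M) :
    Function.Exact (A.natInj x) (A.symbol H x) := by
  have hx := A.mem_coordDomain x
  intro δ
  constructor
  · intro h
    obtain ⟨p, rfl⟩ := (A.coordEquiv H x hx).surjective δ
    rw [symbol, coordSymbol_coordEquiv] at h
    have h2 : p.2 = 0 := tensorSum_injective 𝔨 ((A.coordTensorChart x hx).symm.injective
      (h.trans (by rw [map_zero, map_zero])))
    refine ⟨(derConj (A.lieChart _ x hx.1)).symm p.1, ?_⟩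
    rw [← A.coordEquiv_derConj H x hx, LinearEquiv.apply_symm_apply, ← h2]
  · rintro ⟨D, rfl⟩
    rw [symbol, ← A.coordEquiv_derConj H x hx, coordSymbol_coordEquiv, map_zero, map_zero]

theorem symbol_surjective (H : A.DefectFactors) (x : M) : Function.Surjective (A.symbol H x) := by
  intro t
  have hx := A.mem_coordDomain x
  obtain ⟨f, hf⟩ := tensorSum_surjective (m := m) (𝕂 := 𝕂) 𝔨 (A.coordTensorChart x hx t)
  refine ⟨A.coordEquiv H x hx (0, f), ?_⟩
  rw [symbol, coordSymbol_coordEquiv, hf, LinearEquiv.symm_apply_apply]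

end LieAlgebraBundle

/-! ### Generic linear combinations of generating families -/

section Transversality

variable {m k N : ℕ} {𝕂 : Type*} [RCLike 𝕂] {κ : Type*} [Fintype κ]

/-- The `k × N`-matrix whose `j`-th column is the linear combination `∑ c_{n,j} z_n` of the vectors
`z_n` of `𝕂^k`. -/
def combinationMatrix (c : κ → Fin N → 𝕂) (z : κ → Fin k → 𝕂) : Fin k → Fin N → 𝕂 :=
  fun a j => ∑ n, c n j * z n a

/-- The combinations `∑ c_{n,j} z_n` generate `𝕂^k`, that is, their matrix has independent rows, if
and only if no nonzero functional annihilates all of them. -/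
theorem linearIndependent_combinationMatrix_iff (c : κ → Fin N → 𝕂) (z : κ → Fin k → 𝕂) :
    LinearIndependent 𝕂 (combinationMatrix c z) ↔
      ∀ ℓ : Fin k → 𝕂, (∀ j, ∑ n, c n j * ∑ a, ℓ a * z n a = 0) → ℓ = 0 := by
  rw [Fintype.linearIndependent_iff]
  have h : ∀ ℓ : Fin k → 𝕂, ∑ a, ℓ a • combinationMatrix c z a = 0 ↔
      ∀ j, ∑ n, c n j * ∑ a, ℓ a * z n a = 0 := fun ℓ => by
    rw [funext_iff]
    refine forall_congr' fun j => ?_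
    rw [Finset.sum_apply, Pi.zero_apply]
    simp only [Pi.smul_apply, smul_eq_mul, combinationMatrix, Finset.mul_sum]
    rw [Finset.sum_comm]
    simp only [mul_left_comm]
  simp only [h, funext_iff, Pi.zero_apply]

/-- The coefficients `c` with `∑ c_{n,j} ℓ(z_n(x)) = 0` for all `j`, parametrized by `x`, by a
functional `ℓ` normalized by `ℓ(z_p(x)) = 1`, and by the coefficients with `n ≠ p`. -/
def degenerateParam [DecidableEq κ] (z : κ → EuclideanSpace ℝ (Fin m) → Fin k → 𝕂) (p : κ)
    (q : EuclideanSpace ℝ (Fin m) × (Fin k → 𝕂) × ({n // n ≠ p} → Fin N → 𝕂)) :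
    κ → Fin N → 𝕂 :=
  fun n j => if h : n ≠ p then q.2.2 ⟨n, h⟩ j
    else -∑ n' : {n // n ≠ p}, q.2.2 n' j * ∑ a, q.2.1 a * z n' q.1 a

theorem contDiffAt_degenerateParam [DecidableEq κ]
    {z : κ → EuclideanSpace ℝ (Fin m) → Fin k → 𝕂} (p : κ)
    (q : EuclideanSpace ℝ (Fin m) × (Fin k → 𝕂) × ({n // n ≠ p} → Fin N → 𝕂))
    (hz : ∀ n, ContDiffAt ℝ 1 (z n) q.1) : ContDiffAt ℝ 1 (degenerateParam (N := N) z p) q := by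
  have hc : ∀ (n : {n // n ≠ p}) (j : Fin N), ContDiffAt ℝ 1
      (fun q : EuclideanSpace ℝ (Fin m) × (Fin k → 𝕂) × ({n // n ≠ p} → Fin N → 𝕂) =>
        q.2.2 n j) q := fun n j => by fun_prop
  refine contDiffAt_pi.2 fun n => contDiffAt_pi.2 fun j => ?_
  by_cases h : n ≠ p
  · simp only [degenerateParam, dif_pos h]
    exact hc ⟨n, h⟩ j
  · simp only [degenerateParam, dif_neg h]
    refine (ContDiffAt.sum fun n' _ => (hc n' j).mul (ContDiffAt.sum fun a _ => ?_)).neg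
    refine ContDiffAt.mul (by fun_prop) ?_
    exact (contDiffAt_pi.1 (hz n') a).comp q contDiffAt_fst

/-- If `m + k < N`, then for a dense set of coefficients the `N` linear combinations of the maps
`z_n`, which generate `𝕂^k` at each point of a subset of `ℝ^m`, still generate: the set of bad
coefficients is a union of `C^1`-images of spaces of too small a dimension, so its complement is
dense. -/
theorem dense_setOf_linearIndependent_combination (hN : m + k < N)
    {z : κ → EuclideanSpace ℝ (Fin m) → Fin k → 𝕂} {C Ω : Set (EuclideanSpace ℝ (Fin m))}
    (hΩ : IsOpen Ω) (hC : C ⊆ Ω) (hz : ∀ n, ContDiffOn ℝ 1 (z n) Ω)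
    (hspan : ∀ x ∈ C, ∀ ℓ : Fin k → 𝕂, (∀ n, ∑ a, ℓ a * z n x a = 0) → ℓ = 0) :
    Dense {c : κ → Fin N → 𝕂 | ∀ x ∈ C,
      LinearIndependent 𝕂 (combinationMatrix c fun n => z n x)} := by
  classical
  let S : κ → Set (κ → Fin N → 𝕂) := fun p => degenerateParam z p '' (Ω ×ˢ Set.univ)
  have hsub : (⋃ p, S p)ᶜ ⊆ {c : κ → Fin N → 𝕂 | ∀ x ∈ C,
      LinearIndependent 𝕂 (combinationMatrix c fun n => z n x)} := by
    intro c hc x hx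
    rw [linearIndependent_combinationMatrix_iff]
    by_contra! hbad
    obtain ⟨ℓ, hℓ, hne⟩ := hbad
    obtain ⟨p, hp⟩ : ∃ p, ∑ a, ℓ a * z p x a ≠ 0 := by
      by_contra! h
      exact hne (hspan x hx ℓ h)
    -- Normalize `ℓ` by `ℓ(z_p(x)) = 1` and solve the equations for the coefficients `c_{p,j}`.
    refine hc (Set.mem_iUnion.2 ⟨p, ?_⟩)
    set r := ∑ a, ℓ a * z p x a with hr
    refine ⟨(x, r⁻¹ • ℓ, fun n => c n), ⟨hC hx, trivial⟩, ?_⟩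
    funext n j
    by_cases h : n ≠ p
    · simp [degenerateParam, h]
    · simp only [degenerateParam, dif_neg h]
      obtain rfl : n = p := not_not.1 h
      have h1 : ∀ n', ∑ a, (r⁻¹ • ℓ) a * z n' x a = r⁻¹ * ∑ a, ℓ a * z n' x a := fun n' => by
        rw [Finset.mul_sum]
        exact Finset.sum_congr rfl fun a _ => by simp [mul_assoc]
      simp only [h1]
      have h2 := hℓ j
      rw [Fintype.sum_eq_add_sum_subtype_ne _ n, ← hr] at h2
      have h3 : ∑ n' : {n' // n' ≠ n}, c n' j * (r⁻¹ * ∑ a, ℓ a * z n' x a) =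
          r⁻¹ * ∑ n' : {n' // n' ≠ n}, c n' j * ∑ a, ℓ a * z n' x a := by
        rw [Finset.mul_sum]
        exact Finset.sum_congr rfl fun _ _ => by ring
      rw [h3, eq_neg_of_add_eq_zero_right h2]
      field_simp
  refine Dense.mono hsub ?_
  rcases isEmpty_or_nonempty κ with hκ | hκ
  · simp
  refine dense_compl_of_dimH_lt_finrank ?_
  have hdim : ∀ p, dimH (S p) ≤
      ((m + k * Module.finrank ℝ 𝕂 + (Fintype.card κ - 1) * (N * Module.finrank ℝ 𝕂) : ℕ) :
        ENNReal) := fun p => by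
    calc dimH (S p) ≤ dimH (Ω ×ˢ Set.univ :
          Set (EuclideanSpace ℝ (Fin m) × (Fin k → 𝕂) × ({n // n ≠ p} → Fin N → 𝕂))) := by
          refine dimH_image_le_of_locally_lipschitzOn fun q hq => ?_
          obtain ⟨K, t, ht, hL⟩ := (contDiffAt_degenerateParam (N := N) p q fun n =>
            (hz n).contDiffAt (hΩ.mem_nhds hq.1)).exists_lipschitzOnWith
          exact ⟨K, t, mem_nhdsWithin_of_mem_nhds ht, hL⟩
      _ ≤ dimH (Set.univ :
          Set (EuclideanSpace ℝ (Fin m) × (Fin k → 𝕂) × ({n // n ≠ p} → Fin N → 𝕂))) :=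
          dimH_mono (Set.subset_univ _)
      _ = _ := by
          rw [Real.dimH_univ_eq_finrank]
          congr 1
          simp [Module.finrank_pi_fintype, Fintype.card_subtype_compl]
          ring
  rw [dimH_iUnion]
  refine lt_of_le_of_lt (iSup_le hdim) (Nat.cast_lt.2 ?_)
  -- With `d = dim_ℝ 𝕂`, what is left is `m + k d < N d`.
  have hd : 0 < Module.finrank ℝ 𝕂 := Module.finrank_pos
  obtain ⟨d, hd'⟩ : ∃ d, Module.finrank ℝ 𝕂 = d := ⟨_, rfl⟩
  obtain ⟨s, hs⟩ : ∃ s, Fintype.card κ = s + 1 := ⟨_, (Nat.succ_pred Fintype.card_ne_zero).symm⟩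
  simp only [Module.finrank_pi_fintype, Finset.sum_const, Finset.card_univ, Fintype.card_fin,
    smul_eq_mul, hs, Nat.add_sub_cancel, hd'] at hd ⊢
  nlinarith [Nat.mul_le_mul_right d hN, Nat.le_mul_of_pos_right m hd]

end Transversality

/-! ### Connected paracompact spaces are `σ`-compact -/

section SigmaCompact

/-- A connected paracompact locally compact Hausdorff space is `σ`-compact: starting from one
member of a locally finite cover by relatively compact open sets, the members reached in finitely
many steps of overlapping sets form a clopen set, and there are countably many of them. -/
theorem sigmaCompactSpace_of_connected (X : Type*) [TopologicalSpace X] [T2Space X]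
    [LocallyCompactSpace X] [ParacompactSpace X] [ConnectedSpace X] : SigmaCompactSpace X := by
  choose K hK hKx using fun x : X => exists_compact_mem_nhds x
  obtain ⟨v, hvo, hvc, hvl, hvK⟩ := precise_refinement (fun x => interior (K x))
    (fun x => isOpen_interior) (Set.iUnion_eq_univ_iff.2 fun x =>
      ⟨x, mem_interior_iff_mem_nhds.2 (hKx x)⟩)
  have hcomp : ∀ x, IsCompact (closure (v x)) := fun x =>
    (hK x).of_isClosed_subset isClosed_closure
      (closure_minimal ((hvK x).trans interior_subset) (hK x).isClosed)
  have hfin : ∀ x, {y | (v y ∩ closure (v x)).Nonempty}.Finite := fun x =>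
    hvl.finite_nonempty_inter_compact (hcomp x)
  obtain ⟨p⟩ : Nonempty X := inferInstance
  obtain ⟨x₀, hx₀⟩ := Set.mem_iUnion.1 (hvc.symm ▸ Set.mem_univ p : p ∈ ⋃ x, v x)
  let S : ℕ → Set X := fun n => Nat.rec {x₀}
    (fun _ T => ⋃ x ∈ T, {y | (v y ∩ closure (v x)).Nonempty}) n
  have hS : ∀ n, (S n).Finite := fun n => by
    induction n with
    | zero => exact Set.finite_singleton x₀
    | succ n ih => exact ih.biUnion fun x _ => hfin x
  let U : Set X := ⋃ n, ⋃ x ∈ S n, v x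
  have hUo : IsOpen U := isOpen_iUnion fun n => isOpen_biUnion fun x _ => hvo x
  have hUc : IsClosed U := by
    refine ⟨isOpen_iff_forall_mem_open.2 fun y hy => ?_⟩
    obtain ⟨z, hz⟩ := Set.mem_iUnion.1 (hvc.symm ▸ Set.mem_univ y : y ∈ ⋃ x, v x)
    refine ⟨v z, fun w hw hwU => hy ?_, hvo z, hz⟩
    obtain ⟨n, hn⟩ := Set.mem_iUnion.1 hwU
    obtain ⟨x, hx, hwx⟩ := Set.mem_iUnion₂.1 hn
    refine Set.mem_iUnion.2 ⟨n + 1, Set.mem_iUnion₂.2 ⟨z, ?_, hz⟩⟩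
    exact Set.mem_iUnion₂.2 ⟨x, hx, w, hw, subset_closure hwx⟩
  have hU : U = Set.univ := IsClopen.eq_univ ⟨hUc, hUo⟩
    ⟨p, Set.mem_iUnion.2 ⟨0, Set.mem_iUnion₂.2 ⟨x₀, rfl, hx₀⟩⟩⟩
  refine ⟨⟨fun n => ⋃ x ∈ S n, closure (v x), fun n => (hS n).isCompact_biUnion fun x _ => hcomp x,
    Set.eq_univ_of_univ_subset ?_⟩⟩
  rw [← hU]
  exact Set.iUnion_mono fun n => Set.iUnion₂_mono fun x _ => subset_closure

end SigmaCompact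

/-! ### Finitely many generating sections -/

theorem continuous_combinationMatrix {k N : ℕ} {𝕂 : Type*} [RCLike 𝕂] {κ : Type*} [Fintype κ] :
    Continuous fun q : (κ → Fin N → 𝕂) × (κ → Fin k → 𝕂) => combinationMatrix q.1 q.2 := by
  unfold combinationMatrix
  fun_prop

namespace SmoothVectorBundle

variable {m : ℕ} {𝕂 : Type*} [RCLike 𝕂]
  {M : Type*} [TopologicalSpace M] [ChartedSpace (EuclideanSpace ℝ (Fin m)) M]
  {V : Type*} [AddCommGroup V] [Module 𝕂 V] [FiniteDimensional 𝕂 V]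
  {E : M → Type*} [∀ x, AddCommGroup (E x)] [∀ x, Module 𝕂 (E x)]
  (A : SmoothVectorBundle m 𝕂 M V E)

omit [FiniteDimensional 𝕂 V] in
theorem sum_sections_apply {κ : Type*} (s : Finset κ) (Z : κ → A.sections) (x : M) :
    (∑ p ∈ s, Z p).1 x = ∑ p ∈ s, (Z p).1 x := by
  rw [AddSubmonoidClass.coe_finsetSum, Finset.sum_apply]

theorem finsum_mem_sections {κ : Type*} (Z : κ → A.sections) {u : κ → Set M}
    (hu : LocallyFinite u) (hZ : ∀ p x, x ∉ u p → (Z p).1 x = 0) :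
    (fun x => ∑ᶠ p, (Z p).1 x) ∈ A.sections := by
  classical
  refine A.mem_sections_of_locally fun x => ?_
  obtain ⟨t, ht, hfin⟩ := hu x
  obtain ⟨t', ht', hto, hxt⟩ := mem_nhds_iff.1 ht
  obtain ⟨i, hi⟩ := A.cover x
  refine ⟨i, A.U i ∩ t', (A.isOpen_U i).inter hto, ⟨hi, hxt⟩, Set.inter_subset_left, ?_⟩
  refine (((∑ p ∈ hfin.toFinset, Z p).2 i).mono Set.inter_subset_left).congr fun y hy => ?_
  rw [A.localForm_of_mem i _ hy.1, A.localForm_of_mem i _ hy.1, A.sum_sections_apply]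
  congr 1
  refine finsum_eq_sum_of_support_subset _ fun p hp => ?_
  rw [Set.Finite.coe_toFinset]
  by_contra h
  exact hp (hZ p y fun hyu => h ⟨y, hyu, ht' hy.2⟩)

/-- The sum of a locally finite family of smooth sections. -/
def locallyFiniteSum {κ : Type*} (Z : κ → A.sections) {u : κ → Set M}
    (hu : LocallyFinite u) (hZ : ∀ p x, x ∉ u p → (Z p).1 x = 0) : A.sections :=
  ⟨_, A.finsum_mem_sections Z hu hZ⟩

/-- A vector bundle over a `σ`-compact manifold has finitely many smooth sections which generate
every fiber. Starting from a locally finite family of generating sections, the coefficients of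
sufficiently many linear combinations are chosen generically: for each compact piece of the manifold
the good coefficients are open and dense, and Baire's theorem applies. -/
theorem exists_generating_sections [T2Space M] [SigmaCompactSpace M] [IsManifold (𝓡 m) ∞ M] :
    ∃ (N : ℕ) (W : Fin N → A.sections), ∀ x,
      Submodule.span 𝕂 (Set.range fun j => (W j).1 x) = ⊤ := by
  classical
  choose idx hidx using A.cover
  obtain ⟨ι, f, hf⟩ := SmoothBumpCovering.exists_isSubordinate (I := 𝓡 m)
    (isClosed_univ (X := M)) (U := fun x => A.U (idx x))
    fun x _ => (A.isOpen_U _).mem_nhds (hidx x)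
  let i : ι → A.ι := fun n => idx (f.c n)
  have hfi : ∀ n, tsupport (f n) ⊆ A.U (i n) := hf
  have hcount : Countable ι := by
    rw [← Set.countable_univ_iff]
    exact f.locallyFinite.countable_univ fun n => (f n).nonempty_support
  let b := Module.finBasis 𝕂 V
  let k := Module.finrank 𝕂 V
  let Z : ι × Fin k → A.sections := fun p =>
    A.cutoffSection (i p.1) ⟨f p.1, (f p.1).contMDiff⟩ (A.isOpen_U _) subset_rfl (hfi p.1)
      (SmoothMapOn.const (b p.2))
  have hZ0 : ∀ p x, f p.1 x = 0 → (Z p).1 x = 0 := fun p x hx =>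
    A.cutoff_eq_zero (i p.1) (f p.1) (fun _ => b p.2) hx
  have hZ1 : ∀ p x (hx : x ∈ A.U (i p.1)), f p.1 x = 1 →
      (Z p).1 x = (A.chart _ x hx).symm (b p.2) := fun p x hx h1 => by
    refine (A.cutoff_apply (i p.1) (f p.1) (fun _ => b p.2) hx).trans ?_
    rw [h1]; simp
  -- The support sets of the family, indexed by pairs, still form a locally finite family.
  have hlf : LocallyFinite fun p : ι × Fin k => Function.support (f p.1) := fun x => by
    obtain ⟨t, ht, hfin⟩ := f.locallyFinite x
    refine ⟨t, ht, (hfin.prod Set.finite_univ).subset fun p hp => ⟨hp, trivial⟩⟩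
  -- One more than the dimension `m` of the base plus the rank `k`, as the dimension count needs.
  let N := m + k + 1
  let W : (ι × Fin k → Fin N → 𝕂) → Fin N → A.sections := fun c j =>
    A.locallyFiniteSum (fun p => c p j • Z p) hlf fun p x hx => by
      show c p j • (Z p).1 x = 0
      rw [hZ0 p x (Function.notMem_support.1 hx), smul_zero]
  -- The members of the family that are visible on the compact set `tsupport (f n)`.
  have hvis : ∀ n, {p : ι × Fin k |
      (Function.support (f p.1) ∩ tsupport (f n)).Nonempty}.Finite := fun n =>
    hlf.finite_nonempty_inter_compact (f n).hasCompactSupport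
  let F : ι → Finset (ι × Fin k) := fun n => (hvis n).toFinset
  have hF : ∀ n p x, x ∈ tsupport (f n) → p ∉ F n → (Z p).1 x = 0 := fun n p x hx hp =>
    hZ0 p x (by
      by_contra h
      exact hp ((hvis n).mem_toFinset.2 ⟨x, h, hx⟩))
  let ζ : ∀ n, F n → M → Fin k → 𝕂 := fun n p x a => b.coord a (A.localForm (i n) (Z p).1 x)
  have hζ : ∀ n (p : F n) a, ContMDiffOn (𝓡 m) 𝓘(ℝ, 𝕂) ∞ (fun x => ζ n p x a) (A.U (i n)) :=
    fun n p a => (Z p).2 (i n) (b.coord a)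
  let G : ι → Set (ι × Fin k → Fin N → 𝕂) := fun n => {c | ∀ x ∈ tsupport (f n),
    LinearIndependent 𝕂 (combinationMatrix (fun p : F n => c p) fun p => ζ n p x)}
  have hspan : ∀ n, ∀ x ∈ tsupport (f n), ∀ ℓ : Fin k → 𝕂,
      (∀ p : F n, ∑ a, ℓ a * ζ n p x a = 0) → ℓ = 0 := by
    intro n x hx ℓ hℓ
    obtain ⟨n', hn'⟩ := f.eventuallyEq_one' x trivial
    have h1 : f n' x = 1 := hn'.self_of_nhds
    have hx' : x ∈ A.U (i n') := hfi n' (subset_tsupport _ (by simp [h1]))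
    let T : V →ₗ[𝕂] 𝕂 := ∑ a, ℓ a • b.coord a
    have hT : T ∘ₗ (A.chart (i n) x (hfi n hx)).toLinearMap ∘ₗ
        (A.chart (i n') x hx').symm.toLinearMap = 0 := b.ext fun a' => by
      have hp : (n', a') ∈ F n := (hvis n).mem_toFinset.2 ⟨x, by simp [h1], hx⟩
      have := hℓ ⟨(n', a'), hp⟩
      simp only [ζ, A.localForm_of_mem _ _ (hfi n hx), hZ1 (n', a') x hx' h1] at this
      simpa [T] using this
    have hT0 : T = 0 := LinearMap.ext fun v => by
      have := LinearMap.congr_fun hT ((A.chart (i n') x hx') ((A.chart (i n) x (hfi n hx)).symm v))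
      simpa using this
    funext a
    have := LinearMap.congr_fun hT0 (b a)
    simpa [T, Finsupp.single_apply] using this
  have hGo : ∀ n, IsOpen (G n) := by
    intro n
    rw [isOpen_iff_mem_nhds]
    intro c hc
    refine IsCompact.eventually_forall_of_forall_eventually (x₀ := c)
      (K := tsupport (f n)) (f n).hasCompactSupport
      (P := fun c x => LinearIndependent 𝕂
        (combinationMatrix (fun p : F n => c p) fun p => ζ n p x)) fun x hx => ?_
    have hcont : ContinuousAt (fun q : (ι × Fin k → Fin N → 𝕂) × M =>
        combinationMatrix (fun p : F n => q.1 p) fun p => ζ n p q.2) (c, x) := by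
      refine ContinuousAt.comp (g := fun q : (F n → Fin N → 𝕂) × (F n → Fin k → 𝕂) =>
        combinationMatrix q.1 q.2)
        (f := fun q : (ι × Fin k → Fin N → 𝕂) × M => ((fun p : F n => q.1 p), fun p => ζ n p q.2))
        continuous_combinationMatrix.continuousAt (ContinuousAt.prodMk (by fun_prop) ?_)
      refine continuousAt_pi.2 fun p => continuousAt_pi.2 fun a => ?_
      exact ContinuousAt.comp (f := Prod.snd) (g := fun x => ζ n p x a)
        ((hζ n p a).continuousOn.continuousAt ((A.isOpen_U _).mem_nhds (hfi n hx)))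
        continuousAt_snd
    exact hcont.eventually (isOpen_setOfPred_linearIndependent.mem_nhds (hc x hx))
  have hGd : ∀ n, Dense (G n) := by
    intro n
    let ξ := chartAt (EuclideanSpace ℝ (Fin m)) (f.c n)
    have hξ : ξ ∈ IsManifold.maximalAtlas (𝓡 m) ∞ M := IsManifold.chart_mem_maximalAtlas _
    have hCξ : tsupport (f n) ⊆ ξ.source := (f n).tsupport_subset_chartAt_source
    have hd := dense_setOf_linearIndependent_combination (N := N) (Nat.lt_succ_self _)
      (z := fun (p : F n) y => ζ n p (ξ.symm y)) (C := ξ '' tsupport (f n))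
      (Ω := ξ.target ∩ ξ.symm ⁻¹' A.U (i n))
      (ξ.isOpen_inter_preimage_symm (A.isOpen_U _)) ?_ ?_ ?_
    -- Only the coefficients visible on `tsupport (f n)` matter: perturb these and keep the others.
    · intro c
      let ext : (F n → Fin N → 𝕂) → (ι × Fin k → Fin N → 𝕂) := fun c' p =>
        if h : p ∈ F n then c' ⟨p, h⟩ else c p
      have hext : Continuous ext := continuous_pi fun p => by
        by_cases h : p ∈ F n
        · simp only [ext, dif_pos h]; fun_prop
        · simp only [ext, dif_neg h]; fun_prop
      have hextc : ext (fun p => c p) = c := funext fun p => by simp [ext]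
      have := map_mem_closure hext (hd fun p => c p) (t := G n) fun c' hc' x hx => by
        have h := hc' _ ⟨x, hx, rfl⟩
        simp only [ξ.left_inv (hCξ hx)] at h
        have : (fun p : F n => ext c' p) = c' := funext fun p => by simp [ext]
        rw [this]
        exact h
      rwa [hextc] at this
    · rintro _ ⟨x, hx, rfl⟩
      exact ⟨ξ.map_source (hCξ hx), by simpa [ξ.left_inv (hCξ hx)] using hfi n hx⟩
    · intro p
      refine contDiffOn_pi.2 fun a => ?_
      exact (contDiffOn_comp_chart_symm hξ (hζ n p a)).of_le (by simp)
    · rintro _ ⟨x, hx, rfl⟩ ℓ hℓ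
      refine hspan n x hx ℓ fun p => ?_
      simpa [ξ.left_inv (hCξ hx)] using hℓ p
  obtain ⟨c, hc⟩ := (dense_iInter_of_isOpen hGo hGd).nonempty
  refine ⟨N, W c, fun x => ?_⟩
  obtain ⟨n, hn⟩ := f.eventuallyEq_one' x trivial
  have h1 : f n x = 1 := hn.self_of_nhds
  have hxn : x ∈ tsupport (f n) := subset_tsupport _ (by simp [h1])
  have hLI := (linearIndependent_combinationMatrix_iff _ _).1 (Set.mem_iInter.1 hc n x hxn)
  -- A functional vanishing on all `W c j` at `x` contradicts the choice of `c`.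
  by_contra hne
  obtain ⟨T, hT0, hT⟩ := Submodule.exists_le_ker_of_lt_top _ (lt_top_iff_ne_top.2 hne)
  refine hT0 ?_
  let χ := A.chart (i n) x (hfi n hxn)
  have hz := hLI (fun a => T (χ.symm (b a))) fun j => by
    have hW : (W c j).1 x = ∑ p : F n, c p j • (Z p).1 x := by
      refine (finsum_eq_sum_of_support_subset (s := F n) _ fun p hp => ?_).trans
        (Finset.sum_coe_sort (F n) fun p => c p j • (Z p).1 x).symm
      by_contra h
      refine hp ?_
      show c p j • (Z p).1 x = 0
      rw [hF n p x hxn h, smul_zero]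
    have h2 : T ((W c j).1 x) = 0 := hT (Submodule.subset_span ⟨j, rfl⟩)
    rw [hW, map_sum] at h2
    rw [← h2]
    refine Finset.sum_congr rfl fun p _ => ?_
    rw [map_smul, smul_eq_mul]
    congr 1
    have h3 : (Z p).1 x = χ.symm (∑ a, b.coord a (χ ((Z p).1 x)) • b a) := by
      rw [show ∑ a, b.coord a (χ ((Z p).1 x)) • b a = χ ((Z p).1 x) from b.sum_repr _,
        LinearEquiv.symm_apply_apply]
    rw [h3, map_sum, map_sum]
    refine Finset.sum_congr rfl fun a _ => ?_
    simp only [ζ, A.localForm_of_mem _ _ (hfi n hxn), map_smul, smul_eq_mul]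
    rw [mul_comm]
  have hTχ : T ∘ₗ χ.symm.toLinearMap = 0 := b.ext fun a => congrFun hz a
  refine LinearMap.ext fun v => ?_
  have := LinearMap.congr_fun hTχ (χ v)
  simpa using this

end SmoothVectorBundle

/-! ### Smooth right inverses -/

section Adjugate

variable {m k : ℕ} {𝕂 : Type*} [RCLike 𝕂]

theorem contDiff_det : ContDiff ℝ ∞ (fun T : Fin k → Fin k → 𝕂 => (Matrix.of T).det) := by
  simp only [Matrix.det_apply, Matrix.of_apply]
  refine ContDiff.sum fun σ _ => ContDiff.const_smul _ (contDiff_prod fun i _ => ?_)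
  fun_prop

theorem contDiff_adjugate (a c : Fin k) :
    ContDiff ℝ ∞ (fun T : Fin k → Fin k → 𝕂 => (Matrix.of T).adjugate a c) := by
  simp only [Matrix.adjugate_apply]
  have h : ContDiff ℝ ∞ (fun T : Fin k → Fin k → 𝕂 =>
      (Function.update T c (Pi.single a 1) : Fin k → Fin k → 𝕂)) := contDiff_pi.2 fun r => by
    by_cases h : r = c
    · subst h
      simpa using contDiff_const
    · simp only [Function.update_of_ne h]
      exact contDiff_apply ℝ (Fin k → 𝕂) r
  exact contDiff_det.comp h

variable {M : Type*} [TopologicalSpace M] [ChartedSpace (EuclideanSpace ℝ (Fin m)) M]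
  {V : Type*} [AddCommGroup V] [Module 𝕂 V] [FiniteDimensional 𝕂 V]

/-- A smooth family of endomorphisms which is the identity at `x₀` has a smooth family of right
inverses near `x₀`. -/
theorem exists_smooth_right_inverse {T : M → V →ₗ[𝕂] V} {O : Set M} (hO : IsOpen O) {x₀ : M}
    (hx₀ : x₀ ∈ O) (hT : SmoothMapOn m 𝕂 T O) (h1 : T x₀ = LinearMap.id) :
    ∃ u, IsOpen u ∧ x₀ ∈ u ∧ u ⊆ O ∧ ∃ Q : M → V →ₗ[𝕂] V, SmoothMapOn m 𝕂 Q u ∧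
      ∀ x ∈ u, T x ∘ₗ Q x = LinearMap.id := by
  let b := Module.finBasis 𝕂 V
  let Tm : M → Fin (Module.finrank 𝕂 V) → Fin (Module.finrank 𝕂 V) → 𝕂 := fun x =>
    LinearMap.toMatrix b b (T x)
  have hTm : ContMDiffOn (𝓡 m) 𝓘(ℝ, Fin (Module.finrank 𝕂 V) → Fin (Module.finrank 𝕂 V) → 𝕂) ∞
      Tm O := by
    refine contMDiffOn_pi_space.2 fun a => contMDiffOn_pi_space.2 fun c => ?_
    refine (hT (b.coord a ∘ₗ LinearMap.applyₗ (b c))).congr fun x _ => ?_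
    simp [Tm, LinearMap.toMatrix_apply]
  have hdet : ContMDiffOn (𝓡 m) 𝓘(ℝ, 𝕂) ∞ (fun x => (Matrix.of (Tm x)).det) O :=
    contDiff_det.contMDiff.comp_contMDiffOn hTm
  have hdet1 : (Matrix.of (Tm x₀)).det = 1 := by
    show (LinearMap.toMatrix b b (T x₀)).det = 1
    rw [h1]; simp
  let u : Set M := O ∩ (fun x => (Matrix.of (Tm x)).det) ⁻¹' {0}ᶜ
  have hu : IsOpen u := hdet.continuousOn.isOpen_inter_preimage hO isOpen_compl_singleton
  have hinv : ContMDiffOn (𝓡 m) 𝓘(ℝ, 𝕂) ∞ (fun x => ((Matrix.of (Tm x)).det)⁻¹) u := fun x hx =>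
    ((contDiffAt_inv ℝ (n := ∞) hx.2).contMDiffAt.comp x
      (hdet.contMDiffAt (hO.mem_nhds hx.1))).contMDiffWithinAt
  refine ⟨u, hu, ⟨hx₀, by simp [hdet1]⟩, Set.inter_subset_left,
    fun x => ((Matrix.of (Tm x)).det)⁻¹ • Matrix.toLin b b (Matrix.of (Tm x)).adjugate, ?_, ?_⟩
  · refine SmoothMapOn.smul hinv (SmoothMapOn.of_apply fun v => ?_)
    have : SmoothMapOn m 𝕂 (fun x => ∑ a, (∑ c, (Matrix.of (Tm x)).adjugate a c * b.repr v c) • b a)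
        u := by
      refine SmoothMapOn.sum _ fun a _ => SmoothMapOn.smul ?_ (SmoothMapOn.const (b a))
      refine contMDiffOn_finsetSum fun c _ => contMDiffOn_mul_rclike ?_ contMDiffOn_const
      exact (contDiff_adjugate a c).contMDiff.comp_contMDiffOn (hTm.mono Set.inter_subset_left)
    refine this.congr fun x _ => ?_
    rw [Matrix.toLin_apply]
    rfl
  · intro x hx
    have h2 : T x = Matrix.toLin b b (Matrix.of (Tm x)) :=
      (Matrix.toLin_toMatrix b b (T x)).symm
    rw [LinearMap.comp_smul, h2, ← Matrix.toLin_mul b b b, Matrix.mul_adjugate, map_smul,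
      Matrix.toLin_one, smul_smul, inv_mul_cancel₀ hx.2, one_smul]

end Adjugate

/-! ### Sections as sums of brackets -/

namespace LieAlgebraBundle

variable {m : ℕ} {𝕂 : Type*} [RCLike 𝕂]
  {M : Type*} [TopologicalSpace M] [ChartedSpace (EuclideanSpace ℝ (Fin m)) M]
  {𝔨 : Type*} [LieRing 𝔨] [LieAlgebra 𝕂 𝔨] [FiniteDimensional 𝕂 𝔨]
  {L : M → Type*} [∀ x, LieRing (L x)] [∀ x, LieAlgebra 𝕂 (L x)]
  (A : LieAlgebraBundle m 𝕂 M 𝔨 L)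

/-- In a perfect Lie algebra every element is a sum of brackets with the members of any given
generating system of the vector space, and this can be done linearly. -/
theorem exists_linear_bracket_decomposition
    (h𝔨 : ⁅(⊤ : LieIdeal 𝕂 𝔨), (⊤ : LieIdeal 𝕂 𝔨)⁆ = ⊤) {N : ℕ} (w : Fin N → 𝔨)
    (hw : Submodule.span 𝕂 (Set.range w) = ⊤) :
    ∃ R : 𝔨 →ₗ[𝕂] (Fin N → 𝔨), ∀ v, ∑ j, ⁅R v j, w j⁆ = v := by
  let B : (Fin N → 𝔨) →ₗ[𝕂] 𝔨 :=
    { toFun := fun y => ∑ j, ⁅y j, w j⁆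
      map_add' := fun y y' => by simp [Finset.sum_add_distrib]
      map_smul' := fun r y => by simp [Finset.smul_sum] }
  have hB : ∀ y, B y = ∑ j, ⁅y j, w j⁆ := fun _ => rfl
  have hlie : ∀ u v : 𝔨, ⁅u, v⁆ ∈ LinearMap.range B := fun u v => by
    have hv : v ∈ Submodule.span 𝕂 (Set.range w) := hw ▸ Submodule.mem_top
    induction hv using Submodule.span_induction with
    | mem v hv =>
      obtain ⟨j, rfl⟩ := hv
      refine ⟨Pi.single j u, ?_⟩
      rw [hB, Finset.sum_eq_single j (fun l _ hl => by simp [Pi.single_eq_of_ne hl]) (by simp)]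
      simp
    | zero => rw [lie_zero]; exact Submodule.zero_mem _
    | add v v' _ _ h h' => rw [lie_add]; exact Submodule.add_mem _ h h'
    | smul r v _ h => rw [lie_smul]; exact Submodule.smul_mem _ r h
  have hsurj : LinearMap.range B = ⊤ := by
    have h := congrArg LieSubmodule.toSubmodule h𝔨
    rw [LieSubmodule.lieIdeal_oper_eq_linear_span'] at h
    refine top_le_iff.1 (h.symm.le.trans (Submodule.span_le.2 ?_))
    rintro _ ⟨u, -, v, -, rfl⟩
    exact hlie u v
  obtain ⟨R, hR⟩ := B.exists_rightInverse_of_surjective hsurj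
  exact ⟨R, fun v => LinearMap.congr_fun hR v⟩

/-- Around each point, a smooth section `X` is a sum of brackets with given generating sections.
The linear decomposition at `z` is corrected by a smooth right inverse, so the first factors depend
linearly on the value of `X` at each point and vanish where `X` does. -/
theorem exists_local_bracket_decomposition [T2Space M] [IsManifold (𝓡 m) ∞ M]
    (h𝔨 : ⁅(⊤ : LieIdeal 𝕂 𝔨), (⊤ : LieIdeal 𝕂 𝔨)⁆ = ⊤) {N : ℕ} (W : Fin N → A.sections)
    (hW : ∀ x, Submodule.span 𝕂 (Set.range fun j => (W j).1 x) = ⊤) (X : A.sections) (z : M) :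
    ∃ (O : Set M) (Y : Fin N → A.sections), IsOpen O ∧ z ∈ O ∧
      (∀ x, X.1 x = 0 → ∀ j, (Y j).1 x = 0) ∧
      ∀ x ∈ O, ∑ j, ⁅(Y j).1 x, (W j).1 x⁆ = X.1 x := by
  obtain ⟨i, hi⟩ := A.cover z
  have hspan : Submodule.span 𝕂 (Set.range fun j => A.localForm i (W j).1 z) = ⊤ := by
    have h1 : (Set.range fun j => A.localForm i (W j).1 z) =
        (A.chart i z hi).toLinearMap '' Set.range fun j => (W j).1 z := by
      rw [← Set.range_comp]
      congr 1
      funext j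
      exact A.localForm_of_mem i _ hi
    rw [h1, Submodule.span_image, hW, Submodule.map_top, LinearEquiv.range]
  obtain ⟨R, hR⟩ := exists_linear_bracket_decomposition h𝔨 _ hspan
  let ad : 𝔨 →ₗ[𝕂] 𝔨 →ₗ[𝕂] 𝔨 := (LieModule.toEnd 𝕂 𝔨 𝔨 : 𝔨 →ₗ[𝕂] Module.End 𝕂 𝔨)
  have had : ∀ u v, ad u v = ⁅u, v⁆ := fun _ _ => rfl
  let T : M → 𝔨 →ₗ[𝕂] 𝔨 := fun x =>
    ∑ j, ad.flip (A.localForm i (W j).1 x) ∘ₗ LinearMap.proj j ∘ₗ R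
  have hTv : ∀ x v, T x v = ∑ j, ⁅R v j, A.localForm i (W j).1 x⁆ := fun x v => by
    simp [T, had]
  have hT : SmoothMapOn m 𝕂 T (A.U i) := SmoothMapOn.of_apply fun v => by
    simp only [hTv]
    exact SmoothMapOn.sum _ fun j _ => ((W j).2 i).map (ad (R v j))
  obtain ⟨u, hu, hzu, hui, Q, hQ, hTQ⟩ := exists_smooth_right_inverse (A.isOpen_U i) hi hT
    (LinearMap.ext fun v => by rw [hTv, hR]; rfl)
  obtain ⟨χ, hχ, hχ1⟩ := exists_smooth_bump (m := m) z (hu.mem_nhds hzu)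
  obtain ⟨t, ht, hto, hzt⟩ := eventually_nhds_iff.1 hχ1
  have hY : ∀ j, SmoothMapOn m 𝕂 (fun x => R (Q x (A.localForm i X.1 x)) j) u := fun j =>
    (SmoothMapOn.bilin LinearMap.id hQ ((X.2 i).mono hui)).map (LinearMap.proj j ∘ₗ R)
  refine ⟨t ∩ u, fun j => A.cutoffSection i χ hu hui hχ (hY j), hto.inter hu, ⟨hzt, hzu⟩,
    fun x hx j => ?_, fun x hx => ?_⟩
  · by_cases hxi : x ∈ A.U i
    · rw [A.cutoffSection_apply i χ _ _ _ _ hxi, A.localForm_of_mem i _ hxi, hx]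
      simp
    · exact A.cutoff_eq_zero i χ (fun x => R (Q x (A.localForm i X.1 x)) j)
        (image_eq_zero_of_notMem_tsupport fun h => hxi (hui (hχ h)))
  · have hxi := hui hx.2
    refine (A.chart i x hxi).injective ?_
    rw [map_sum, ← A.localForm_of_mem i X.1 hxi]
    have h1 : ∀ j, A.chart i x hxi ⁅(A.cutoffSection i χ hu hui hχ (hY j)).1 x, (W j).1 x⁆ =
        ⁅R (Q x (A.localForm i X.1 x)) j, A.localForm i (W j).1 x⁆ := fun j => by
      rw [A.chart_lie, A.cutoffSection_apply i χ _ _ _ _ hxi, LinearEquiv.apply_symm_apply,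
        ht x hx.1, ← A.localForm_of_mem i (W j).1 hxi]
      simp
    rw [Finset.sum_congr rfl fun j _ => h1 j, ← hTv]
    exact LinearMap.congr_fun (hTQ x hx.2) _

/-- If `𝔨` is perfect then `Γ(L)` is perfect, and the first factors of the brackets can be chosen to
vanish wherever the given section does. The number of brackets is finite because finitely many
sections generate all fibers; for fixed second factors the local decompositions can be patched by
a partition of unity. A locally finite sum of brackets would not do, since an `x`-derivation is not
known to be local. -/
theorem exists_bracket_decomposition [T2Space M] [SigmaCompactSpace M] [IsManifold (𝓡 m) ∞ M]
    (h𝔨 : ⁅(⊤ : LieIdeal 𝕂 𝔨), (⊤ : LieIdeal 𝕂 𝔨)⁆ = ⊤) (X : A.sections) :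
    ∃ (N : ℕ) (Y W : Fin N → A.sections), (∀ x, X.1 x = 0 → ∀ j, (Y j).1 x = 0) ∧
      X = ∑ j, ⁅Y j, W j⁆ := by
  obtain ⟨N, W, hW⟩ := A.exists_generating_sections
  choose O Y hO hzO hY0 hYX using A.exists_local_bracket_decomposition h𝔨 W hW X
  obtain ⟨ρ, hρ⟩ := SmoothPartitionOfUnity.exists_isSubordinate (𝓡 m) (isClosed_univ (X := M)) O hO
    (fun z _ => Set.mem_iUnion.2 ⟨z, hzO z⟩)
  have h0 : ∀ j z x, x ∉ Function.support (ρ z) → (A.smulSection (ρ z) (Y z j)).1 x = 0 :=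
    fun j z x hx => by
      rw [A.smulSection_apply, Function.notMem_support.1 hx]
      simp
  refine ⟨N, fun j => A.locallyFiniteSum (fun z => A.smulSection (ρ z) (Y z j))
    ρ.locallyFinite (h0 j), W, fun x hx j => ?_, Subtype.ext <| funext fun x => ?_⟩
  · refine finsum_eq_zero_of_forall_eq_zero fun z => ?_
    rw [A.smulSection_apply, hY0 z x hx j, smul_zero]
  · have hfin : (Function.support fun z => ρ z x).Finite := ρ.locallyFinite.point_finite x
    rw [A.sum_sections_apply]
    have h1 : ∀ j, (⁅A.locallyFiniteSum (fun z => A.smulSection (ρ z) (Y z j))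
        ρ.locallyFinite (h0 j), W j⁆ : A.sections).1 x =
          ∑ z ∈ hfin.toFinset, ((ρ z x : ℝ) : 𝕂) • ⁅(Y z j).1 x, (W j).1 x⁆ := fun j => by
      rw [A.lie_sections_apply]
      have h2 : (A.locallyFiniteSum (fun z => A.smulSection (ρ z) (Y z j))
          ρ.locallyFinite (h0 j)).1 x =
            ∑ z ∈ hfin.toFinset, ((ρ z x : ℝ) : 𝕂) • (Y z j).1 x := by
        refine finsum_eq_sum_of_support_subset _ fun z hz => ?_
        rw [Set.Finite.coe_toFinset]
        by_contra h
        exact hz (h0 j z x h)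
      rw [h2, sum_lie]
      simp only [smul_lie]
    rw [Finset.sum_congr rfl fun j _ => h1 j, Finset.sum_comm]
    have h3 : ∀ z ∈ hfin.toFinset, ∑ j, ((ρ z x : ℝ) : 𝕂) • ⁅(Y z j).1 x, (W j).1 x⁆ =
        ((ρ z x : ℝ) : 𝕂) • X.1 x := fun z hz => by
      have hz' : x ∈ O z := hρ z (subset_tsupport _ (hfin.mem_toFinset.1 hz))
      rw [← Finset.smul_sum, hYX z x hz']
    have h4 : ∑ z ∈ hfin.toFinset, ρ z x = 1 := by
      rw [← ρ.sum_eq_one (Set.mem_univ x)]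
      exact (finsum_eq_sum_of_support_subset _ (by simp)).symm
    rw [Finset.sum_congr rfl h3, ← Finset.sum_smul, ← RCLike.ofReal_sum, h4, RCLike.ofReal_one,
      one_smul]

/-- The defect of an `x`-derivation factors through the value at `x` in both the perfect and the
centerfree case. -/
theorem defectFactors [T2Space M] [ParacompactSpace M] [ConnectedSpace M] [IsManifold (𝓡 m) ∞ M]
    (h𝔨 : ⁅(⊤ : LieIdeal 𝕂 𝔨), (⊤ : LieIdeal 𝕂 𝔨)⁆ = ⊤ ∨ LieAlgebra.center 𝕂 𝔨 = ⊥) :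
    A.DefectFactors := by
  rcases h𝔨 with h | h
  · have := ChartedSpace.locallyCompactSpace (EuclideanSpace ℝ (Fin m)) M
    have := sigmaCompactSpace_of_connected M
    refine A.defectFactors_of_decomposition fun x X hX => ?_
    obtain ⟨N, Y, W, hY, hsum⟩ := A.exists_bracket_decomposition h X
    exact ⟨N, Y, W, hY x hX, hsum⟩
  · exact A.defectFactors_of_center_eq_bot h

end LieAlgebraBundle

end

theorem mainTheorem3
    {m : ℕ} {M : Type uM} [TopologicalSpace M] [ChartedSpace (EuclideanSpace ℝ (Fin m)) M]
    [IsManifold (𝓡 m) ∞ M] [T2Space M] [ParacompactSpace M] [ConnectedSpace M]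
    {𝕂 : Type*} [RCLike 𝕂]
    {𝔨 : Type*} [LieRing 𝔨] [LieAlgebra 𝕂 𝔨] [FiniteDimensional 𝕂 𝔨]
    {L : M → Type*} [∀ x, LieRing (L x)] [∀ x, LieAlgebra 𝕂 (L x)]
    (𝕃 : LieAlgebraBundle m 𝕂 M 𝔨 L)
    (h𝔨 : ⁅(⊤ : LieIdeal 𝕂 𝔨), (⊤ : LieIdeal 𝕂 𝔨)⁆ = ⊤ ∨ LieAlgebra.center 𝕂 𝔨 = ⊥) :
    -- every `x`-derivation is a differential operator of order at most one
    (∀ (x : M) (δ : 𝕃.xDerivations x),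
      IsDiffOpOfOrderLEAt 𝕃.toSmoothVectorBundle 1 x δ.1) ∧
    -- the `x`-derivations form a vector bundle with fiber `Der(𝔨) × Cent(𝔨)^m` ...
    ∃ 𝒟 : SmoothVectorBundle.{_, _, _, _, uM} m 𝕂 M
        (LieDerivation 𝕂 𝔨 𝔨 × (Fin m → lieCentroid 𝕂 𝔨)) (fun x => 𝕃.xDerivations x),
      -- ... such that `D ↦ (x ↦ ev_x ∘ D)` identifies `Der(Γ(𝕃))` with `Γ(𝒟)`,
      (∃ Φ : LieDerivation 𝕂 𝕃.sections 𝕃.sections ≃ₗ[𝕂] 𝒟.sections,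
        ∀ (D : LieDerivation 𝕂 𝕃.sections 𝕃.sections) (x : M) (X : 𝕃.sections),
          ((Φ D).1 x).1 X = (D X).1 x) ∧
      -- and `0 → Der(𝕃) → 𝒟 → TM ⊗ Cent(𝕃) → 0` is a short exact sequence of vector bundles,
      -- the maps being the natural injection and the symbol map
      SmoothVectorBundle.IsBundleMorphism 𝕃.derBundle 𝒟 𝕃.natInj ∧
      ∃ σ : ∀ x, 𝕃.xDerivations x →ₗ[𝕂] CentTensorTangent m 𝕂 L x,
        𝕃.IsSymbolMap σ ∧
        SmoothVectorBundle.IsBundleMorphism 𝒟 𝕃.centTensorTangentBundle σ ∧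
        ∀ x, Function.Injective (𝕃.natInj x) ∧ Function.Exact (𝕃.natInj x) (σ x) ∧
          Function.Surjective (σ x) := by
  have H := 𝕃.defectFactors h𝔨
  exact ⟨𝕃.isDiffOpOfOrderLEAt_one H, 𝕃.xDerivationBundle H,
    ⟨𝕃.derivationEquivSections H, fun _ _ _ => rfl⟩, 𝕃.isBundleMorphism_natInj H,
    𝕃.symbol H, 𝕃.isSymbolMap_symbol H, 𝕃.isBundleMorphism_symbol H,
    fun x => ⟨𝕃.natInj_injective x, 𝕃.exact_natInj_symbol H x, 𝕃.symbol_surjective H x⟩⟩
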